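/- **Setting.** Let $G=(V,E)$ be a locally finite simple graph on a countable vertex set, with degree function $\deg$; write $x\sim y$ for adjacency and $C_c(V)$ for the finitely supported functions in the complex Hilbert space $\ell^2(V)$. A phase is a map $\theta:V\times V\to\mathbb R/2\pi\mathbb Z$ with $\theta(x,y)=-\theta(y,x)$. For $q\ge 0$ the operator $\Delta_\theta+q$ acts as $$(\Delta_\theta+q)\varphi(x)=\sum_{y\sim x}\bigl(\varphi(x)-e^{i\theta(x,y)}\varphi(y)\bigr)+q(x)\varphi(x)$$ on the domain of all $\varphi\in\ell^2(V)$ for which the right-hand side is in $\ell^2(V)$. Functions $V\to\mathbb R$ are identified with their maximal multiplication operators. For operators $T_1,T_2$ we say $T_1\le T_2$ on a subspace $D_0$ of both domains if $\langle\varphi,T_1\varphi\rangle\le\langle\varphi,T_2\varphi\rangle$ for all $\varphi\in D_0$. Let $q_\pm=\max(\pm q,0)$. A function $q:V\to\mathbb R$ is in $\mathcal K^\theta_{0^+}$ if for every $\alpha\in(0,1)$ there is $C_\alpha\ge0$ with $q_-\le\alpha(\Delta_\theta+q_+)+C_\alpha$ on $C_c(V)$; for such $q$, $\Delta_\theta+q$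 denotes the form sum of $\Delta_\theta+q_+$ and $-q_-$, a self-adjoint operator. For $a,k\ge 0$, $(G,q)$ is $(a,k)$-sparse if for every finite $W\subseteq V$ $$2|E_W|\le k|W|+a\Bigl(|\partial W|+\sum_{x\in W}q_+(x)\Bigr),$$ where $|E_W|$ is the number of undirected edges inside $W$ and $|\partial W|$ the number of edges between $W$ and $V\setminus W$; $(G,q)$ is almost sparse if for every $\varepsilon>0$ there is $k_\varepsilon\ge0$ such that it is $(\varepsilon,k_\varepsilon)$-sparse. For $g:V\to\mathbb R$ put $\liminf_{|x|\to\infty}g(x)=\sup_{W\text{ finite}}\inf_{x\notin W}g(x)$, with $\inf\emptyset=\infty$. **Theorem.** Let $\theta$ be a phase, $q\in\mathcal K^\theta_{0^+}$, and let $(G,q)$ be $(a,k)$-sparse for some $a,k\ge0$. Then: (a) There are $\tilde a\in(0,1)$ and $\tilde k\ge0$ such that on $C_c(V)$ $$(1-\tilde a)(\deg+q)-\tilde k\le\Delta_\theta+q\le(1+\tilde a)(\deg+q)+\tilde k .$$ (b) $\mathcal D(|\Delta_\theta+q|^{1/2})=\mathcal D(|\deg+q|^{1/2})$. (c) $\Delta_\theta+q$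 has purely discrete spectrum (that is, empty essential spectrum) if and only if $\liminf_{|x|\to\infty}(\deg+q)(x)=\infty$. If this holds, $V$ is infinite, and $(G,q)$ is moreover almost sparse, then $$\lim_{n\to\infty}\frac{\lambda_n(\Delta_\theta+q)}{\lambda_n(\deg+q)}=1,$$ where $\lambda_n(T)$, $n\ge0$, are the eigenvalues of $T$ below its essential spectrum in increasing order, counted with multiplicity. -/

import Mathlib

noncomputable section

namespace SparseMagnetic

/-! ### Unbounded operators on a complex Hilbert space -/

section Operators

variable {H : Type*} [NormedAddCommGroup H] [InnerProductSpace ℂ H]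

/-- `T₁ ≤ T₂` on `D₀`: the subspace `D₀` lies in both domains and
`⟨φ, T₁ φ⟩ ≤ ⟨φ, T₂ φ⟩` for every `φ ∈ D₀`. -/
def OpLEOn (D₀ : Submodule ℂ H) (T₁ T₂ : H →ₗ.[ℂ] H) : Prop :=
  ∀ φ ∈ D₀, ∃ (h₁ : φ ∈ T₁.domain) (h₂ : φ ∈ T₂.domain),
    (inner ℂ φ (T₁ ⟨φ, h₁⟩)).re ≤ (inner ℂ φ (T₂ ⟨φ, h₂⟩)).re

/-- The domain `{u ∈ D(T) | T u ∈ D(T)}` of the square of `T`. -/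
def sqDomain (T : H →ₗ.[ℂ] H) : Submodule ℂ H :=
  (T.domain.comap T.toFun).map T.domain.subtype

/-- The square `T ∘ T` with its natural domain. -/
def sqOp (T : H →ₗ.[ℂ] H) : H →ₗ.[ℂ] H :=
  T.comp (T.domRestrict (sqDomain T)) (by
    rintro ⟨x, hx, hx'⟩
    obtain ⟨y, hy, hyx⟩ := hx
    have hxy : (T.domRestrict (sqDomain T)) ⟨x, ⟨y, hy, hyx⟩, hx'⟩ = T y :=
      LinearPMap.domRestrict_apply (by simpa using hyx.symm)
    rw [hxy]
    exact hy)

/-- `S` is a nonnegative self-adjoint square root of `A`. -/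
def IsPosSqrt [CompleteSpace H] (A S : H →ₗ.[ℂ] H) : Prop :=
  IsSelfAdjoint S ∧ (∀ u : S.domain, 0 ≤ (inner ℂ (u : H) (S u)).re) ∧ sqOp S = A

open scoped Classical in
/-- The square root `A^{1/2}` of a nonnegative self-adjoint operator `A`: by the spectral theorem
such an `A` has exactly one nonnegative self-adjoint square root, which is the one chosen here.
(The value is irrelevant for other operators.) -/
def posSqrt [CompleteSpace H] (A : H →ₗ.[ℂ] H) : H →ₗ.[ℂ] H :=
  if h : ∃ S, IsPosSqrt A S then h.choose else A

/-- The absolute value `|T| = (T²)^{1/2}` of a self-adjoint operator `T`. -/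
def absOp [CompleteSpace H] (T : H →ₗ.[ℂ] H) : H →ₗ.[ℂ] H :=
  posSqrt (sqOp T)

/-- The domain of `|T|^{1/2}`. -/
def absSqrtDomain [CompleteSpace H] (T : H →ₗ.[ℂ] H) : Submodule ℂ H :=
  (posSqrt (absOp T)).domain

/-- The graph of the operator associated with a sesquilinear form `Q` with domain `D`: all pairs
`(u, w)` with `u ∈ D` and `Q(v, u) = ⟨v, w⟩` for every `v ∈ D`. -/
def formGraph (D : Submodule ℂ H) (Q : D →ₗ⋆[ℂ] D →ₗ[ℂ] ℂ) : Submodule ℂ (H × H) where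
  carrier := {p | ∃ h : p.1 ∈ D, ∀ v : D, Q v ⟨p.1, h⟩ = inner ℂ (v : H) p.2}
  zero_mem' := ⟨D.zero_mem, fun v => by
    have : (⟨(0 : H × H).1, D.zero_mem⟩ : D) = 0 := rfl
    rw [this]
    simp⟩
  add_mem' := by
    rintro a b ⟨ha, ha'⟩ ⟨hb, hb'⟩
    refine ⟨D.add_mem ha hb, fun v => ?_⟩
    have : (⟨(a + b).1, D.add_mem ha hb⟩ : D) = ⟨a.1, ha⟩ + ⟨b.1, hb⟩ := rfl
    rw [this, map_add, ha', hb', Prod.snd_add, inner_add_right]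
  smul_mem' := by
    rintro c a ⟨ha, ha'⟩
    refine ⟨D.smul_mem c ha, fun v => ?_⟩
    have : (⟨(c • a).1, D.smul_mem c ha⟩ : D) = c • ⟨a.1, ha⟩ := rfl
    rw [this, map_smul, ha', Prod.smul_snd, inner_smul_right, smul_eq_mul]

/-- The operator associated with a densely defined sesquilinear form. -/
def formOp (D : Submodule ℂ H) (Q : D →ₗ⋆[ℂ] D →ₗ[ℂ] ℂ) : H →ₗ.[ℂ] H :=
  (formGraph D Q).toLinearPMap

/-- The form `(v, u) ↦ ⟨S v, S u⟩ - ⟨R v, R u⟩` on `D(S) ∩ D(R)`. -/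
def diffForm (S R : H →ₗ.[ℂ] H) :
    (S.domain ⊓ R.domain : Submodule ℂ H) →ₗ⋆[ℂ] (S.domain ⊓ R.domain : Submodule ℂ H) →ₗ[ℂ] ℂ :=
  let s := S.toFun.comp (Submodule.inclusion (inf_le_left : S.domain ⊓ R.domain ≤ S.domain))
  let r := R.toFun.comp (Submodule.inclusion (inf_le_right : S.domain ⊓ R.domain ≤ R.domain))
  LinearMap.mk₂'ₛₗ (starRingEnd ℂ) (RingHom.id ℂ)
    (fun v u => inner ℂ (s v) (s u) - inner ℂ (r v) (r u))
    (fun v v' u => by simp only [map_add, inner_add_left]; ring)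
    (fun c v u => by simp only [map_smul, inner_smul_left, smul_eq_mul]; ring)
    (fun v u u' => by simp only [map_add, inner_add_right]; ring)
    (fun c v u => by simp only [map_smul, inner_smul_right, smul_eq_mul, RingHom.id_apply]; ring)

/-- The form sum of `A` and `-B` for nonnegative self-adjoint operators `A` and `B`: the operator
associated with the form `⟨A^{1/2} v, A^{1/2} u⟩ - ⟨B^{1/2} v, B^{1/2} u⟩` on
`D(A^{1/2}) ∩ D(B^{1/2})`. If `B ≤ α A + C` in the form sense with `α < 1`, then the form domain is
`D(A^{1/2})` and this is the self-adjoint operator given by the KLMN theorem. -/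
def formSumSub [CompleteSpace H] (A B : H →ₗ.[ℂ] H) : H →ₗ.[ℂ] H :=
  formOp _ (diffForm (posSqrt A) (posSqrt B))

/-- The resolvent set: `T - z` is a bijection from `D(T)` onto `H` with bounded inverse. -/
def resolventSet (T : H →ₗ.[ℂ] H) : Set ℂ :=
  {z | ∃ R : H →L[ℂ] H,
    (∀ w : H, ∃ h : R w ∈ T.domain, T ⟨R w, h⟩ - z • R w = w) ∧
    ∀ u : T.domain, R (T u - z • (u : H)) = u}

/-- The spectrum `σ(T)`. -/
def opSpectrum (T : H →ₗ.[ℂ] H) : Set ℂ := (resolventSet T)ᶜ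

/-- The eigenspace `ker (T - z)`. -/
def opEigenspace (T : H →ₗ.[ℂ] H) (z : ℂ) : Submodule ℂ H :=
  (LinearMap.ker (T.toFun - z • T.domain.subtype)).map T.domain.subtype

/-- The discrete spectrum: isolated points of the spectrum which are eigenvalues of finite
multiplicity. -/
def discreteSpectrum (T : H →ₗ.[ℂ] H) : Set ℂ :=
  {z | z ∈ opSpectrum T ∧ (∃ ε > 0, opSpectrum T ∩ Metric.ball z ε ⊆ {z}) ∧
    opEigenspace T z ≠ ⊥ ∧ FiniteDimensional ℂ (opEigenspace T z)}

/-- The essential spectrum. -/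
def essSpectrum (T : H →ₗ.[ℂ] H) : Set ℂ := opSpectrum T \ discreteSpectrum T

/-- `T` has purely discrete spectrum. -/
def HasPurelyDiscreteSpectrum (T : H →ₗ.[ℂ] H) : Prop := essSpectrum T = ∅

/-- `ev 0 ≤ ev 1 ≤ ⋯` are all the eigenvalues of the self-adjoint operator `T` below its essential
spectrum, in increasing order and counted with multiplicity (there being infinitely many). -/
def IsEigenvalueSequence (T : H →ₗ.[ℂ] H) (ev : ℕ → ℝ) : Prop :=
  Monotone ev ∧ (∀ n, ∀ z ∈ essSpectrum T, ev n < z.re) ∧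
    ∀ μ : ℝ, (∀ z ∈ essSpectrum T, μ < z.re) →
      {n | ev n = μ}.encard = (Module.finrank ℂ (opEigenspace T (μ : ℂ)) : ℕ∞)

end Operators

/-! ### Operators on `ℓ²(V)` -/

/-- The complex Hilbert space `ℓ²(V)`. -/
abbrev L2 (V : Type*) : Type _ := lp (fun _ : V => ℂ) 2

/-- The space `C_c(V)` of finitely supported functions. -/
def Cc (V : Type*) : Submodule ℂ (L2 V) where
  carrier := {φ | (Function.support (φ : V → ℂ)).Finite}
  zero_mem' := by
    change (Function.support ((0 : L2 V) : V → ℂ)).Finite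
    rw [lp.coeFn_zero, Function.support_zero]
    exact Set.finite_empty
  add_mem' := by
    intro a b ha hb
    exact (ha.union hb).subset (Function.support_add _ _)
  smul_mem' := by
    intro c a ha
    exact Set.Finite.subset ha (Function.support_const_smul_subset c _)

/-- The maximal operator on `ℓ²(V)` given by a linear map `L` on all functions: its domain consists
of all `φ ∈ ℓ²(V)` with `L φ ∈ ℓ²(V)`, and it acts as `L`. -/
def maxOp {V : Type*} (L : (V → ℂ) →ₗ[ℂ] (V → ℂ)) : L2 V →ₗ.[ℂ] L2 V where
  domain :=
    { carrier := {φ | Memℓp (E := fun _ : V => ℂ) (L (φ : V → ℂ)) 2}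
      zero_mem' := by
        have h : L ((0 : L2 V) : V → ℂ) = 0 := by
          rw [lp.coeFn_zero, map_zero]
        change Memℓp (E := fun _ : V => ℂ) (L ((0 : L2 V) : V → ℂ)) 2
        rw [h]
        exact zero_memℓp
      add_mem' := by
        intro a b ha hb
        have h : L ((a + b : L2 V) : V → ℂ) = L a + L b := by
          rw [lp.coeFn_add, map_add]
        change Memℓp (E := fun _ : V => ℂ) (L ((a + b : L2 V) : V → ℂ)) 2
        rw [h]
        exact Memℓp.add ha hb
      smul_mem' := by
        intro c a ha
        have h : L ((c • a : L2 V) : V → ℂ) = c • L a := by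
          rw [lp.coeFn_smul, map_smul]
        change Memℓp (E := fun _ : V => ℂ) (L ((c • a : L2 V) : V → ℂ)) 2
        rw [h]
        exact Memℓp.const_smul ha c }
  toFun :=
    { toFun := fun φ => ⟨L ((φ : L2 V) : V → ℂ), φ.2⟩
      map_add' := by
        intro a b
        apply lp.ext
        change L (((a : L2 V) + (b : L2 V) : L2 V) : V → ℂ) = L (a : L2 V) + L (b : L2 V)
        rw [lp.coeFn_add, map_add]
      map_smul' := by
        intro c a
        apply lp.ext
        change L ((c • (a : L2 V) : L2 V) : V → ℂ) = c • L (a : L2 V)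
        rw [lp.coeFn_smul, map_smul] }

/-- The operator of multiplication by `g` with domain `{φ ∈ ℓ²(V) | g φ ∈ ℓ²(V)}`. -/
def mulOp {V : Type*} (g : V → ℝ) : L2 V →ₗ.[ℂ] L2 V :=
  maxOp (LinearMap.mulLeft ℂ (fun x => (g x : ℂ)))

section Graphs

variable {V : Type*} (G : SimpleGraph V) [G.LocallyFinite]

/-- The action `φ ↦ (x ↦ ∑_{y ∼ x} (φ(x) - e^{iθ(x,y)} φ(y)) + q(x) φ(x))` on all functions. -/
def magneticAction (θ : V → V → Real.Angle) (q : V → ℝ) : (V → ℂ) →ₗ[ℂ] (V → ℂ) where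
  toFun φ x :=
    ∑ y ∈ G.neighborFinset x, (φ x - ((θ x y).toCircle : ℂ) * φ y) + (q x : ℂ) * φ x
  map_add' φ ψ := by
    funext x
    simp only [Pi.add_apply, Finset.sum_sub_distrib, mul_add, Finset.sum_add_distrib]
    ring
  map_smul' c φ := by
    funext x
    simp only [Pi.smul_apply, smul_eq_mul, RingHom.id_apply, mul_add, Finset.mul_sum]
    congr 1
    · exact Finset.sum_congr rfl fun y _ => by ring
    · ring

/-- The maximal magnetic Schrödinger operator, which is `Δ_θ + q` for potentials `q ≥ 0`. -/
def magneticMaxOp (θ : V → V → Real.Angle) (q : V → ℝ) : L2 V →ₗ.[ℂ] L2 V :=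
  maxOp (magneticAction G θ q)

/-- The positive part `q₊ = max(q, 0)`. -/
def pospart (q : V → ℝ) : V → ℝ := fun x => max (q x) 0

/-- The negative part `q₋ = max(-q, 0)`. -/
def negpart (q : V → ℝ) : V → ℝ := fun x => max (-q x) 0

/-- The class `K^θ_α`: `q₋ ≤ α (Δ_θ + q₊) + C` on `C_c(V)` for some `C ≥ 0`. -/
def MemK (θ : V → V → Real.Angle) (α : ℝ) (q : V → ℝ) : Prop :=
  ∃ C : ℝ, 0 ≤ C ∧ OpLEOn (Cc V) (mulOp (negpart q))
    ((α : ℂ) • magneticMaxOp G θ (pospart q) + mulOp (fun _ => C))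

/-- The class `K^θ_{0+}`, the intersection of the classes `K^θ_α` with `α ∈ (0,1)`. -/
def MemKZeroPlus (θ : V → V → Real.Angle) (q : V → ℝ) : Prop :=
  ∀ α ∈ Set.Ioo (0 : ℝ) 1, MemK G θ α q

/-- The magnetic Schrödinger operator `Δ_θ + q`: the form sum of `Δ_θ + q₊` and `-q₋`. -/
def magneticOp (θ : V → V → Real.Angle) (q : V → ℝ) : L2 V →ₗ.[ℂ] L2 V :=
  formSumSub (magneticMaxOp G θ (pospart q)) (mulOp (negpart q))

/-- The function `deg + q`. -/
def degAdd (q : V → ℝ) : V → ℝ := fun x => (G.degree x : ℝ) + q x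

/-- `(G, q)` is `(a, k)`-sparse: `2 |E_W| ≤ k |W| + a (|∂W| + q₊(W))` for every finite `W`.
Here `2 |E_W|` is the number of directed edges within `W`, and `∂W` is the set of directed edges
from `W` to its complement. -/
def IsSparse (q : V → ℝ) (a k : ℝ) : Prop :=
  ∀ W : Finset V,
    (({p : V × V | p.1 ∈ W ∧ p.2 ∈ W ∧ G.Adj p.1 p.2}.ncard : ℕ) : ℝ) ≤
      k * (W.card : ℝ) +
        a * ((({p : V × V | p.1 ∈ W ∧ p.2 ∉ W ∧ G.Adj p.1 p.2}.ncard : ℕ) : ℝ) +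
          ∑ x ∈ W, pospart q x)

/-- `(G, q)` is almost sparse. -/
def IsAlmostSparse (q : V → ℝ) : Prop :=
  ∀ ε : ℝ, 0 < ε → ∃ k : ℝ, 0 ≤ k ∧ IsSparse G q ε k

end Graphs

/-- `liminf_{|x| → ∞} g(x)`, the supremum over all finite `W` of the infimum of `g` outside `W`. -/
def liminfAtInfinity {V : Type*} (g : V → ℝ) : EReal :=
  ⨆ W : Finset V, ⨅ x : V, ⨅ _ : x ∉ W, (g x : EReal)

end SparseMagnetic

end

open SparseMagnetic

set_option linter.unusedSectionVars false

/-! Everything is measured against `deg + q₊`. Let b = (1 + deg + q₊)^(-1/2) and let J be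
multiplication by b. The substitution φ = Ju turns the forms of `deg + q₊`, of the magnetic
adjacency (hopping) operator and of q₋ into bounded operators X, A, Z on ℓ² with X + J² = 1
(`ScaledForms`). Then `deg + q` becomes X - Z and Δ_θ + q becomes X - A - Z, both with form domain
ran J. All claims follow from one estimate, |⟨u, Au⟩| ≤ a'⟨u, (X - Z)u⟩ + k'‖Ju‖² with a' < 1.

The estimate: sparseness is an isoperimetric inequality. Summed over the level sets of |φ|²
(`IsSparse.sum_le`), it bounds the form of `deg + q₊` by the edge differences of |φ|², the form of
q₊ and ‖φ‖². On an edge, ||φ(x)|² - |φ(y)|²| is at most the geometric mean of |φ(x) - eφ(y)|² + (a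
nonnegative defect) and |φ(x) + eφ(y)|² taken likewise, where e is the phase factor; in fact the
product |φ(x) - eφ(y)|²|φ(x) + eφ(y)|² already dominates its square. Weighted AM-GM with weights L
and L⁻¹ (`abs_sq_sub_sq_le`, `IsSparse.hopForm_estimate`) leaves the hopping form on one side. A
large L gives a coefficient below 1; for almost sparse graphs L close to 1 makes it as small as
desired. Since q₋ is form small, X may be replaced by X - Z (`exists_abs_hop_le`).

Consequences: (a) is the estimate on C_c(V). For (b), `mem_absSqrtDomain_iff` shows D(|T|^(1/2)) =
ran J for each operator T whose form is coercive over J; the square root is reached through T² and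
the Heinz inequality. For (c), the resolvent J N⁻¹ J is comparable with J² as a form, so
discreteness of the spectrum only depends on whether b tends to 0 at infinity. The eigenvalue
asymptotics follow by min-max (`IsMinMaxSequence.le_of_form_le`), because a' is arbitrarily small.
-/

namespace SparseMagnetic

/-! ### Bounded self-adjoint operators: ranges, coercive inverses, the Heinz inequality. -/

section BoundedOperators

variable {H : Type*} [NormedAddCommGroup H] [InnerProductSpace ℂ H] [CompleteSpace H]

theorem inner_map_eq {P : H →L[ℂ] H} (hP : IsSelfAdjoint P) (x y : H) :
    inner ℂ (P x) y = inner ℂ x (P y) :=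
  ContinuousLinearMap.isSelfAdjoint_iff_isSymmetric.1 hP x y

theorem isSelfAdjoint_of_inner {P : H →L[ℂ] H}
    (h : ∀ x y, inner ℂ (P x) y = inner ℂ x (P y)) : IsSelfAdjoint P :=
  ContinuousLinearMap.isSelfAdjoint_iff_isSymmetric.2 h

theorem nonneg_iff_re_inner {P : H →L[ℂ] H} (hP : IsSelfAdjoint P) :
    0 ≤ P ↔ ∀ x, 0 ≤ (inner ℂ (P x) x).re := by
  rw [ContinuousLinearMap.nonneg_iff_isPositive]
  constructor
  · intro h x
    exact h.re_inner_nonneg_left x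
  · intro h
    exact ⟨ContinuousLinearMap.isSelfAdjoint_iff_isSymmetric.1 hP, h⟩

theorem le_iff_re_inner {P Q : H →L[ℂ] H} (hP : IsSelfAdjoint P) (hQ : IsSelfAdjoint Q) :
    P ≤ Q ↔ ∀ x, (inner ℂ (P x) x).re ≤ (inner ℂ (Q x) x).re := by
  rw [← sub_nonneg, nonneg_iff_re_inner (hQ.sub hP)]
  simp

theorem inner_self_re (x : H) : (inner ℂ x x).re = ‖x‖ ^ 2 := by
  have := inner_self_eq_norm_sq (𝕜 := ℂ) x
  simpa using this

theorem re_inner_le (x y : H) : (inner ℂ x y).re ≤ ‖x‖ * ‖y‖ :=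
  (Complex.re_le_norm _).trans (norm_inner_le_norm x y)

theorem re_inner_comm (x y : H) : (inner ℂ x y).re = (inner ℂ y x).re := by
  rw [← inner_conj_symm, Complex.conj_re]

/-- The orthogonal complement of the range of a self-adjoint operator is its kernel. -/
theorem denseRange_of_injective {Q : H →L[ℂ] H} (hQ : IsSelfAdjoint Q)
    (hinj : Function.Injective Q) : DenseRange Q := by
  have : (Q : H →ₗ[ℂ] H).range.topologicalClosure = ⊤ := by
    rw [Submodule.topologicalClosure_eq_top_iff, Submodule.eq_bot_iff]
    intro x hx
    apply hinj
    rw [map_zero]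
    refine ext_inner_left ℂ fun v => ?_
    rw [← inner_map_eq hQ, inner_zero_right]
    exact (Submodule.mem_orthogonal _ _).1 hx _ ⟨v, rfl⟩
  have h := Submodule.dense_iff_topologicalClosure_eq_top.2 this
  exact h

/-- A vector whose pairing is controlled by `‖Q w‖` lies in the range of `Q`. -/
theorem mem_range_of_inner_bound {Q : H →L[ℂ] H} (hQ : IsSelfAdjoint Q)
    (hinj : Function.Injective Q) {x : H} {c : ℝ}
    (h : ∀ w, ‖inner ℂ x w‖ ≤ c * ‖Q w‖) : ∃ z, Q z = x := by
  let e := LinearEquiv.ofInjective (Q : H →ₗ[ℂ] H) hinj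
  -- The functional Qw ↦ ⟨x, w⟩ is well defined and bounded on ran Q; a Hahn-Banach extension is
  -- represented by a vector z, and then ⟨z, Qw⟩ = ⟨x, w⟩ for all w says Qz = x.
  let f₀ : (Q : H →ₗ[ℂ] H).range →ₗ[ℂ] ℂ := (innerSL ℂ x : H →ₗ[ℂ] ℂ).comp e.symm.toLinearMap
  have hf : ∀ v, ‖f₀ v‖ ≤ c * ‖v‖ := by
    intro v
    obtain ⟨w, rfl⟩ := e.surjective v
    have h1 : f₀ (e w) = inner ℂ x w := by simp [f₀]
    rw [h1]
    exact h w
  let f : StrongDual ℂ (Q : H →ₗ[ℂ] H).range := f₀.mkContinuous c hf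
  obtain ⟨g, hg, -⟩ := exists_extension_norm_eq _ f
  refine ⟨(InnerProductSpace.toDual ℂ H).symm g, ?_⟩
  refine ext_inner_right ℂ fun w => ?_
  rw [inner_map_eq hQ, InnerProductSpace.toDual_symm_apply]
  have h2 := hg (e w)
  have h3 : ((e w : (Q : H →ₗ[ℂ] H).range) : H) = Q w := rfl
  rw [h3] at h2
  rw [h2]
  simp [f, f₀]

theorem injective_of_lower_bound {N : H →L[ℂ] H} {c : ℝ} (hc : 0 < c)
    (h : ∀ u, c * ‖u‖ ^ 2 ≤ (inner ℂ u (N u)).re) : Function.Injective N := by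
  rw [injective_iff_map_eq_zero]
  intro u hu
  have := h u
  rw [hu, inner_zero_right, Complex.zero_re] at this
  have h2 : ‖u‖ ^ 2 = 0 := le_antisymm (by nlinarith [sq_nonneg ‖u‖]) (sq_nonneg _)
  simpa using h2

theorem lower_bound_norm {N : H →L[ℂ] H} {c : ℝ} 
    (h : ∀ u, c * ‖u‖ ^ 2 ≤ (inner ℂ u (N u)).re) (u : H) : c * ‖u‖ ≤ ‖N u‖ := by
  rcases (norm_nonneg u).eq_or_lt with h0 | h0
  · rw [← h0]; simp
  · have h1 := (h u).trans (re_inner_le u (N u))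
    have : (c * ‖u‖) * ‖u‖ ≤ ‖N u‖ * ‖u‖ := by nlinarith
    exact le_of_mul_le_mul_right this h0

/-- A coercive bounded self-adjoint operator has a bounded self-adjoint coercive inverse. -/
theorem exists_inverse_of_coercive {N : H →L[ℂ] H} (hN : IsSelfAdjoint N) {c : ℝ} (hc : 0 < c)
    (h : ∀ u, c * ‖u‖ ^ 2 ≤ (inner ℂ u (N u)).re) :
    ∃ N' : H →L[ℂ] H, IsSelfAdjoint N' ∧ (∀ u, N (N' u) = u) ∧ (∀ u, N' (N u) = u) ∧
      ∃ c' > 0, ∀ u, c' * ‖u‖ ^ 2 ≤ (inner ℂ u (N' u)).re := by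
  have hinj := injective_of_lower_bound hc h
  have hsurj : Function.Surjective N := by
    intro x
    refine mem_range_of_inner_bound hN hinj (c := ‖x‖ / c) fun w => ?_
    refine (norm_inner_le_norm x w).trans ?_
    have := lower_bound_norm h w
    rw [div_mul_eq_mul_div, le_div_iff₀ hc]
    nlinarith [norm_nonneg x]
  let e := ContinuousLinearEquiv.ofBijective N (LinearMap.ker_eq_bot.2 hinj)
    (LinearMap.range_eq_top.2 hsurj)
  have h1 : ∀ u, N (e.symm u) = u := fun u =>
    ContinuousLinearEquiv.ofBijective_apply_symm_apply N _ _ u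
  have h2 : ∀ u, e.symm (N u) = u := fun u =>
    ContinuousLinearEquiv.ofBijective_symm_apply_apply N _ _ u
  refine ⟨e.symm, ?_, h1, h2, ?_⟩
  · refine isSelfAdjoint_of_inner fun x y => ?_
    conv_lhs => rw [← h1 y]
    conv_rhs => rw [← h1 x]
    exact (inner_map_eq hN _ _).symm
  -- With v = N⁻¹u one has ⟨N⁻¹u, u⟩ = ⟨v, Nv⟩ ≥ c‖v‖², while ‖u‖ ≤ (‖N‖ + 1)‖v‖; the added 1 keeps
  -- the denominator positive.
  · refine ⟨c / (‖N‖ + 1) ^ 2, by positivity, fun u => ?_⟩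
    have h3 := h (e.symm u)
    rw [h1] at h3
    have h4 : ‖u‖ ≤ (‖N‖ + 1) * ‖e.symm u‖ := by
      conv_lhs => rw [← h1 u]
      exact (N.le_opNorm _).trans (by nlinarith [norm_nonneg (e.symm u)])
    have h5 : ‖u‖ ^ 2 ≤ (‖N‖ + 1) ^ 2 * ‖e.symm u‖ ^ 2 := by
      rw [← mul_pow]; exact pow_le_pow_left₀ (norm_nonneg _) h4 2
    rw [re_inner_comm]
    refine le_trans ?_ h3
    rw [div_mul_eq_mul_div, div_le_iff₀ (by positivity)]
    nlinarith

theorem commute_sqrt_left {a b : H →L[ℂ] H} (h : Commute a b) :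
    Commute (CFC.sqrt a) b := by
  have := Commute.cfcₙ_nnreal h NNReal.sqrt
  exact this

theorem isSelfAdjoint_sqrt (a : H →L[ℂ] H) : IsSelfAdjoint (CFC.sqrt a) :=
  IsSelfAdjoint.of_nonneg (CFC.sqrt_nonneg a)

theorem sqrt_sqrt_apply {a : H →L[ℂ] H} (ha : 0 ≤ a) (x : H) :
    CFC.sqrt a (CFC.sqrt a x) = a x := by
  have := CFC.sqrt_mul_sqrt_self a ha
  exact congrArg (fun f : H →L[ℂ] H => f x) this

theorem norm_sqrt_sq {a : H →L[ℂ] H} (ha : 0 ≤ a) (x : H) :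
    ‖CFC.sqrt a x‖ ^ 2 = (inner ℂ x (a x)).re := by
  rw [← inner_self_re, inner_map_eq (isSelfAdjoint_sqrt a), sqrt_sqrt_apply ha]

/-- The Heinz inequality for bounded nonnegative operators. -/
theorem heinz {X Y : H →L[ℂ] H} (hX : 0 ≤ X) (hY : 0 ≤ Y) {c : ℝ} (hc : 0 ≤ c)
    (h : ∀ w, ‖Y w‖ ≤ c * ‖X w‖) (w : H) :
    (inner ℂ w (Y w)).re ≤ c * (inner ℂ w (X w)).re := by
  have hXs := IsSelfAdjoint.of_nonneg hX
  have hYs := IsSelfAdjoint.of_nonneg hY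
  have hcX : 0 ≤ c • X := smul_nonneg hc hX
  have hcXs := IsSelfAdjoint.of_nonneg hcX
  have hsq : ∀ {P : H →L[ℂ] H}, IsSelfAdjoint P → IsSelfAdjoint (P * P) := fun {P} hP => by
    refine isSelfAdjoint_of_inner fun x y => ?_
    simp only [mul_apply_eq_comp, inner_map_eq hP]
  have h1 : Y * Y ≤ (c • X) * (c • X) := by
    rw [le_iff_re_inner (hsq hYs) (hsq hcXs)]
    intro x
    simp only [mul_apply_eq_comp]
    rw [inner_map_eq hYs, inner_map_eq hcXs, inner_self_re, inner_self_re]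
    refine pow_le_pow_left₀ (norm_nonneg _) ?_ 2
    refine (h x).trans (le_of_eq ?_)
    simp [norm_smul, abs_of_nonneg hc]
  -- The hypothesis says Y² ≤ (cX)², and the square root is operator monotone.
  have h2 := CFC.sqrt_le_sqrt _ _ h1
  rw [CFC.sqrt_mul_self Y hY, CFC.sqrt_mul_self _ hcX, le_iff_re_inner hYs hcXs] at h2
  have h3 := h2 w
  rw [inner_map_eq hYs, inner_map_eq hcXs] at h3
  simpa [inner_smul_right_eq_smul] using h3

end BoundedOperators

/-! ### Unbounded operators described by their graphs, by forms and by resolvents. -/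

section UnboundedOperators

variable {H : Type*} [NormedAddCommGroup H] [InnerProductSpace ℂ H] [CompleteSpace H]

/-- `T` is the operator `J⁻¹ M J⁻¹` of the form `(J v, J u) ↦ ⟨v, M u⟩`. -/
def HasFormRep (T : H →ₗ.[ℂ] H) (J M : H →L[ℂ] H) : Prop :=
  ∀ x y, (x, y) ∈ T.graph ↔ ∃ u, J u = x ∧ M u = J y

/-- `R` is the inverse of `T + C`. -/
def HasResolventRep (T : H →ₗ.[ℂ] H) (R : H →L[ℂ] H) (C : ℝ) : Prop :=
  ∀ x y, (x, y) ∈ T.graph ↔ R (y + (C : ℂ) • x) = x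

/-- The form `(J v, J u) ↦ ⟨v, M u⟩` is bounded below by `-C`, with form norm equivalent to
`J u ↦ ‖u‖`. -/
structure IsFormPair (J M : H →L[ℂ] H) (C : ℝ) : Prop where
  selfAdjoint_left : IsSelfAdjoint J
  injective : Function.Injective J
  selfAdjoint_right : IsSelfAdjoint M
  coercive : ∃ c > 0, ∀ u, c * ‖u‖ ^ 2 ≤ (inner ℂ u (M u)).re + C * ‖J u‖ ^ 2

theorem mem_graph_iff_of_isSelfAdjoint {S : H →ₗ.[ℂ] H} (hS : IsSelfAdjoint S) (x y : H) :
    (x, y) ∈ S.graph ↔ ∀ a b, (a, b) ∈ S.graph → inner ℂ b x = inner ℂ a y := by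
  have h := LinearPMap.adjoint_graph_eq_graph_adjoint hS.dense_domain
  rw [LinearPMap.isSelfAdjoint_def.1 hS] at h
  conv_lhs => rw [h]
  rw [Submodule.mem_adjoint_iff]
  simp only [sub_eq_zero]

theorem inner_graph_eq {S : H →ₗ.[ℂ] H} (hS : IsSelfAdjoint S) {a b x y : H}
    (h : (a, b) ∈ S.graph) (h' : (x, y) ∈ S.graph) : inner ℂ b x = inner ℂ a y :=
  (mem_graph_iff_of_isSelfAdjoint hS x y).1 h' a b h

theorem graph_isClosed {S : H →ₗ.[ℂ] H} (hS : IsSelfAdjoint S) :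
    IsClosed (S.graph : Set (H × H)) :=
  hS.isClosed

theorem isSelfAdjoint_of_graph {S : H →ₗ.[ℂ] H} (hd : Dense (S.domain : Set H))
    (h : ∀ x y, (x, y) ∈ S.graph ↔ ∀ a b, (a, b) ∈ S.graph → inner ℂ b x = inner ℂ a y) :
    IsSelfAdjoint S := by
  rw [LinearPMap.isSelfAdjoint_def]
  apply LinearPMap.eq_of_eq_graph
  ext ⟨x, y⟩
  rw [LinearPMap.adjoint_graph_eq_graph_adjoint hd, Submodule.mem_adjoint_iff, h]
  simp only [sub_eq_zero]

theorem mem_sqOp_graph {T : H →ₗ.[ℂ] H} {x y : H} :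
    (x, y) ∈ (sqOp T).graph ↔ ∃ z, (x, z) ∈ T.graph ∧ (z, y) ∈ T.graph := by
  have key : ∀ (x : H) (hx : x ∈ T.domain) (hx' : x ∈ sqDomain T) (h2 : T ⟨x, hx⟩ ∈ T.domain)
      (h3 : x ∈ (sqOp T).domain), (sqOp T) ⟨x, h3⟩ = T ⟨T ⟨x, hx⟩, h2⟩ := by
    intro x hx hx' h2 h3
    have hxy : (T.domRestrict (sqDomain T)) ⟨x, h3⟩ = T ⟨x, hx⟩ :=
      LinearPMap.domRestrict_apply rfl
    change T ⟨(T.domRestrict (sqDomain T)) ⟨x, h3⟩, _⟩ = _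
    congr 1
  constructor
  · intro h
    obtain ⟨⟨x', hx'⟩, rfl, rfl⟩ := (LinearPMap.mem_graph_iff _).1 h
    have hx2 := hx'
    obtain ⟨hs, hd⟩ := hx2
    obtain ⟨y, hy, hyx⟩ := hs
    simp only [Submodule.coe_subtype] at hyx
    subst hyx
    refine ⟨T y, LinearPMap.mem_graph _ _, ?_⟩
    have := key y y.2 ⟨y, hy, rfl⟩ hy hx'
    rw [this]
    exact LinearPMap.mem_graph T ⟨_, hy⟩
  · rintro ⟨z, hz, hy⟩
    obtain ⟨x', rfl, rfl⟩ := (LinearPMap.mem_graph_iff _).1 hz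
    obtain ⟨z', hz', rfl⟩ := (LinearPMap.mem_graph_iff _).1 hy
    have h2 : T x' ∈ T.domain := by
      have : (z' : H) = T x' := hz'
      rw [← this]; exact z'.2
    have hs : (x' : H) ∈ sqDomain T := ⟨x', h2, rfl⟩
    have h3 : (x' : H) ∈ (sqOp T).domain := ⟨hs, x'.2⟩
    rw [LinearPMap.mem_graph_iff]
    refine ⟨⟨x', h3⟩, rfl, ?_⟩
    rw [key x' x'.2 hs h2 h3]
    congr 1
    exact Subtype.ext hz'.symm

theorem HasResolventRep.graph_mk {T : H →ₗ.[ℂ] H} {R : H →L[ℂ] H} {C : ℝ}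
    (h : HasResolventRep T R C) (w : H) : (R w, w - (C : ℂ) • R w) ∈ T.graph := by
  rw [h]; simp

theorem HasResolventRep.domain {T : H →ₗ.[ℂ] H} {R : H →L[ℂ] H} {C : ℝ}
    (h : HasResolventRep T R C) (x : H) : x ∈ T.domain ↔ ∃ w, R w = x := by
  rw [LinearPMap.mem_domain_iff]
  constructor
  · rintro ⟨y, hy⟩
    exact ⟨_, (h x y).1 hy⟩
  · rintro ⟨w, rfl⟩
    exact ⟨_, h.graph_mk w⟩

/-- T is R⁻¹ - C with R bounded, self-adjoint and injective: ran R is the dense domain, and the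
pairs (Rw, w - CRw) suffice as test vectors for the adjoint. -/
theorem HasResolventRep.isSelfAdjoint {T : H →ₗ.[ℂ] H} {R : H →L[ℂ] H} {C : ℝ}
    (h : HasResolventRep T R C) (hR : IsSelfAdjoint R) (hinj : Function.Injective R) :
    IsSelfAdjoint T := by
  have hd : Dense (T.domain : Set H) := by
    have := denseRange_of_injective hR hinj
    refine this.mono ?_
    rintro _ ⟨w, rfl⟩
    exact (h.domain _).2 ⟨w, rfl⟩
  refine isSelfAdjoint_of_graph hd fun x y => ?_
  have hC : ∀ a b : H, inner ℂ ((C : ℂ) • a) b = inner ℂ a ((C : ℂ) • b) := by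
    intro a b
    rw [inner_smul_left, inner_smul_right, Complex.conj_ofReal]
  constructor
  · intro hxy a b hab
    have h1 := (h _ _).1 hxy
    have h2 := (h _ _).1 hab
    have h3 : inner ℂ (b + (C : ℂ) • a) x = inner ℂ a (y + (C : ℂ) • x) := by
      conv_lhs => rw [← h1]
      rw [← inner_map_eq hR, h2]
    rw [inner_add_left, inner_add_right, hC] at h3
    exact add_right_cancel h3
  · intro hxy
    rw [h]
    refine ext_inner_left ℂ fun w => ?_
    have := hxy _ _ (h.graph_mk w)
    rw [inner_sub_left, hC, sub_eq_iff_eq_add, ← inner_add_right] at this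
    rw [this, inner_map_eq hR]

/-- The bounded inverse of `T + C` for the operator `T` of a form bounded below. -/
theorem IsFormPair.exists_resolvent {J M : H →L[ℂ] H} {C : ℝ} (hp : IsFormPair J M C) :
    ∃ R N' : H →L[ℂ] H, IsSelfAdjoint R ∧ Function.Injective R ∧ (∀ w, R w = J (N' (J w))) ∧
      IsSelfAdjoint N' ∧ (∀ u, M (N' u) + (C : ℂ) • J (J (N' u)) = u) ∧
      (∀ u, N' (M u + (C : ℂ) • J (J u)) = u) ∧
      (∃ c > 0, ∀ w, c * ‖J w‖ ^ 2 ≤ (inner ℂ w (R w)).re) ∧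
      (∃ c, 0 ≤ c ∧ ∀ w, (inner ℂ w (R w)).re ≤ c * ‖J w‖ ^ 2) ∧
      (∀ T, HasFormRep T J M → HasResolventRep T R C) := by
  obtain ⟨hJ, hJi, hM, c, hc, hcoer⟩ := hp
  -- N represents the form of T + C and is coercive, so (T + C)⁻¹ = J N⁻¹ J.
  let N : H →L[ℂ] H := M + (C : ℂ) • (J.comp J)
  have hNa : ∀ u, N u = M u + (C : ℂ) • J (J u) := fun u => rfl
  have hN : IsSelfAdjoint N := by
    refine isSelfAdjoint_of_inner fun x y => ?_
    simp only [hNa, inner_add_left, inner_add_right, inner_smul_left, inner_smul_right,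
      Complex.conj_ofReal, inner_map_eq hM, inner_map_eq hJ]
  have hNc : ∀ u, c * ‖u‖ ^ 2 ≤ (inner ℂ u (N u)).re := by
    intro u
    refine (hcoer u).trans (le_of_eq ?_)
    rw [hNa, inner_add_right, inner_smul_right, ← inner_map_eq hJ, Complex.add_re,
      Complex.re_ofReal_mul, inner_self_re]
  obtain ⟨N', hN', h1, h2, c', hc', h3⟩ := exists_inverse_of_coercive hN hc hNc
  have hin : ∀ w, inner ℂ w (J (N' (J w))) = inner ℂ (J w) (N' (J w)) := fun w => by
    rw [inner_map_eq hJ]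
  refine ⟨J.comp (N'.comp J), N', ?_, ?_, fun w => rfl, hN', fun u => ?_, fun u => ?_,
    ⟨c', hc', fun w => ?_⟩, ⟨‖N'‖, norm_nonneg _, fun w => ?_⟩, ?_⟩
  · refine isSelfAdjoint_of_inner fun x y => ?_
    simp only [ContinuousLinearMap.comp_apply, inner_map_eq hJ, inner_map_eq hN']
  · exact hJi.comp ((Function.LeftInverse.injective (g := N) h1).comp hJi)
  · rw [← hNa, h1]
  · rw [← hNa, h2]
  · simp only [ContinuousLinearMap.comp_apply]
    rw [hin]
    exact h3 _
  · simp only [ContinuousLinearMap.comp_apply]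
    rw [hin]
    refine (re_inner_le _ _).trans ?_
    have := N'.le_opNorm (J w)
    nlinarith [norm_nonneg (J w)]
  · intro T hT x y
    rw [hT]
    simp only [ContinuousLinearMap.comp_apply, map_add, map_smul]
    constructor
    · rintro ⟨u, rfl, hu⟩
      have h5 := h2 u
      rw [hNa, map_add, map_smul, hu] at h5
      rw [← map_smul, ← map_add, h5]
    · intro h
      refine ⟨N' (J y) + (C : ℂ) • N' (J x), by rw [map_add, map_smul]; exact h, ?_⟩
      have h4 : N (N' (J y) + (C : ℂ) • N' (J x)) = J y + (C : ℂ) • J x := by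
        rw [map_add, map_smul, h1, h1]
      rw [hNa] at h4
      have h5 : J (N' (J y) + (C : ℂ) • N' (J x)) = x := by rw [map_add, map_smul]; exact h
      rw [h5] at h4
      exact add_right_cancel h4

theorem IsFormPair.isSelfAdjoint {J M : H →L[ℂ] H} {C : ℝ} (hp : IsFormPair J M C)
    {T : H →ₗ.[ℂ] H} (hT : HasFormRep T J M) : IsSelfAdjoint T := by
  obtain ⟨R, N', hR, hRi, -, -, -, -, -, -, h⟩ := hp.exists_resolvent
  exact (h T hT).isSelfAdjoint hR hRi

/-- A nonnegative self-adjoint operator `A` has a bounded inverse of `A + 1`. -/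
theorem exists_resolventRep_of_nonneg {A : H →ₗ.[ℂ] H} (hA : IsSelfAdjoint A)
    (hpos : ∀ x y, (x, y) ∈ A.graph → 0 ≤ (inner ℂ x y).re) :
    ∃ R : H →L[ℂ] H, 0 ≤ R ∧ R ≤ 1 ∧ Function.Injective R ∧ HasResolventRep A R 1 := by
  have hcl : CompleteSpace A.graph := (graph_isClosed hA).completeSpace_coe
  -- This is A + 1 seen on the complete space given by the graph of A. Positivity bounds it below,
  -- so its range is closed; R is the first coordinate of its inverse.
  let f : A.graph →L[ℂ] H := (ContinuousLinearMap.snd ℂ H H + ContinuousLinearMap.fst ℂ H H).comp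
    A.graph.subtypeL
  have hfa : ∀ p : A.graph, f p = p.1.2 + p.1.1 := fun p => rfl
  have hre : ∀ p : A.graph, ‖p.1.1‖ ^ 2 ≤ (inner ℂ p.1.1 (f p)).re := by
    intro p
    rw [hfa, inner_add_right, Complex.add_re, inner_self_re]
    have := hpos p.1.1 p.1.2 p.2
    linarith
  have hfst : ∀ p : A.graph, ‖p.1.1‖ ≤ ‖f p‖ := by
    intro p
    have h1 := (hre p).trans (re_inner_le _ _)
    rcases (norm_nonneg p.1.1).eq_or_lt with h0 | h0
    · rw [← h0]; exact norm_nonneg _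
    · exact le_of_mul_le_mul_left (by nlinarith) h0
  have hbd : ∀ p : A.graph, ‖p‖ ≤ (2 : NNReal) * ‖f p‖ := by
    intro p
    have h1 := hfst p
    have h2 : ‖p.1.2‖ ≤ ‖f p‖ + ‖p.1.1‖ := by
      have : p.1.2 = f p - p.1.1 := by rw [hfa]; abel
      conv_lhs => rw [this]
      exact norm_sub_le _ _
    have : ‖p‖ = max ‖p.1.1‖ ‖p.1.2‖ := rfl
    rw [this]
    refine max_le ?_ ?_ <;> push_cast <;> nlinarith [norm_nonneg (f p)]
  have hanti := AddMonoidHomClass.antilipschitz_of_bound f hbd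
  have hcr : IsClosed (Set.range f) := hanti.isClosed_range f.uniformContinuous
  have hsurj : Function.Surjective f := by
    have hK : IsClosed (((f : A.graph →ₗ[ℂ] H).range : Submodule ℂ H) : Set H) := by
      exact hcr
    have : ((f : A.graph →ₗ[ℂ] H).range) = ⊤ := by
      rw [← hK.submodule_topologicalClosure_eq, Submodule.topologicalClosure_eq_top_iff,
        Submodule.eq_bot_iff]
      intro x hx
      rw [Submodule.mem_orthogonal] at hx
      -- A vector orthogonal to ran (A + 1) is an eigenvector of A at -1 or zero; positivity leaves
      -- zero.
      have hg : (x, -x) ∈ A.graph := by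
        rw [mem_graph_iff_of_isSelfAdjoint hA]
        intro a b hab
        have := hx (b + a) ⟨⟨(a, b), hab⟩, rfl⟩
        rw [inner_add_left] at this
        rw [inner_neg_right]
        exact eq_neg_of_add_eq_zero_left this
      have := hpos _ _ hg
      rw [inner_neg_right, Complex.neg_re, inner_self_re] at this
      have : ‖x‖ ^ 2 = 0 := le_antisymm (by linarith) (sq_nonneg _)
      simpa using this
    exact LinearMap.range_eq_top.1 this
  let e := ContinuousLinearEquiv.ofBijective f (LinearMap.ker_eq_bot.2 hanti.injective)
    (LinearMap.range_eq_top.2 hsurj)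
  have h1 : ∀ u, f (e.symm u) = u := fun u =>
    ContinuousLinearEquiv.ofBijective_apply_symm_apply f _ _ u
  have h2 : ∀ u, e.symm (f u) = u := fun u =>
    ContinuousLinearEquiv.ofBijective_symm_apply_apply f _ _ u
  let R : H →L[ℂ] H := (ContinuousLinearMap.fst ℂ H H).comp
    (A.graph.subtypeL.comp (e.symm : H →L[ℂ] A.graph))
  have hRa : ∀ w, R w = (e.symm w).1.1 := fun w => rfl
  have hrep : HasResolventRep A R 1 := by
    intro x y
    constructor
    · intro h
      have h3 : y + ((1 : ℝ) : ℂ) • x = f ⟨(x, y), h⟩ := by rw [hfa]; simp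
      rw [h3, hRa, h2]
    · intro h
      have h3 := (e.symm (y + ((1 : ℝ) : ℂ) • x)).2
      have h4 := h1 (y + ((1 : ℝ) : ℂ) • x)
      rw [hfa, ← hRa, h] at h4
      rw [hRa] at h
      have h5 : (e.symm (y + ((1 : ℝ) : ℂ) • x)).1.2 = y := by
        simpa using h4
      have h6 : (e.symm (y + ((1 : ℝ) : ℂ) • x)).1 = (x, y) := Prod.ext h h5
      rwa [h6] at h3
  have hRs : IsSelfAdjoint R := by
    refine isSelfAdjoint_of_inner fun x y => ?_
    have h3 := inner_graph_eq hA (hrep.graph_mk x) (hrep.graph_mk y)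
    simp only [Complex.ofReal_one, one_smul, inner_sub_left, inner_sub_right] at h3
    exact (sub_left_inj.1 h3).symm
  refine ⟨R, ?_, ?_, ?_, hrep⟩
  · rw [nonneg_iff_re_inner hRs]
    intro x
    have h3 := hre (e.symm x)
    rw [h1] at h3
    exact (sq_nonneg _).trans h3
  · rw [le_iff_re_inner hRs (IsSelfAdjoint.one _)]
    intro x
    have h3 := hfst (e.symm x)
    rw [h1] at h3
    refine (re_inner_le _ _).trans ?_
    rw [one_apply_eq_self, inner_self_re]
    rw [← hRa] at h3
    nlinarith [norm_nonneg x]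
  · rw [injective_iff_map_eq_zero]
    intro w hw
    have h3 := hrep.graph_mk w
    rw [hw] at h3
    have := LinearPMap.graph_fst_eq_zero_snd A h3 rfl
    simpa using this

end UnboundedOperators

/-! ### Square roots, absolute values and the form domain of an operator. -/

section SquareRoots

variable {H : Type*} [NormedAddCommGroup H] [InnerProductSpace ℂ H] [CompleteSpace H]

/-- Douglas range inclusion: |⟨Pv, w⟩| ≤ ‖v‖‖Pw‖ ≤ ‖v‖√c ‖Qw‖, which puts Pv into ran Q. -/
theorem range_subset_of_norm_sq_le {P Q : H →L[ℂ] H} (hP : IsSelfAdjoint P)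
    (hQ : IsSelfAdjoint Q) (hinj : Function.Injective Q) {c : ℝ} (hc : 0 ≤ c)
    (h : ∀ w, ‖P w‖ ^ 2 ≤ c * ‖Q w‖ ^ 2) (v : H) : ∃ z, Q z = P v := by
  refine mem_range_of_inner_bound hQ hinj (c := ‖v‖ * √c) fun w => ?_
  rw [inner_map_eq hP]
  refine (norm_inner_le_norm _ _).trans ?_
  rw [mul_assoc]
  refine mul_le_mul_of_nonneg_left ?_ (norm_nonneg _)
  rw [← Real.sqrt_sq (norm_nonneg (Q w)), ← Real.sqrt_mul hc]
  exact Real.le_sqrt_of_sq_le (h w)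

theorem injective_sqrt {R : H →L[ℂ] H} (hR : 0 ≤ R) (hinj : Function.Injective R) :
    Function.Injective (CFC.sqrt R : H →L[ℂ] H) := by
  intro x y h
  apply hinj
  rw [← sqrt_sqrt_apply hR, h, sqrt_sqrt_apply hR]

/-- For R = (A + 1)⁻¹, P = √R and Q = √(1 - R) formally A = P⁻²Q², so the root is S = P⁻¹Q, given by
its graph {(x, y) | Qx = Py}. -/
theorem exists_isPosSqrt {A : H →ₗ.[ℂ] H} (hA : IsSelfAdjoint A)
    (hpos : ∀ x y, (x, y) ∈ A.graph → 0 ≤ (inner ℂ x y).re) : ∃ S, IsPosSqrt A S := by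
  obtain ⟨R, hR0, hR1, hRi, hrep⟩ := exists_resolventRep_of_nonneg hA hpos
  have h1R : 0 ≤ 1 - R := sub_nonneg.2 hR1
  let P := CFC.sqrt R
  let Q := CFC.sqrt (1 - R)
  have hPP : ∀ x, P (P x) = R x := sqrt_sqrt_apply hR0
  have hQQ : ∀ x, Q (Q x) = x - R x := fun x => by
    have := sqrt_sqrt_apply h1R x
    simpa using this
  have hPs : IsSelfAdjoint P := isSelfAdjoint_sqrt _
  have hQs : IsSelfAdjoint Q := isSelfAdjoint_sqrt _
  have hPi : Function.Injective P := injective_sqrt hR0 hRi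
  have hcomm : Commute P Q := by
    have h1 : Commute R (1 - R) := (Commute.one_right R).sub_right (Commute.refl R)
    have h2 : Commute P (1 - R) := commute_sqrt_left h1
    exact (commute_sqrt_left h2.symm).symm
  have hPQ : ∀ x, P (Q x) = Q (P x) := fun x => congrArg (fun f : H →L[ℂ] H => f x) hcomm
  let L : H × H →ₗ[ℂ] H := (Q : H →ₗ[ℂ] H).comp (LinearMap.fst ℂ H H) -
    (P : H →ₗ[ℂ] H).comp (LinearMap.snd ℂ H H)
  let S : H →ₗ.[ℂ] H := (LinearMap.ker L).toLinearPMap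
  have hS : ∀ x y, (x, y) ∈ S.graph ↔ Q x = P y := by
    intro x y
    have : S.graph = LinearMap.ker L := by
      apply Submodule.toLinearPMap_graph_eq
      rintro ⟨a, b⟩ hab (h0 : a = 0)
      have h3 : Q a - P b = 0 := hab
      rw [h0, map_zero, zero_sub, neg_eq_zero] at h3
      exact hPi (by simpa using h3)
    rw [this]
    exact sub_eq_zero
  -- P² + Q² = 1 and PQ = QP, so the graph of S is exactly {(Pu, Qu)}, with u recovered as Px + Qy.
  have hparam : ∀ x y, Q x = P y → P (P x + Q y) = x ∧ Q (P x + Q y) = y := by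
    intro x y h
    constructor
    · rw [map_add, hPP, hPQ, ← h, hQQ]; abel
    · rw [map_add, ← hPQ, h, hPP, hQQ]; abel
  have hmk : ∀ u, (P u, Q u) ∈ S.graph := fun u => (hS _ _).2 (hPQ u).symm
  have hd : Dense (S.domain : Set H) := by
    refine Dense.mono ?_ (denseRange_of_injective hPs hPi)
    rintro _ ⟨u, rfl⟩
    exact LinearPMap.mem_domain_of_mem_graph (hmk u)
  refine ⟨S, isSelfAdjoint_of_graph hd fun x y => ⟨?_, ?_⟩, ?_, ?_⟩
  · intro h a b hab
    have h1 := hparam x y ((hS x y).1 h)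
    have h2 := hparam a b ((hS a b).1 hab)
    generalize P x + Q y = u at h1
    generalize P a + Q b = v at h2
    rw [← h1.1, ← h1.2, ← h2.1, ← h2.2]
    simp only [inner_map_eq hPs, inner_map_eq hQs, hPQ]
  · intro h
    rw [hS]
    refine ext_inner_left ℂ fun v => ?_
    rw [← inner_map_eq hQs, ← inner_map_eq hPs]
    exact h _ _ (hmk v)
  · intro u
    have h1 := hparam _ _ ((hS _ _).1 (LinearPMap.mem_graph S u))
    set v := P (u : H) + Q (S u)
    rw [← h1.1, ← h1.2, inner_map_eq hPs]
    have h2 : 0 ≤ P * Q := hcomm.mul_nonneg (CFC.sqrt_nonneg _) (CFC.sqrt_nonneg _)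
    have h3 := (nonneg_iff_re_inner (IsSelfAdjoint.of_nonneg h2)).1 h2 v
    rw [re_inner_comm] at h3
    exact h3
  · apply LinearPMap.eq_of_eq_graph
    ext ⟨x, y⟩
    rw [mem_sqOp_graph, hrep]
    simp only [hS, Complex.ofReal_one, one_smul]
    constructor
    · rintro ⟨z, h1, h2⟩
      have h3 : P (P y) = Q (Q x) := by rw [h1, ← hPQ, h2]
      rw [hPP, hQQ] at h3
      rw [map_add, h3]; abel
    · intro h
      refine ⟨P (Q (x + y)), ?_, ?_⟩
      · have h' : P (P (x + y)) = x := by rw [hPP, add_comm, h]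
        conv_lhs => rw [← h', ← hPQ, ← hPQ]
      · rw [← hPQ, hQQ, add_comm x y, h]; congr 1; abel

theorem posSqrt_spec {A : H →ₗ.[ℂ] H} (hA : IsSelfAdjoint A)
    (hpos : ∀ x y, (x, y) ∈ A.graph → 0 ≤ (inner ℂ x y).re) : IsPosSqrt A (posSqrt A) := by
  have h := exists_isPosSqrt hA hpos
  rw [posSqrt, dif_pos h]
  exact h.choose_spec

theorem IsPosSqrt.graph_nonneg {A S : H →ₗ.[ℂ] H} (h : IsPosSqrt A S) (x y : H)
    (hxy : (x, y) ∈ S.graph) : 0 ≤ (inner ℂ x y).re := by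
  obtain ⟨u, hu, hu'⟩ := (LinearPMap.mem_graph_iff _).1 hxy
  have := h.2.1 u
  simp only at hu hu'
  rwa [hu, hu'] at this

/-- A self-adjoint square root of the operator of a form `(J v, J u) ↦ ⟨v, M u⟩` has domain
`ran J` and realizes this form. -/
theorem domain_and_inner_of_sqOp_eq {A S : H →ₗ.[ℂ] H} {J M : H →L[ℂ] H} {C : ℝ}
    (hp : IsFormPair J M C) (hA : HasFormRep A J M) (hS : IsSelfAdjoint S) (hsq : sqOp S = A) :
    (∀ x, x ∈ S.domain ↔ ∃ u, J u = x) ∧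
    ∀ u v y y', (J u, y) ∈ S.graph → (J v, y') ∈ S.graph → inner ℂ y y' = inner ℂ u (M v) := by
  obtain ⟨R, N', hR, hRi, hRa, hN', h1, h2, -, -, hrep⟩ := hp.exists_resolvent
  replace hrep := hrep A hA
  have hJ := hp.selfAdjoint_left
  -- On D(A) the values z w = S(Rw) exist because A = S²; there the form identity is just symmetry
  -- of S.
  have hex : ∀ w, ∃ z, (R w, z) ∈ S.graph ∧ (z, w - (C : ℂ) • R w) ∈ S.graph := by
    intro w
    have := hrep.graph_mk w
    rwa [← hsq, mem_sqOp_graph] at this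
  choose z hz hz' using hex
  have hM : ∀ w, M (N' (J w)) = J (w - (C : ℂ) • R w) := by
    intro w
    rw [map_sub, map_smul, hRa, eq_sub_iff_add_eq]
    exact h1 _
  have hzin : ∀ u y w, (J u, y) ∈ S.graph → inner ℂ y (z w) = inner ℂ u (M (N' (J w))) := by
    intro u y w h
    rw [inner_graph_eq hS h (hz' w), inner_map_eq hJ, hM]
  have hznorm : ∀ w, ‖z w‖ ≤ (‖M‖ + 1) * ‖N' (J w)‖ := by
    intro w
    have h3 := hzin (N' (J w)) (z w) w (by rw [← hRa]; exact hz w)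
    have h4 : ‖z w‖ ^ 2 ≤ ‖N' (J w)‖ * (‖M‖ * ‖N' (J w)‖) := by
      rw [← inner_self_re, h3]
      exact (re_inner_le _ _).trans
        (mul_le_mul_of_nonneg_left (M.le_opNorm _) (norm_nonneg _))
    refine le_of_sq_le_sq ?_ (by positivity)
    rw [mul_pow]
    nlinarith [sq_nonneg ‖N' (J w)‖, norm_nonneg M, sq_nonneg (‖M‖ * ‖N' (J w)‖)]
  have hzsub : ∀ w w', z w - z w' = z (w - w') := by
    intro w w'
    have h3 := S.graph.sub_mem (hz w) (hz w')
    have h4 := hz (w - w')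
    rw [map_sub] at h4
    exact LinearPMap.mem_graph_snd_inj S h3 h4 rfl
  -- In the coordinate u with Ju = Rw, the domain of A corresponds to the vectors N'(Jw). They are
  -- dense and z is bounded in terms of them, so closedness of S extends the identity to all of ran
  -- J.
  have hdense : DenseRange (fun w => N' (J w)) := by
    have : DenseRange N' := by
      apply Function.Surjective.denseRange
      intro u
      exact ⟨_, h2 u⟩
    exact this.comp (denseRange_of_injective hJ hp.injective) N'.continuous
  have happrox : ∀ u, ∃ (y : H) (w : ℕ → H), (J u, y) ∈ S.graph ∧
      Filter.Tendsto (fun n => N' (J (w n))) Filter.atTop (nhds u) ∧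
      Filter.Tendsto (fun n => z (w n)) Filter.atTop (nhds y) := by
    intro u
    obtain ⟨s, hs, hsu⟩ := mem_closure_iff_seq_limit.1 (hdense u)
    choose w hw using hs
    have hws : (fun n => N' (J (w n))) = s := funext hw
    have hc : CauchySeq (fun n => z (w n)) := by
      have h3 := hsu.cauchySeq
      rw [Metric.cauchySeq_iff'] at h3 ⊢
      intro ε hε
      obtain ⟨n₀, hn₀⟩ := h3 (ε / (‖M‖ + 1)) (by positivity)
      refine ⟨n₀, fun n hn => ?_⟩
      have h4 := hn₀ n hn
      rw [dist_eq_norm] at h4 ⊢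
      rw [hzsub]
      refine (hznorm _).trans_lt ?_
      rw [map_sub, map_sub]
      change (‖M‖ + 1) * ‖(fun w => N' (J w)) (w n) - (fun w => N' (J w)) (w n₀)‖ < ε
      rw [hw, hw]
      rwa [lt_div_iff₀' (by positivity)] at h4
    obtain ⟨y, hy⟩ := cauchySeq_tendsto_of_complete hc
    rw [← hws] at hsu
    refine ⟨y, w, ?_, hsu, hy⟩
    have h5 : Filter.Tendsto (fun n => (R (w n), z (w n))) Filter.atTop (nhds (J u, y)) := by
      refine Filter.Tendsto.prodMk_nhds ?_ hy
      simp only [hRa]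
      exact (J.continuous.tendsto _).comp hsu
    exact (graph_isClosed hS).mem_of_tendsto h5 (Filter.Eventually.of_forall fun n => hz _)
  refine ⟨fun x => ⟨?_, ?_⟩, ?_⟩
  · intro hx
    obtain ⟨s, hs⟩ := LinearPMap.mem_domain_iff.1 hx
    -- To have x in ran J it is enough to bound ⟨x, w⟩ by ‖Jw‖. Splitting w = (w - CRw) + CRw gives
    -- ⟨Sx, z w⟩ + C⟨x, Rw⟩, and both terms contain N'(Jw).
    refine mem_range_of_inner_bound hJ hp.injective
      (c := (‖s‖ * (‖M‖ + 1) + |C| * ‖x‖ * ‖J‖) * ‖N'‖) fun w => ?_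
    have h3 : w = (w - (C : ℂ) • R w) + (C : ℂ) • R w := by abel
    have h4 : inner ℂ x w = inner ℂ s (z w) + C * inner ℂ x (R w) := by
      conv_lhs => rw [h3]
      rw [inner_add_right, inner_smul_right, ← inner_graph_eq hS hs (hz' w)]
    have h5 := N'.le_opNorm (J w)
    have h6 : ‖inner ℂ s (z w)‖ ≤ ‖s‖ * ((‖M‖ + 1) * (‖N'‖ * ‖J w‖)) := by
      refine (norm_inner_le_norm _ _).trans ?_
      gcongr
      exact (hznorm w).trans (by gcongr)
    have h7 : ‖(C : ℂ) * inner ℂ x (R w)‖ ≤ |C| * (‖x‖ * (‖J‖ * (‖N'‖ * ‖J w‖))) := by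
      rw [norm_mul, Complex.norm_real, Real.norm_eq_abs]
      gcongr
      refine (norm_inner_le_norm _ _).trans ?_
      gcongr
      rw [hRa]
      exact (J.le_opNorm _).trans (by gcongr)
    rw [h4]
    refine (norm_add_le _ _).trans ((add_le_add h6 h7).trans (le_of_eq ?_))
    ring
  · rintro ⟨u, rfl⟩
    obtain ⟨y, w, hy, -, -⟩ := happrox u
    exact LinearPMap.mem_domain_of_mem_graph hy
  · intro u v y y' hy hy'
    obtain ⟨y'', w, hy'', hw, hzw⟩ := happrox v
    obtain rfl := LinearPMap.mem_graph_snd_inj S hy' hy'' rfl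
    have h3 : Filter.Tendsto (fun n => inner ℂ y (z (w n))) Filter.atTop
        (nhds (inner ℂ y y')) := tendsto_const_nhds.inner hzw
    have h4 : Filter.Tendsto (fun n => inner ℂ y (z (w n))) Filter.atTop
        (nhds (inner ℂ u (M v))) := by
      simp only [hzin u y _ hy]
      exact tendsto_const_nhds.inner ((M.continuous.tendsto _).comp hw)
    exact tendsto_nhds_unique h3 h4

/-- A = R⁻¹ - 1 = R^(-1/2)(1 - R)R^(-1/2). Thus any nonnegative self-adjoint operator has a form
representation, with J = √R. -/
theorem HasResolventRep.hasFormRep_sqrt {A : H →ₗ.[ℂ] H} {R : H →L[ℂ] H} (hR : 0 ≤ R)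
    (h : HasResolventRep A R 1) : HasFormRep A (CFC.sqrt R) (1 - R) := by
  intro x y
  rw [h]
  simp only [Complex.ofReal_one, one_smul, sub_apply, one_apply_eq_self]
  have hPP := sqrt_sqrt_apply hR
  constructor
  · intro hxy
    have h1 : CFC.sqrt R (CFC.sqrt R (x + y)) = x := by rw [hPP, add_comm, hxy]
    refine ⟨CFC.sqrt R (x + y), h1, ?_⟩
    rw [← hPP, h1, map_add]; abel
  · rintro ⟨u, rfl, hu⟩
    rw [map_add, ← hPP, ← hu, ← hPP u, map_sub, hPP]; abel

theorem isFormPair_sqrt {R : H →L[ℂ] H} (hR : 0 ≤ R) (hinj : Function.Injective R) :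
    IsFormPair (CFC.sqrt R) (1 - R) 1 where
  selfAdjoint_left := isSelfAdjoint_sqrt R
  injective := injective_sqrt hR hinj
  selfAdjoint_right := (IsSelfAdjoint.one _).sub (IsSelfAdjoint.of_nonneg hR)
  coercive := ⟨1, one_pos, fun u => by
    rw [norm_sqrt_sq hR, sub_apply, one_apply_eq_self, inner_sub_right, Complex.sub_re,
      inner_self_re]
    linarith⟩

theorem sqOp_graph_nonneg {T : H →ₗ.[ℂ] H} (hT : IsSelfAdjoint T) (x y : H)
    (h : (x, y) ∈ (sqOp T).graph) : 0 ≤ (inner ℂ x y).re := by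
  obtain ⟨z, h1, h2⟩ := mem_sqOp_graph.1 h
  rw [← inner_graph_eq hT h1 h2, inner_self_re]
  positivity

/-- The square of a self-adjoint operator with a real point in its resolvent set. -/
theorem HasResolventRep.isSelfAdjoint_sqOp {T : H →ₗ.[ℂ] H} {R : H →L[ℂ] H} {C : ℝ}
    (h : HasResolventRep T R C) (hR : IsSelfAdjoint R) (hinj : Function.Injective R) :
    IsSelfAdjoint (sqOp T) := by
  let E : H →L[ℂ] H := 1 - (C : ℂ) • R
  have hEa : ∀ u, E u = u - (C : ℂ) • R u := fun u => rfl
  have hE : IsSelfAdjoint E := by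
    refine isSelfAdjoint_of_inner fun x y => ?_
    simp only [hEa, inner_sub_left, inner_sub_right, inner_smul_left, inner_smul_right,
      Complex.conj_ofReal, inner_map_eq hR]
  have hRE : ∀ u, R (E u) = E (R u) := fun u => by simp only [hEa, map_sub, map_smul]
  -- E equals TR, so (T² + 1)R² = E² + R² = B and the resolvent of T² at -1 is R²B⁻¹ once B is
  -- invertible.
  let B : H →L[ℂ] H := R * R + E * E
  have hBa : ∀ u, B u = R (R u) + E (E u) := fun u => rfl
  have hB : IsSelfAdjoint B := by
    refine isSelfAdjoint_of_inner fun x y => ?_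
    simp only [hBa, inner_add_left, inner_add_right, inner_map_eq hR, inner_map_eq hE]
  -- From u = Eu + CRu one gets ‖u‖² ≤ 2‖Eu‖² + 2C²‖Ru‖².
  have hc : 0 < 1 / (2 * (1 + C ^ 2)) := by positivity
  obtain ⟨B', hB', h1, h2, -⟩ := exists_inverse_of_coercive hB hc (by
    intro u
    rw [hBa, inner_add_right, ← inner_map_eq hR, ← inner_map_eq hE, Complex.add_re,
      inner_self_re, inner_self_re]
    have h3 : ‖u‖ ≤ ‖E u‖ + |C| * ‖R u‖ := by
      have : u = E u + (C : ℂ) • R u := by rw [hEa]; abel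
      conv_lhs => rw [this]
      refine (norm_add_le _ _).trans ?_
      rw [norm_smul, Complex.norm_real, Real.norm_eq_abs]
    rw [div_mul_eq_mul_div, one_mul, div_le_iff₀ (by positivity)]
    have h4 : ‖u‖ ^ 2 ≤ (‖E u‖ + |C| * ‖R u‖) ^ 2 := pow_le_pow_left₀ (norm_nonneg _) h3 2
    have h5 := sq_abs C
    nlinarith [sq_nonneg (‖E u‖ - |C| * ‖R u‖), sq_nonneg (C * ‖E u‖), sq_nonneg ‖R u‖,
      sq_nonneg ‖E u‖])
  have hBR : ∀ u, B (R u) = R (B u) := fun u => by simp only [hBa, map_add, hRE]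
  have hB'R : ∀ u, B' (R u) = R (B' u) := by
    intro u
    have : R u = B (R (B' u)) := by rw [hBR, h1]
    rw [this, h2]
  have hrep : HasResolventRep (sqOp T) (R * R * B') 1 := by
    intro x y
    rw [mem_sqOp_graph]
    simp only [Complex.ofReal_one, one_smul, mul_apply_eq_comp]
    constructor
    · rintro ⟨z, h3, h4⟩
      rw [h] at h3 h4
      set u := y + (C : ℂ) • z + (C : ℂ) • (z + (C : ℂ) • x) with hu
      have hRu : R u = z + (C : ℂ) • x := by rw [hu, map_add, h4, map_smul, h3]
      have hx : R (R u) = x := by rw [hRu, h3]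
      have hEu : E u = y + (C : ℂ) • z := by rw [hEa, hRu, hu]; abel
      have hEEu : E (E u) = y := by rw [hEu, hEa, h4]; abel
      have : B u = y + x := by rw [hBa, hx, hEEu, add_comm]
      rw [← this, h2, hx]
    · intro h3
      set u := B' (y + x) with hu
      have h4 : B u = y + x := h1 _
      have h5 : E (E u) = y := by
        rw [hBa, h3, add_comm] at h4
        exact add_right_cancel h4
      refine ⟨R (E u), ?_, ?_⟩
      · rw [h, ← h3, ← map_smul, ← map_add]
        congr 2
        rw [hEa]; abel
      · rw [h, ← h5, hRE, hEa (E u), ← hRE]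
        congr 1; abel
  refine hrep.isSelfAdjoint ?_ ?_
  · refine isSelfAdjoint_of_inner fun x y => ?_
    simp only [mul_apply_eq_comp, inner_map_eq hR, inner_map_eq hB', hB'R]
  · exact (hinj.comp hinj).comp (Function.LeftInverse.injective (g := B) h1)

/-- If D(T) ⊆ D(S) with equal norms of values, then (S + C₁)R is a bounded operator, that is R =
R₁K; passing to adjoints gives R = K*R₁ and the norm bound. -/
theorem exists_norm_transfer {T S : H →ₗ.[ℂ] H} {R R₁ : H →L[ℂ] H} {C C₁ : ℝ}
    (hT : HasResolventRep T R C) (hS : HasResolventRep S R₁ C₁)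
    (hR : IsSelfAdjoint R) (hR₁ : IsSelfAdjoint R₁)
    (h : ∀ x t, (x, t) ∈ T.graph → ∃ s, (x, s) ∈ S.graph ∧ ‖s‖ = ‖t‖) :
    ∃ c, 0 ≤ c ∧ ∀ w, ‖R w‖ ≤ c * ‖R₁ w‖ := by
  refine ⟨1 + (|C| + |C₁|) * ‖R‖, by positivity, fun w => ?_⟩
  have key : ∀ y, ∃ y₁, R₁ y₁ = R y ∧ ‖y₁‖ ≤ (1 + (|C| + |C₁|) * ‖R‖) * ‖y‖ := by
    intro y
    obtain ⟨s, hs, hst⟩ := h _ _ (hT.graph_mk y)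
    refine ⟨s + (C₁ : ℂ) • R y, (hS _ _).1 hs, ?_⟩
    have h1 : ‖s‖ ≤ ‖y‖ + |C| * ‖R y‖ := by
      rw [hst]
      refine (norm_sub_le _ _).trans ?_
      rw [norm_smul, Complex.norm_real, Real.norm_eq_abs]
    have h2 := R.le_opNorm y
    refine (norm_add_le _ _).trans ?_
    rw [norm_smul, Complex.norm_real, Real.norm_eq_abs]
    nlinarith [abs_nonneg C, abs_nonneg C₁]
  obtain ⟨y₁, h1, h2⟩ := key (R w)
  -- The adjoint step by hand: ‖Rw‖² = ⟨w, R(Rw)⟩ = ⟨w, R₁y₁⟩ = ⟨R₁w, y₁⟩ with y₁ bounded by a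
  -- multiple of ‖Rw‖.
  have h3 : ‖R w‖ ^ 2 ≤ ‖R₁ w‖ * ((1 + (|C| + |C₁|) * ‖R‖) * ‖R w‖) := by
    rw [← inner_self_re, inner_map_eq hR, ← h1, ← inner_map_eq hR₁]
    exact (re_inner_le _ _).trans (mul_le_mul_of_nonneg_left h2 (norm_nonneg _))
  rcases (norm_nonneg (R w)).eq_or_lt with h0 | h0
  · rw [← h0]; positivity
  · exact le_of_mul_le_mul_right (by nlinarith) h0

/-- For the operator `T` of a form bounded below, `D(|T|^{1/2})` is the form domain. -/
theorem mem_absSqrtDomain_iff {T : H →ₗ.[ℂ] H} {J M : H →L[ℂ] H} {C : ℝ}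
    (hp : IsFormPair J M C) (hT : HasFormRep T J M) (x : H) :
    x ∈ absSqrtDomain T ↔ ∃ u, J u = x := by
  obtain ⟨R, N', hR, hRi, hRa, -, -, -, ⟨c₁, hc₁, hlow⟩, ⟨c₂, hc₂, hup⟩, hrep⟩ :=
    hp.exists_resolvent
  replace hrep := hrep T hT
  have hJ := hp.selfAdjoint_left
  have hR0 : 0 ≤ R := by
    rw [nonneg_iff_re_inner hR]
    intro w
    rw [re_inner_comm]
    exact le_trans (by positivity) (hlow w)
  have hTs := hrep.isSelfAdjoint hR hRi
  have hAs := hrep.isSelfAdjoint_sqOp hR hRi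
  have hA0 := sqOp_graph_nonneg hTs
  have hS := posSqrt_spec hAs hA0
  obtain ⟨R', hR'0, -, hR'i, hrep'⟩ := exists_resolventRep_of_nonneg hAs hA0
  have hA := hrep'.hasFormRep_sqrt hR'0
  have hApair := isFormPair_sqrt hR'0 hR'i
  -- T and |T| are both self-adjoint square roots of T², hence have the same domain and ‖Tx‖ =
  -- ‖|T|x‖ there.
  have hfT := domain_and_inner_of_sqOp_eq hApair hA hTs rfl
  have hfS := domain_and_inner_of_sqOp_eq hApair hA hS.1 hS.2.2
  have htrans : ∀ {T₁ T₂ : H →ₗ.[ℂ] H}, ((∀ x, x ∈ T₁.domain ↔ ∃ u, CFC.sqrt R' u = x) ∧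
      ∀ u v y y', (CFC.sqrt R' u, y) ∈ T₁.graph → (CFC.sqrt R' v, y') ∈ T₁.graph →
        inner ℂ y y' = inner ℂ u ((1 - R') v)) →
      ((∀ x, x ∈ T₂.domain ↔ ∃ u, CFC.sqrt R' u = x) ∧
      ∀ u v y y', (CFC.sqrt R' u, y) ∈ T₂.graph → (CFC.sqrt R' v, y') ∈ T₂.graph →
        inner ℂ y y' = inner ℂ u ((1 - R') v)) →
      ∀ x t, (x, t) ∈ T₁.graph → ∃ s, (x, s) ∈ T₂.graph ∧ ‖s‖ = ‖t‖ := by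
    intro T₁ T₂ h₁ h₂ x t hxt
    obtain ⟨u, rfl⟩ := (h₁.1 x).1 (LinearPMap.mem_domain_of_mem_graph hxt)
    obtain ⟨s, hs⟩ := LinearPMap.mem_domain_iff.1 ((h₂.1 _).2 ⟨u, rfl⟩)
    refine ⟨s, hs, ?_⟩
    have h3 := (h₂.2 u u s s hs hs).trans (h₁.2 u u t t hxt hxt).symm
    have h4 : ‖s‖ ^ 2 = ‖t‖ ^ 2 := by rw [← inner_self_re, ← inner_self_re, h3]
    exact (pow_left_inj₀ (norm_nonneg _) (norm_nonneg _) two_ne_zero).1 h4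
  obtain ⟨R₁, hR₁0, -, hR₁i, hrep₁⟩ := exists_resolventRep_of_nonneg hS.1 hS.graph_nonneg
  have hR₁ := IsSelfAdjoint.of_nonneg hR₁0
  have hS₂ := posSqrt_spec hS.1 hS.graph_nonneg
  have hdom := (domain_and_inner_of_sqOp_eq (isFormPair_sqrt hR₁0 hR₁i)
    (hrep₁.hasFormRep_sqrt hR₁0) hS₂.1 hS₂.2.2).1 x
  obtain ⟨a, ha, hRR₁⟩ := exists_norm_transfer hrep hrep₁ hR hR₁ (htrans hfT hfS)
  obtain ⟨b, hb, hR₁R⟩ := exists_norm_transfer hrep₁ hrep hR₁ hR (htrans hfS hfT)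
  -- The resolvents of T and |T| are comparable in norm; by Heinz they are comparable as forms. So
  -- √R₁, whose range is D(|T|^(1/2)), and J have comparable norms and therefore equal ranges.
  have h1 := heinz hR₁0 hR0 ha hRR₁
  have h2 := heinz hR0 hR₁0 hb hR₁R
  refine hdom.trans ⟨?_, ?_⟩
  · rintro ⟨v, rfl⟩
    refine range_subset_of_norm_sq_le (isSelfAdjoint_sqrt _) hJ hp.injective
      (c := b * c₂) (by positivity) (fun w => ?_) v
    rw [norm_sqrt_sq hR₁0, mul_assoc]
    exact (h2 w).trans (mul_le_mul_of_nonneg_left (hup w) hb)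
  · rintro ⟨v, rfl⟩
    refine range_subset_of_norm_sq_le hJ (isSelfAdjoint_sqrt _) (injective_sqrt hR₁0 hR₁i)
      (c := a / c₁) (by positivity) (fun w => ?_) v
    rw [norm_sqrt_sq hR₁0, div_mul_eq_mul_div, le_div_iff₀ hc₁, mul_comm]
    exact (hlow w).trans (h1 w)

end SquareRoots

/-! ### Eigenspaces of bounded self-adjoint operators and the spectral bound on their complement. -/

section Eigenspaces

variable {H : Type*} [NormedAddCommGroup H] [InnerProductSpace ℂ H] [CompleteSpace H]

/-- The eigenspace of a bounded operator at a real number. -/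
def eig (R : H →L[ℂ] H) (μ : ℝ) : Submodule ℂ H :=
  Module.End.eigenspace (R : H →ₗ[ℂ] H) (μ : ℂ)

theorem mem_eig {R : H →L[ℂ] H} {μ : ℝ} {x : H} : x ∈ eig R μ ↔ R x = (μ : ℂ) • x :=
  Module.End.mem_eigenspace_iff

/-- The span of the eigenspaces with eigenvalue in `S`. -/
def eigSum (R : H →L[ℂ] H) (S : Set ℝ) : Submodule ℂ H := ⨆ μ : S, eig R μ

theorem eig_le_eigSum {R : H →L[ℂ] H} {S : Set ℝ} {μ : ℝ} (h : μ ∈ S) : eig R μ ≤ eigSum R S :=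
  le_iSup (fun μ : S => eig R μ) ⟨μ, h⟩

theorem inner_eig_eq_zero {R : H →L[ℂ] H} (hR : IsSelfAdjoint R) {μ ν : ℝ} (h : μ ≠ ν) {x y : H}
    (hx : x ∈ eig R μ) (hy : y ∈ eig R ν) : inner ℂ x y = 0 := by
  rw [mem_eig] at hx hy
  have h1 := inner_map_eq hR x y
  rw [hx, hy, inner_smul_left, inner_smul_right, Complex.conj_ofReal] at h1
  have h2 : ((μ : ℂ) - ν) * inner ℂ x y = 0 := by rw [sub_mul, h1, sub_self]
  refine (mul_eq_zero.1 h2).resolve_left ?_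
  rw [sub_eq_zero]
  exact_mod_cast h

theorem exists_sum_of_mem_eigSum {R : H →L[ℂ] H} {S : Set ℝ} {f : H} (hf : f ∈ eigSum R S) :
    ∃ (s : Finset S) (v : S → H), (∀ μ : S, v μ ∈ eig R μ) ∧ f = ∑ μ ∈ s, v μ := by
  obtain ⟨v, hv, hsum⟩ := (Submodule.mem_iSup_iff_exists_finsupp _ _).1 hf
  exact ⟨v.support, v, hv, hsum.symm⟩

theorem re_inner_sum_eig {R : H →L[ℂ] H} (hR : IsSelfAdjoint R) {S : Set ℝ} (s : Finset S)
    (v w : S → H) (hv : ∀ μ : S, v μ ∈ eig R μ) (hw : ∀ μ : S, w μ ∈ eig R μ) :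
    inner ℂ (∑ μ ∈ s, v μ) (∑ μ ∈ s, w μ) = ∑ μ ∈ s, inner ℂ (v μ) (w μ) := by
  rw [sum_inner]
  refine Finset.sum_congr rfl fun μ hμ => ?_
  rw [inner_sum]
  refine Finset.sum_eq_single_of_mem μ hμ fun ν _ hne => ?_
  refine inner_eig_eq_zero hR ?_ (hv μ) (hw ν)
  exact fun h => hne (Subtype.ext h.symm)

theorem eigSum_bounds {R : H →L[ℂ] H} (hR : IsSelfAdjoint R) {S : Set ℝ} {ε : ℝ} (hε : 0 ≤ ε)
    (hS : ∀ μ ∈ S, ε ≤ μ) {f : H} (hf : f ∈ eigSum R S) :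
    ε * ‖f‖ ^ 2 ≤ (inner ℂ f (R f)).re ∧ ε * (inner ℂ f (R f)).re ≤ ‖R f‖ ^ 2 := by
  obtain ⟨s, v, hv, rfl⟩ := exists_sum_of_mem_eigSum hf
  have hRs : R (∑ μ ∈ s, v μ) = ∑ μ ∈ s, ((μ : ℝ) : ℂ) • v μ := by
    rw [map_sum]
    exact Finset.sum_congr rfl fun μ _ => mem_eig.1 (hv μ)
  have hw : ∀ μ : S, ((μ : ℝ) : ℂ) • v μ ∈ eig R μ := fun μ => Submodule.smul_mem _ _ (hv μ)
  have h1 : ‖∑ μ ∈ s, v μ‖ ^ 2 = ∑ μ ∈ s, ‖v μ‖ ^ 2 := by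
    rw [← inner_self_re, re_inner_sum_eig hR s v v hv hv, Complex.re_sum]
    simp only [inner_self_re]
  have h2 : (inner ℂ (∑ μ ∈ s, v μ) (R (∑ μ ∈ s, v μ))).re = ∑ μ ∈ s, (μ : ℝ) * ‖v μ‖ ^ 2 := by
    rw [hRs, re_inner_sum_eig hR s v _ hv hw, Complex.re_sum]
    simp only [inner_smul_right, Complex.re_ofReal_mul, inner_self_re]
  have h3 : ‖R (∑ μ ∈ s, v μ)‖ ^ 2 = ∑ μ ∈ s, (μ : ℝ) * ((μ : ℝ) * ‖v μ‖ ^ 2) := by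
    rw [← inner_self_re, hRs, re_inner_sum_eig hR s _ _ hw hw, Complex.re_sum]
    simp only [inner_smul_right, inner_smul_left, Complex.re_ofReal_mul, inner_self_re,
      Complex.conj_ofReal]
  rw [h2, h1, h3, Finset.mul_sum, Finset.mul_sum]
  refine ⟨Finset.sum_le_sum fun μ _ => ?_, Finset.sum_le_sum fun μ _ => ?_⟩
  · exact mul_le_mul_of_nonneg_right (hS μ μ.2) (sq_nonneg _)
  · have := hS μ μ.2
    exact mul_le_mul_of_nonneg_right this (mul_nonneg (hε.trans this) (sq_nonneg _))

theorem finrank_eigSum {R : H →L[ℂ] H} (hR : IsSelfAdjoint R) (S : Finset ℝ)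
    (hfin : ∀ μ ∈ S, FiniteDimensional ℂ (eig R μ)) :
    FiniteDimensional ℂ (eigSum R S) ∧
      Module.finrank ℂ (eigSum R S) = ∑ μ ∈ S, Module.finrank ℂ (eig R μ) := by
  have hfin' : ∀ μ : (S : Set ℝ), FiniteDimensional ℂ (eig R μ) := fun μ => hfin μ μ.2
  let Φ : ((μ : (S : Set ℝ)) → eig R μ) →ₗ[ℂ] H :=
    ∑ μ : (S : Set ℝ), (eig R μ).subtype.comp (LinearMap.proj μ)
  have hΦ : ∀ v, Φ v = ∑ μ : (S : Set ℝ), (v μ : H) := fun v => by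
    simp [Φ]
  have hinj : Function.Injective Φ := by
    rw [injective_iff_map_eq_zero]
    intro v hv
    have h1 := re_inner_sum_eig hR Finset.univ (fun μ => (v μ : H)) (fun μ => (v μ : H))
      (fun μ => (v μ).2) (fun μ => (v μ).2)
    rw [← hΦ, hv, inner_zero_left] at h1
    have h2 := congrArg Complex.re h1
    rw [Complex.re_sum, Complex.zero_re] at h2
    simp only [inner_self_re] at h2
    have h3 := (Finset.sum_eq_zero_iff_of_nonneg (fun μ _ => sq_nonneg _)).1 h2.symm
    funext μ
    have := h3 μ (Finset.mem_univ _)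
    simpa using this
  have hrange : LinearMap.range Φ = eigSum R S := by
    apply le_antisymm
    · rintro _ ⟨v, rfl⟩
      rw [hΦ]
      exact Submodule.sum_mem _ fun μ _ => eig_le_eigSum μ.2 (v μ).2
    · refine iSup_le fun μ x hx => ?_
      refine ⟨Pi.single μ ⟨x, hx⟩, ?_⟩
      rw [hΦ, Finset.sum_eq_single_of_mem μ (Finset.mem_univ _)]
      · simp
      · intro ν _ hne
        simp [hne]
  have he := LinearEquiv.ofInjective Φ hinj
  rw [hrange] at he
  refine ⟨Module.Finite.equiv he, ?_⟩
  rw [← he.finrank_eq, Module.finrank_pi_fintype]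
  exact Finset.sum_coe_sort S (fun μ => Module.finrank ℂ (eig R μ))

theorem eigSum_eq_of_inter {R : H →L[ℂ] H} {S F : Set ℝ} (hF : F ⊆ S)
    (h : ∀ μ ∈ S, μ ∉ F → eig R μ = ⊥) : eigSum R S = eigSum R F := by
  apply le_antisymm
  · refine iSup_le fun μ => ?_
    by_cases hμ : (μ : ℝ) ∈ F
    · exact eig_le_eigSum hμ
    · rw [h μ μ.2 hμ]; exact bot_le
  · exact iSup_le fun μ => eig_le_eigSum (hF μ.2)

theorem mem_spectrum_of_eig_ne_bot {R : H →L[ℂ] H} {μ : ℝ} (h : eig R μ ≠ ⊥) :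
    μ ∈ spectrum ℝ R := by
  rw [← spectrum.algebraMap_mem_iff ℂ]
  have h1 : Module.End.HasEigenvalue (R : H →ₗ[ℂ] H) (μ : ℂ) := h
  have h2 := h1.mem_spectrum
  rw [ContinuousLinearMap.spectrum_eq]
  exact h2

/-- If only finitely many spectral values exceed `ε`, then the form of `R` is at most `ε` on the
orthogonal complement of the corresponding eigenspaces. -/
theorem re_inner_le_of_orthogonal {R : H →L[ℂ] H} (hR : IsSelfAdjoint R) {ε : ℝ} (hε : 0 ≤ ε)
    (hF : (spectrum ℝ R ∩ Set.Ioi ε).Finite) {g : H}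
    (hg : ∀ μ, ε < μ → ∀ x ∈ eig R μ, inner ℂ x g = 0) :
    (inner ℂ g (R g)).re ≤ ε * ‖g‖ ^ 2 := by
  classical
  -- The spectrum is the union of two closed sets, the part up to ε and a finite set, so continuity
  -- only has to be checked on the first.
  have hcont : ∀ f : ℝ → ℝ, ContinuousOn f (spectrum ℝ R ∩ Set.Iic ε) →
      ContinuousOn f (spectrum ℝ R) := by
    intro f hf
    have h1 : spectrum ℝ R = (spectrum ℝ R ∩ Set.Iic ε) ∪ (spectrum ℝ R ∩ Set.Ioi ε) := by
      rw [← Set.inter_union_distrib_left, Set.Iic_union_Ioi, Set.inter_univ]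
    rw [h1]
    exact hf.union_of_isClosed (hF.continuousOn f)
      ((spectrum.isClosed R).inter isClosed_Iic) hF.isClosed
  let p : ℝ → ℝ → ℝ := fun μ t => if t = μ then 1 else 0
  have hp : ∀ μ ∈ hF.toFinset, ContinuousOn (p μ) (spectrum ℝ R) := by
    intro μ hμ
    rw [Set.Finite.mem_toFinset] at hμ
    refine hcont _ ((continuousOn_const (c := (0 : ℝ))).congr fun t ht => ?_)
    have : t ≠ μ := fun h => lt_irrefl ε (lt_of_lt_of_le hμ.2 (h ▸ ht.2))
    simp [p, this]
  let f : ℝ → ℝ := fun t => if t ≤ ε then t else 0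
  have hf : ContinuousOn f (spectrum ℝ R) :=
    hcont _ (continuousOn_id.congr fun t ht => if_pos ht.2)
  -- The function `p μ` gives the spectral projection at the isolated point μ; its range lies in the
  -- eigenspace, which is orthogonal to g.
  have hpg : ∀ μ ∈ hF.toFinset, cfc (p μ) R g = 0 := by
    intro μ hμ
    have hRp : R * cfc (p μ) R = μ • cfc (p μ) R := by
      conv_lhs => rw [← cfc_id ℝ R]
      rw [← cfc_const_mul μ (p μ) R (hp μ hμ)]
      rw [cfc_id ℝ R]
      conv_lhs => enter [1]; rw [← cfc_id ℝ R]
      rw [← cfc_mul id (p μ) R continuousOn_id (hp μ hμ)]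
      congr 1
      funext t
      by_cases h : t = μ <;> simp [p, h]
    have hpp : cfc (p μ) R * cfc (p μ) R = cfc (p μ) R := by
      rw [← cfc_mul (p μ) (p μ) R (hp μ hμ) (hp μ hμ)]
      congr 1
      funext t
      by_cases h : t = μ <;> simp [p, h]
    have hps : IsSelfAdjoint (cfc (p μ) R) := cfc_predicate _ _
    have hmem : cfc (p μ) R g ∈ eig R μ := by
      rw [mem_eig]
      have := congrArg (fun f : H →L[ℂ] H => f g) hRp
      simpa using this
    have h0 := hg μ ((Set.Finite.mem_toFinset _).1 hμ).2 _ hmem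
    have h1 : cfc (p μ) R (cfc (p μ) R g) = cfc (p μ) R g :=
      congrArg (fun f : H →L[ℂ] H => f g) hpp
    rw [← h1, inner_map_eq hps] at h0
    simpa using h0
  have hdecomp : R = cfc f R + ∑ μ ∈ hF.toFinset, μ • cfc (p μ) R := by
    have h1 : ∑ μ ∈ hF.toFinset, μ • cfc (p μ) R
        = cfc (∑ μ ∈ hF.toFinset, fun t => μ * p μ t) R := by
      rw [cfc_sum (fun μ t => μ * p μ t) R hF.toFinset
        (fun μ hμ => continuousOn_const.mul (hp μ hμ))]
      exact Finset.sum_congr rfl fun μ hμ => (cfc_const_mul μ (p μ) R (hp μ hμ)).symm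
    have h2 : ContinuousOn (∑ μ ∈ hF.toFinset, fun t => μ * p μ t) (spectrum ℝ R) := by
      have : (∑ μ ∈ hF.toFinset, fun t => μ * p μ t)
          = fun t => ∑ μ ∈ hF.toFinset, μ * p μ t := by
        funext t; simp
      rw [this]
      exact continuousOn_finsetSum _ fun μ hμ => continuousOn_const.mul (hp μ hμ)
    rw [h1, ← cfc_add R _ _ hf h2]
    conv_lhs => rw [← cfc_id ℝ R]
    refine cfc_congr fun t ht => ?_
    simp only [id, Finset.sum_apply, p, mul_ite, mul_one, mul_zero, f, Finset.sum_ite_eq,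
      Set.Finite.mem_toFinset]
    by_cases h : t ≤ ε
    · have : ¬ (t ∈ spectrum ℝ R ∩ Set.Ioi ε) := fun h' => absurd h'.2 (not_lt.2 h)
      simp only [h, this, if_true, if_false, add_zero]
    · have : t ∈ spectrum ℝ R ∩ Set.Ioi ε := ⟨ht, not_le.1 h⟩
      simp only [h, this, if_true, if_false, zero_add]
  have hRg : R g = cfc f R g := by
    conv_lhs => rw [hdecomp]
    rw [add_apply, sum_apply, Finset.sum_eq_zero, add_zero]
    intro μ hμ
    rw [smul_apply, hpg μ hμ, smul_zero]
  have hle : cfc f R ≤ algebraMap ℝ (H →L[ℂ] H) ε := by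
    refine cfc_le_algebraMap f ε R (fun t ht => ?_) hf
    by_cases h : t ≤ ε
    · simp [f, h]
    · simp only [f, h, if_false]
      exact hε
  rw [hRg]
  have hs : IsSelfAdjoint (algebraMap ℝ (H →L[ℂ] H) ε) := IsSelfAdjoint.algebraMap _ (.all _)
  have := (le_iff_re_inner (cfc_predicate f R) hs).1 hle g
  rw [re_inner_comm]
  refine this.trans (le_of_eq ?_)
  rw [Algebra.algebraMap_eq_smul_one, smul_apply, one_apply_eq_self]
  rw [inner_smul_left_eq_smul, Complex.smul_re, inner_self_re, smul_eq_mul]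

end Eigenspaces

/-! ### Compactness of the resolvent and purely discrete spectrum. -/

section DiscreteSpectrum

variable {H : Type*} [NormedAddCommGroup H] [InnerProductSpace ℂ H] [CompleteSpace H]

/-- Above every positive level, `R` has finitely many spectral values and a finite-dimensional
sum of eigenspaces. -/
def DiscreteAbove (R : H →L[ℂ] H) : Prop :=
  ∀ ε : ℝ, 0 < ε → (spectrum ℝ R ∩ Set.Ioi ε).Finite ∧
    FiniteDimensional ℂ (eigSum R (Set.Ioi ε))

/-- The form of `R` is small on subspaces of finite codimension. -/
def SmallOffFinite (R : H →L[ℂ] H) : Prop :=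
  ∀ ε : ℝ, 0 < ε → ∃ K : Submodule ℂ H, FiniteDimensional ℂ K ∧
    ∀ g ∈ Kᗮ, (inner ℂ g (R g)).re ≤ ε * ‖g‖ ^ 2

/-- √R is a norm limit of finite-rank operators: on Kᗮ one has ‖√R g‖² = ⟨g, Rg⟩, so projecting to K
changes √R little. The level is (1/(n+1))² because √R sees its root. -/
theorem SmallOffFinite.isCompactOperator {R : H →L[ℂ] H} (hR : 0 ≤ R) (h : SmallOffFinite R) :
    IsCompactOperator R := by
  have hex : ∀ n : ℕ, ∃ K : Submodule ℂ H, FiniteDimensional ℂ K ∧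
      ∀ g ∈ Kᗮ, (inner ℂ g (R g)).re ≤ (1 / ((n : ℝ) + 1)) ^ 2 * ‖g‖ ^ 2 := fun n =>
    h _ (by positivity)
  choose K hK hKg using hex
  have hcomp : ∀ n, CompleteSpace (K n) := fun n => FiniteDimensional.complete ℂ (K n)
  let S : H →L[ℂ] H := CFC.sqrt R
  have hlim : Filter.Tendsto (fun n => S.comp ((K n).subtypeL.comp (K n).orthogonalProjectionOnto))
      Filter.atTop (nhds S) := by
    rw [tendsto_iff_norm_sub_tendsto_zero]
    refine squeeze_zero (fun _ => norm_nonneg _) (fun n => ?_)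
      tendsto_one_div_add_atTop_nhds_zero_nat
    refine ContinuousLinearMap.opNorm_le_bound _ (by positivity) fun x => ?_
    have hmem : x - ((K n).orthogonalProjectionOnto x : H) ∈ (K n)ᗮ :=
      Submodule.sub_starProjection_mem_orthogonal x
    have h1 := hKg n _ hmem
    rw [← norm_sqrt_sq hR, ← mul_pow] at h1
    have h2 := le_of_sq_le_sq h1 (by positivity)
    have h3 : ‖x - ((K n).orthogonalProjectionOnto x : H)‖ ≤ ‖x‖ := by
      have h4 := Submodule.norm_sq_eq_add_norm_sq_projection x (K n)
      have h5 := Submodule.norm_sq_eq_add_norm_sq_starProjection x (K n)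
      have h6 : x - ((K n).orthogonalProjectionOnto x : H) = (K n)ᗮ.starProjection x := by
        rw [Submodule.starProjection_orthogonal]
        rfl
      rw [h6]
      exact Submodule.norm_starProjection_apply_le _ _
    rw [sub_apply, norm_sub_rev, ContinuousLinearMap.comp_apply, ContinuousLinearMap.comp_apply,
      ← map_sub]
    exact h2.trans (mul_le_mul_of_nonneg_left h3 (by positivity))
  have hS : IsCompactOperator S := by
    refine isCompactOperator_of_tendsto hlim (Filter.Eventually.of_forall fun n => ?_)
    have : ProperSpace (K n) := FiniteDimensional.proper ℂ (K n)
    have h1 : IsCompactOperator (K n).orthogonalProjectionOnto :=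
      isCompactOperator_of_locallyCompactSpace_dom _
    exact h1.clm_comp (S.comp (K n).subtypeL)
  have h1 := hS.clm_comp S
  have h2 : (S ∘ S : H → H) = R := funext fun x => sqrt_sqrt_apply hR x
  rwa [h2] at h1

/-- Projection to K is injective on the sum of eigenspaces: there the form is at least ε‖x‖², on Kᗮ
at most (ε/2)‖x‖². -/
theorem SmallOffFinite.finiteDimensional {R : H →L[ℂ] H} (hR : IsSelfAdjoint R)
    (h : SmallOffFinite R) {ε : ℝ} (hε : 0 < ε) :
    FiniteDimensional ℂ (eigSum R (Set.Ioi ε)) := by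
  obtain ⟨K, hK, hKg⟩ := h (ε / 2) (by positivity)
  have hcomp : CompleteSpace K := FiniteDimensional.complete ℂ K
  let f : eigSum R (Set.Ioi ε) →ₗ[ℂ] K :=
    (K.orthogonalProjectionOnto : H →ₗ[ℂ] K).comp (eigSum R (Set.Ioi ε)).subtype
  refine FiniteDimensional.of_injective f ?_
  rw [injective_iff_map_eq_zero]
  intro x hx
  have h1 : (x : H) ∈ Kᗮ := Submodule.orthogonalProjectionOnto_eq_zero_iff.1 hx
  have h2 := hKg _ h1
  have h3 := (eigSum_bounds hR hε.le (fun μ hμ => le_of_lt hμ) x.2).1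
  have h4 : ‖(x : H)‖ ^ 2 = 0 := by nlinarith [sq_nonneg ‖(x : H)‖]
  simpa using h4

theorem SmallOffFinite.hasEigenvector {R : H →L[ℂ] H} (hR : 0 ≤ R) (h : SmallOffFinite R) {r : ℝ}
    (hr : 0 < r) (hs : r ∈ spectrum ℝ R) : eig R r ≠ ⊥ := by
  have hc := h.isCompactOperator hR
  rw [← spectrum.algebraMap_mem_iff ℂ] at hs
  have hne : (algebraMap ℝ ℂ r) ≠ 0 := by
    simpa using hr.ne'
  exact (hc.hasEigenvalue_iff_mem_spectrum hne).2 hs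

/-- By compactness every positive spectral value is an eigenvalue, and eigenvectors for distinct
values above ε are independent in a finite-dimensional space. -/
theorem SmallOffFinite.discreteAbove {R : H →L[ℂ] H} (hR : 0 ≤ R) (h : SmallOffFinite R) :
    DiscreteAbove R := by
  intro ε hε
  have hfd := h.finiteDimensional (IsSelfAdjoint.of_nonneg hR) hε
  refine ⟨?_, hfd⟩
  have hex : ∀ r : ↥(spectrum ℝ R ∩ Set.Ioi ε), ∃ x, x ∈ eig R r ∧ x ≠ 0 := fun r =>
    Submodule.exists_mem_ne_zero_of_ne_bot (h.hasEigenvector hR (hε.trans r.2.2) r.2.1)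
  choose x hx hx0 using hex
  let y : ↥(spectrum ℝ R ∩ Set.Ioi ε) → eigSum R (Set.Ioi ε) := fun r =>
    ⟨x r, eig_le_eigSum r.2.2 (hx r)⟩
  have hli : LinearIndependent ℂ x := by
    refine Module.End.eigenvectors_linearIndependent' (R : H →ₗ[ℂ] H)
      (fun r : ↥(spectrum ℝ R ∩ Set.Ioi ε) => ((r : ℝ) : ℂ)) ?_ x fun r => ⟨hx r, hx0 r⟩
    intro r s hrs
    exact Subtype.ext (Complex.ofReal_injective hrs)
  have hli' : LinearIndependent ℂ y := by
    refine LinearIndependent.of_comp (eigSum R (Set.Ioi ε)).subtype ?_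
    exact hli
  have : Finite ↥(spectrum ℝ R ∩ Set.Ioi ε) := hli'.finite
  exact Set.toFinite _

theorem mem_resolventSet_iff_graph {T : H →ₗ.[ℂ] H} {z : ℂ} :
    z ∈ resolventSet T ↔ ∃ R' : H →L[ℂ] H, (∀ w, (R' w, w + z • R' w) ∈ T.graph) ∧
      ∀ x y, (x, y) ∈ T.graph → R' (y - z • x) = x := by
  refine exists_congr fun R' => and_congr (forall_congr' fun w => ?_) ?_
  · constructor
    · rintro ⟨h, h'⟩
      have := LinearPMap.mem_graph T ⟨R' w, h⟩
      rwa [sub_eq_iff_eq_add.1 h'] at this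
    · intro h
      obtain ⟨u, hu, hu'⟩ := (LinearPMap.mem_graph_iff _).1 h
      simp only at hu hu'
      have hd : R' w ∈ T.domain := by rw [← hu]; exact u.2
      refine ⟨hd, ?_⟩
      have : (⟨R' w, hd⟩ : T.domain) = u := Subtype.ext hu.symm
      rw [this, hu', add_sub_cancel_right]
  · constructor
    · intro h x y hxy
      obtain ⟨u, hu, hu'⟩ := (LinearPMap.mem_graph_iff _).1 hxy
      simp only at hu hu'
      rw [← hu, ← hu']
      exact h u
    · intro h u
      exact h _ _ (LinearPMap.mem_graph T u)

/-- Spectral mapping for the resolvent. With ζ = z + C one has (T - z)R = 1 - ζR, so T - z is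
invertible exactly when ζ = 0 or ζ⁻¹ - R is invertible. -/
theorem HasResolventRep.mem_opSpectrum_iff {T : H →ₗ.[ℂ] H} {R : H →L[ℂ] H} {C : ℝ}
    (h : HasResolventRep T R C) (z : ℂ) :
    z ∈ opSpectrum T ↔ z + C ≠ 0 ∧ (z + C)⁻¹ ∈ spectrum ℂ R := by
  have key : z ∈ resolventSet T ↔ z + C = 0 ∨ (z + C)⁻¹ ∉ spectrum ℂ R := by
    rw [mem_resolventSet_iff_graph]
    have e1 : ∀ R' : H →L[ℂ] H, (∀ w, (R' w, w + z • R' w) ∈ T.graph) ↔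
        ∀ w, R (w + (z + C) • R' w) = R' w := fun R' => forall_congr' fun w => by
      rw [h, add_smul, add_assoc]
    have e2 : ∀ R' : H →L[ℂ] H, (∀ x y, (x, y) ∈ T.graph → R' (y - z • x) = x) ↔
        ∀ v, R' (v - (z + C) • R v) = R v := by
      intro R'
      constructor
      · intro h' v
        have := h' _ _ (h.graph_mk v)
        rw [← this]
        congr 1
        rw [this, add_smul]; abel
      · intro h' x y hxy
        have h1 := (h x y).1 hxy
        have := h' (y + (C : ℂ) • x)
        rw [h1] at this
        conv_rhs => rw [← this]
        congr 1
        rw [add_smul]; abel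
    simp only [e1, e2]
    by_cases hz : z + C = 0
    · simp only [hz, true_or, iff_true]
      exact ⟨R, by simp, by simp⟩
    · simp only [hz, false_or]
      set ζ : ℂ := z + C with hζ
      rw [spectrum.notMem_iff]
      have hal : ∀ v, (algebraMap ℂ (H →L[ℂ] H) ζ⁻¹ - R) v = ζ⁻¹ • v - R v := fun v => by
        rw [Algebra.algebraMap_eq_smul_one]; rfl
      constructor
      · rintro ⟨R', h1, h2⟩
        -- If R' inverts T - z, then (ζ⁻¹ - R)⁻¹ = ζ(1 - ζR)⁻¹ = ζ(1 + ζR').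
        let B : H →L[ℂ] H := ζ • (1 + ζ • R')
        have hB : ∀ v, B v = ζ • (v + ζ • R' v) := fun v => rfl
        refine ⟨⟨algebraMap ℂ (H →L[ℂ] H) ζ⁻¹ - R, B, ?_, ?_⟩, rfl⟩
        · ext w
          rw [mul_apply_eq_comp, hal, hB, map_smul, h1, inv_smul_smul₀ hz, one_apply_eq_self]
          abel
        · ext v
          rw [mul_apply_eq_comp, hal, hB, one_apply_eq_self]
          have h3 : ζ⁻¹ • v - R v = ζ⁻¹ • (v - ζ • R v) := by
            rw [smul_sub, inv_smul_smul₀ hz]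
          rw [h3, map_smul, h2, smul_add, smul_inv_smul₀ hz, smul_smul, smul_smul, 
            mul_assoc, mul_inv_cancel₀ hz, mul_one]
          abel
      · rintro ⟨U, hU⟩
        let B : H →L[ℂ] H := ((U⁻¹ : (H →L[ℂ] H)ˣ) : H →L[ℂ] H)
        have hUB : ∀ w, ζ⁻¹ • B w - R (B w) = w := by
          intro w
          rw [← hal, ← hU]
          exact congrArg (fun f : H →L[ℂ] H => f w) U.mul_inv
        have hBU : ∀ v, B (ζ⁻¹ • v - R v) = v := by
          intro v
          rw [← hal, ← hU]
          exact congrArg (fun f : H →L[ℂ] H => f v) U.inv_mul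
        refine ⟨ζ⁻¹ • (R * B), fun w => ?_, fun v => ?_⟩
        · rw [smul_apply, mul_apply_eq_comp, smul_inv_smul₀ hz, ← map_smul]
          congr 1
          exact (sub_eq_iff_eq_add.1 (hUB w)).symm
        · have h3 : v - ζ • R v = ζ • (ζ⁻¹ • v - R v) := by
            rw [smul_sub, smul_inv_smul₀ hz]
          rw [smul_apply, mul_apply_eq_comp, h3, map_smul, hBU, map_smul, inv_smul_smul₀ hz]
  rw [opSpectrum, Set.mem_compl_iff, key]
  tauto

theorem HasResolventRep.mem_opSpectrum_iff_real {T : H →ₗ.[ℂ] H} {R : H →L[ℂ] H} {C : ℝ}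
    (h : HasResolventRep T R C) (hR : 0 ≤ R) (z : ℂ) :
    z ∈ opSpectrum T ↔ ∃ r : ℝ, 0 < r ∧ r ∈ spectrum ℝ R ∧ z = ((r⁻¹ - C : ℝ) : ℂ) := by
  rw [h.mem_opSpectrum_iff]
  constructor
  · rintro ⟨h1, h2⟩
    have h3 := (IsSelfAdjoint.of_nonneg hR).mem_spectrum_eq_re h2
    set r := ((z + C)⁻¹).re with hr
    have h4 : r ∈ spectrum ℝ R := by
      rw [← spectrum.algebraMap_mem_iff ℂ]
      rw [h3] at h2
      exact h2
    have h5 : r ≠ 0 := by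
      intro h0
      rw [h0, Complex.ofReal_zero] at h3
      exact h1 (inv_eq_zero.1 h3)
    refine ⟨r, lt_of_le_of_ne (spectrum_nonneg_of_nonneg hR h4) h5.symm, h4, ?_⟩
    push_cast
    rw [← h3, inv_inv]; ring
  · rintro ⟨r, hr, hs, rfl⟩
    have h1 : ((r⁻¹ - C : ℝ) : ℂ) + C = (r : ℂ)⁻¹ := by push_cast; ring
    rw [h1, inv_inv]
    refine ⟨inv_ne_zero (by exact_mod_cast hr.ne'), ?_⟩
    rw [← spectrum.algebraMap_mem_iff ℂ] at hs
    exact hs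

theorem mem_opEigenspace {T : H →ₗ.[ℂ] H} {z : ℂ} {x : H} :
    x ∈ opEigenspace T z ↔ (x, z • x) ∈ T.graph := by
  rw [LinearPMap.mem_graph_iff]
  constructor
  · rintro ⟨u, hu, rfl⟩
    have h1 : T u - z • (u : H) = 0 := hu
    exact ⟨u, rfl, sub_eq_zero.1 h1⟩
  · rintro ⟨u, hu, hu'⟩
    simp only at hu hu'
    refine ⟨u, ?_, hu⟩
    change T u - z • (u : H) = 0
    rw [hu', hu, sub_self]

theorem HasResolventRep.opEigenspace_eq {T : H →ₗ.[ℂ] H} {R : H →L[ℂ] H} {C : ℝ}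
    (h : HasResolventRep T R C) {μ : ℝ} (hμ : μ + C ≠ 0) :
    opEigenspace T (μ : ℂ) = eig R (μ + C)⁻¹ := by
  ext x
  have hμ' : (μ : ℂ) + C ≠ 0 := by exact_mod_cast hμ
  rw [mem_opEigenspace, h, mem_eig, ← add_smul, map_smul]
  push_cast
  rw [eq_inv_smul_iff₀ hμ']

theorem HasResolventRep.opEigenspace_eq_bot {T : H →ₗ.[ℂ] H} {R : H →L[ℂ] H} {C : ℝ}
    (h : HasResolventRep T R C) (hR : 0 ≤ R) {μ : ℝ} (hμ : μ + C ≤ 0) :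
    opEigenspace T (μ : ℂ) = ⊥ := by
  rcases hμ.lt_or_eq with h1 | h1
  · rw [h.opEigenspace_eq h1.ne]
    by_contra h2
    have := spectrum_nonneg_of_nonneg hR (mem_spectrum_of_eig_ne_bot h2)
    exact absurd (inv_nonneg.1 this) (not_le.2 h1)
  · rw [Submodule.eq_bot_iff]
    intro x hx
    rw [mem_opEigenspace, h, ← add_smul, ← Complex.ofReal_add, h1] at hx
    simpa using hx.symm

theorem eig_finiteDimensional {R : H →L[ℂ] H} (h : DiscreteAbove R) {r : ℝ} (hr : 0 < r) :
    FiniteDimensional ℂ (eig R r) := by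
  have := (h (r / 2) (by positivity)).2
  exact Submodule.finiteDimensional_of_le
    (eig_le_eigSum (S := Set.Ioi (r / 2)) (by simp; linarith))

theorem HasResolventRep.hasPurelyDiscreteSpectrum {T : H →ₗ.[ℂ] H} {R : H →L[ℂ] H} {C : ℝ}
    (h : HasResolventRep T R C) (hR : 0 ≤ R) (hs : SmallOffFinite R) :
    HasPurelyDiscreteSpectrum T := by
  rw [HasPurelyDiscreteSpectrum, essSpectrum, Set.sdiff_eq_empty]
  intro z hz
  obtain ⟨r, hr, hrs, rfl⟩ := (h.mem_opSpectrum_iff_real hR z).1 hz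
  have hd := hs.discreteAbove hR
  have hrC : r⁻¹ - C + C ≠ 0 := by rw [sub_add_cancel]; positivity
  have heig : opEigenspace T ((r⁻¹ - C : ℝ) : ℂ) = eig R r := by
    rw [h.opEigenspace_eq hrC, sub_add_cancel, inv_inv]
  refine ⟨hz, ?_, ?_, ?_⟩
  · set z : ℂ := ((r⁻¹ - C : ℝ) : ℂ) with hzdef
    -- A point s⁻¹ - C of the ball around r⁻¹ - C has s⁻¹ < 2r⁻¹, so s > r/2, and only finitely many
    -- spectral values of R lie there.
    have hfin : (opSpectrum T ∩ Metric.ball z r⁻¹).Finite := by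
      refine ((hd (r / 2) (by positivity)).1.image
        (fun s : ℝ => ((s⁻¹ - C : ℝ) : ℂ))).subset ?_
      rintro z' ⟨hz', hball⟩
      obtain ⟨s, hs0, hss, rfl⟩ := (h.mem_opSpectrum_iff_real hR z').1 hz'
      refine ⟨s, ⟨hss, ?_⟩, rfl⟩
      rw [Metric.mem_ball, Complex.dist_eq, hzdef, ← Complex.ofReal_sub, Complex.norm_real,
        Real.norm_eq_abs, sub_sub_sub_cancel_right] at hball
      have h1 := (abs_lt.1 hball).2
      have h2 : s⁻¹ < (r / 2)⁻¹ := by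
        rw [inv_div, div_eq_mul_inv]; linarith
      exact (inv_lt_inv₀ hs0 (by positivity)).1 h2
    have hcl : IsClosed ((opSpectrum T ∩ Metric.ball z r⁻¹) \ {z}) :=
      (hfin.subset Set.sdiff_subset).isClosed
    obtain ⟨ε, hε, hball⟩ := Metric.mem_nhds_iff.1
      (hcl.isOpen_compl.mem_nhds (show z ∈ _ from fun h' => h'.2 rfl))
    refine ⟨min ε r⁻¹, lt_min hε (by positivity), ?_⟩
    rintro z' ⟨h1, h2⟩
    by_contra h3
    exact hball (Metric.ball_subset_ball (min_le_left _ _) h2)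
      ⟨⟨h1, Metric.ball_subset_ball (min_le_right _ _) h2⟩, h3⟩
  · rw [heig]
    exact hs.hasEigenvector hR hr hrs
  · rw [heig]
    exact eig_finiteDimensional hd hr

/-- Infinitely many spectral values of R above ε would accumulate at some r ≥ ε of the compact
spectrum, and r⁻¹ - C would not be isolated in the spectrum of T. -/
theorem HasResolventRep.discreteAbove {T : H →ₗ.[ℂ] H} {R : H →L[ℂ] H} {C : ℝ}
    (h : HasResolventRep T R C) (hR : 0 ≤ R) (hT : HasPurelyDiscreteSpectrum T) :
    DiscreteAbove R := by
  rw [HasPurelyDiscreteSpectrum, essSpectrum, Set.sdiff_eq_empty] at hT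
  intro ε hε
  have hdisc : ∀ r, 0 < r → r ∈ spectrum ℝ R → ((r⁻¹ - C : ℝ) : ℂ) ∈ discreteSpectrum T :=
    fun r hr hs => hT ((h.mem_opSpectrum_iff_real hR _).2 ⟨r, hr, hs, rfl⟩)
  have hfin : (spectrum ℝ R ∩ Set.Ioi ε).Finite := by
    by_contra hinf
    have hcomp : IsCompact (spectrum ℝ R ∩ Set.Ici ε) :=
      (spectrum.isCompact R).inter_right isClosed_Ici
    obtain ⟨r, ⟨hr, hrε⟩, hacc⟩ := Set.Infinite.exists_accPt_of_subset_isCompact hinf hcomp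
      (Set.inter_subset_inter_right _ Set.Ioi_subset_Ici_self)
    have hr0 : 0 < r := hε.trans_le hrε
    obtain ⟨-, ⟨η, hη, hball⟩, -, -⟩ := hdisc r hr0 hr
    have hcont : ContinuousAt (fun s : ℝ => ((s⁻¹ - C : ℝ) : ℂ)) r :=
      Complex.continuous_ofReal.continuousAt.comp
        ((continuousAt_inv₀ hr0.ne').sub continuousAt_const)
    have hnhds := hcont (Metric.ball_mem_nhds _ hη)
    rw [accPt_iff_nhds] at hacc
    obtain ⟨s, ⟨hs1, hs2⟩, hne⟩ := hacc _ hnhds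
    have hs0 : 0 < s := hε.trans hs2.2
    have := hball ⟨(h.mem_opSpectrum_iff_real hR _).2 ⟨s, hs0, hs2.1, rfl⟩, hs1⟩
    have h1 : ((s⁻¹ - C : ℝ) : ℂ) = ((r⁻¹ - C : ℝ) : ℂ) := this
    have h2 := Complex.ofReal_injective h1
    exact hne (inv_injective (sub_left_injective h2))
  refine ⟨hfin, ?_⟩
  have h1 : eigSum R (Set.Ioi ε) = eigSum R (hfin.toFinset : Set ℝ) := by
    refine eigSum_eq_of_inter ?_ ?_
    · intro μ hμ
      rw [Set.Finite.coe_toFinset] at hμ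
      exact hμ.2
    · intro μ hμ hμ'
      by_contra hne
      rw [Set.Finite.coe_toFinset] at hμ'
      exact hμ' ⟨mem_spectrum_of_eig_ne_bot hne, hμ⟩
  rw [h1]
  refine (finrank_eigSum (IsSelfAdjoint.of_nonneg hR) _ fun r hr => ?_).1
  rw [Set.Finite.mem_toFinset] at hr
  have hr0 : 0 < r := hε.trans hr.2
  have h2 := (hdisc r hr0 hr.1).2.2.2
  rwa [h.opEigenspace_eq (by rw [sub_add_cancel]; positivity), sub_add_cancel, inv_inv] at h2

/-- If the form of `R` is bounded below by a positive constant on the range of an injective linear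
map, then the source of this map is finite-dimensional as soon as `R` is discrete above. -/
theorem DiscreteAbove.finiteDimensional_of_lower_bound {R : H →L[ℂ] H} (hR : IsSelfAdjoint R)
    (h : DiscreteAbove R) {E : Submodule ℂ H} {c : ℝ} (hc : 0 < c)
    (hE : ∀ f ∈ E, c * ‖f‖ ^ 2 ≤ (inner ℂ f (R f)).re) : FiniteDimensional ℂ E := by
  obtain ⟨hfin, hfd⟩ := h (c / 2) (by positivity)
  have hcomp : CompleteSpace (eigSum R (Set.Ioi (c / 2))) := FiniteDimensional.complete ℂ _
  let f : E →ₗ[ℂ] eigSum R (Set.Ioi (c / 2)) :=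
    ((eigSum R (Set.Ioi (c / 2))).orthogonalProjectionOnto : H →ₗ[ℂ] _).comp E.subtype
  refine FiniteDimensional.of_injective f ?_
  rw [injective_iff_map_eq_zero]
  intro x hx
  have h1 : (x : H) ∈ (eigSum R (Set.Ioi (c / 2)))ᗮ :=
    Submodule.orthogonalProjectionOnto_eq_zero_iff.1 hx
  -- A vector of E orthogonal to the eigenspaces above c/2 has form at most (c/2)‖x‖², against the
  -- lower bound c‖x‖²; it vanishes.
  have h2 := re_inner_le_of_orthogonal hR (by positivity) hfin (g := (x : H))
    fun μ hμ y hy => (Submodule.mem_orthogonal _ _).1 h1 y (eig_le_eigSum hμ hy)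
  have h3 := hE x x.2
  have h4 : ‖(x : H)‖ ^ 2 = 0 := by nlinarith [sq_nonneg ‖(x : H)‖]
  simpa using h4

end DiscreteSpectrum

/-! ### Eigenvalue sequences: enumeration with multiplicity and min-max. -/

/-- A locally finite multiplicity function on the real line, bounded below and with infinite
support, is enumerated by a monotone sequence. -/
theorem exists_sequence_of_multiplicity (mult : ℝ → ℕ)
    (hfin : ∀ μ, {s | s ≤ μ ∧ mult s ≠ 0}.Finite) (hinf : {s | mult s ≠ 0}.Infinite) :
    ∃ ev : ℕ → ℝ, Monotone ev ∧ Filter.Tendsto ev Filter.atTop Filter.atTop ∧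
      (∀ μ, {n | ev n = μ}.encard = mult μ) ∧
      ∀ n, mult (ev n) ≠ 0 ∧ ∑ s ∈ (hfin (ev n)).toFinset.erase (ev n), mult s ≤ n ∧
        n < ∑ s ∈ (hfin (ev n)).toFinset, mult s := by
  classical
  let A : ℝ → Finset ℝ := fun μ => (hfin μ).toFinset
  have hA : ∀ μ s, s ∈ A μ ↔ s ≤ μ ∧ mult s ≠ 0 := fun μ s => Set.Finite.mem_toFinset _
  -- `N` counts values ≤ μ and `N'` values < μ, with multiplicity. As indices start at 0, `ev n` is
  -- the unique μ with N' μ ≤ n < N μ.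
  let N : ℝ → ℕ := fun μ => ∑ s ∈ A μ, mult s
  let N' : ℝ → ℕ := fun μ => ∑ s ∈ (A μ).erase μ, mult s
  have hNN' : ∀ μ, N μ = N' μ + mult μ := by
    intro μ
    by_cases h : mult μ = 0
    · have : μ ∉ A μ := fun h' => ((hA _ _).1 h').2 h
      simp only [N, N', Finset.erase_eq_of_notMem this, h, add_zero]
    · exact (Finset.sum_erase_add _ _ ((hA _ _).2 ⟨le_rfl, h⟩)).symm
  have hlt : ∀ μ ν, μ < ν → N μ ≤ N' ν := by
    intro μ ν h
    refine Finset.sum_le_sum_of_subset fun s hs => ?_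
    have hs' := (hA _ _).1 hs
    exact Finset.mem_erase.2 ⟨(hs'.1.trans_lt h).ne, (hA _ _).2 ⟨hs'.1.trans h.le, hs'.2⟩⟩
  have hmono : ∀ μ ν, μ ≤ ν → N μ ≤ N ν := by
    intro μ ν h
    refine Finset.sum_le_sum_of_subset fun s hs => ?_
    have hs' := (hA _ _).1 hs
    exact (hA _ _).2 ⟨hs'.1.trans h, hs'.2⟩
  have hex : ∀ n, ∃ μ, mult μ ≠ 0 ∧ N' μ ≤ n ∧ n < N μ := by
    intro n
    obtain ⟨t, ht, htn⟩ := hinf.exists_subset_card_eq (n + 1)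
    have htne : t.Nonempty := by rw [← Finset.card_pos, htn]; omega
    have hbig : n < N (t.max' htne) := by
      have h1 : ∑ s ∈ t, 1 ≤ N (t.max' htne) := by
        refine (Finset.sum_le_sum (g := mult) fun s hs => Nat.one_le_iff_ne_zero.2 (ht hs)).trans ?_
        exact Finset.sum_le_sum_of_subset fun s hs => (hA _ _).2 ⟨t.le_max' s hs, ht hs⟩
      rw [Finset.sum_const, smul_eq_mul, mul_one, htn] at h1
      omega
    have hmem := ht (t.max'_mem htne)
    set μ₀ := t.max' htne
    -- Take the smallest value of the support whose count exceeds n; if N' μ > n, its predecessor in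
    -- the support would already qualify.
    have hB : ((A μ₀).filter fun s => n < N s).Nonempty :=
      ⟨μ₀, Finset.mem_filter.2 ⟨(hA _ _).2 ⟨le_rfl, hmem⟩, hbig⟩⟩
    set μ := ((A μ₀).filter fun s => n < N s).min' hB with hμ
    have hμm := Finset.mem_filter.1 (Finset.min'_mem _ hB)
    rw [← hμ] at hμm
    have hμA := (hA _ _).1 hμm.1
    refine ⟨μ, hμA.2, ?_, hμm.2⟩
    by_contra hcon
    rw [not_le] at hcon
    have hD : ((A μ).erase μ).Nonempty := by
      rw [Finset.nonempty_iff_ne_empty]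
      intro h0
      simp only [N', h0, Finset.sum_empty] at hcon
      omega
    set s := ((A μ).erase μ).max' hD with hs
    have hsm := Finset.mem_erase.1 (Finset.max'_mem _ hD)
    rw [← hs] at hsm
    have hsA := (hA _ _).1 hsm.2
    have hsμ : s < μ := lt_of_le_of_ne hsA.1 hsm.1
    have hNs : N' μ ≤ N s := by
      refine Finset.sum_le_sum_of_subset fun r hr => ?_
      have h1 := Finset.le_max' _ _ hr
      have h2 := (hA _ _).1 (Finset.mem_erase.1 hr).2
      exact (hA _ _).2 ⟨h1, h2.2⟩
    have hsB : s ∈ (A μ₀).filter fun s => n < N s :=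
      Finset.mem_filter.2 ⟨(hA _ _).2 ⟨hsA.1.trans hμA.1, hsA.2⟩, hcon.trans_le hNs⟩
    exact absurd (Finset.min'_le _ _ hsB) (not_le.2 hsμ)
  choose ev hev using hex
  have huniq : ∀ n μ, N' μ ≤ n → n < N μ → ev n = μ := by
    intro n μ h1 h2
    rcases lt_trichotomy (ev n) μ with h | h | h
    · have := hlt _ _ h
      have := (hev n).2.2
      omega
    · exact h
    · have := hlt _ _ h
      have := (hev n).2.1
      omega
  have hevmono : Monotone ev := by
    intro n m hnm
    by_contra h
    have := hlt _ _ (not_le.1 h)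
    have := (hev n).2.1
    have := (hev m).2.2
    omega
  refine ⟨ev, hevmono, ?_, ?_, hev⟩
  · refine Filter.tendsto_atTop_atTop.2 fun b => ⟨N b, fun n hn => ?_⟩
    by_contra h
    have := hmono _ _ (not_le.1 h).le
    have := (hev n).2.2
    omega
  · intro μ
    have : {n | ev n = μ} = (Finset.Ico (N' μ) (N μ) : Finset ℕ) := by
      ext n
      rw [Set.mem_ofPred_eq, Finset.mem_coe, Finset.mem_Ico]
      constructor
      · rintro rfl
        exact (hev n).2
      · rintro ⟨h1, h2⟩
        exact huniq n μ h1 h2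
    rw [this, Set.encard_coe_eq_coe_finsetCard, Nat.card_Ico, hNN', Nat.add_sub_cancel_left]

section EigenvalueSequences

variable {H : Type*} [NormedAddCommGroup H] [InnerProductSpace ℂ H] [CompleteSpace H]

/-- The min-max characterization of the sequence `ev` for the form `(J v, J u) ↦ ⟨v, M u⟩`. -/
def IsMinMaxSequence (J M : H →L[ℂ] H) (ev : ℕ → ℝ) : Prop :=
  ∀ n, (∃ E : Submodule ℂ H, FiniteDimensional ℂ E ∧ n < Module.finrank ℂ E ∧
      ∀ u ∈ E, (inner ℂ u (M u)).re ≤ ev n * ‖J u‖ ^ 2) ∧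
    ∃ Z : Submodule ℂ H, FiniteDimensional ℂ Z ∧ Module.finrank ℂ Z ≤ n ∧
      ∀ u, (∀ z ∈ Z, inner ℂ z (J u) = 0) → ev n * ‖J u‖ ^ 2 ≤ (inner ℂ u (M u)).re

theorem smallOffFinite_of_le {J R : H →L[ℂ] H} {c : ℝ}
    (hc : 0 ≤ c) (hup : ∀ w, (inner ℂ w (R w)).re ≤ c * ‖J w‖ ^ 2)
    (hsmall : ∀ ε : ℝ, 0 < ε → ∃ K : Submodule ℂ H, FiniteDimensional ℂ K ∧
      ∀ g ∈ Kᗮ, ‖J g‖ ^ 2 ≤ ε * ‖g‖ ^ 2) : SmallOffFinite R := by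
  intro ε hε
  obtain ⟨K, hK, hKg⟩ := hsmall (ε / (c + 1)) (by positivity)
  refine ⟨K, hK, fun g hg => (hup g).trans ?_⟩
  have h1 := hKg g hg
  rw [div_mul_eq_mul_div, le_div_iff₀ (by positivity)] at h1
  nlinarith [sq_nonneg ‖J g‖]

/-- Smallness of J makes the resolvent compact, and the eigenvalues s of T correspond to (s + C)⁻¹
for R. The min-max spaces are spans of eigenvectors up to `ev n` and strictly below it. -/
theorem exists_eigenvalueSequence {T : H →ₗ.[ℂ] H} {J M : H →L[ℂ] H} {C : ℝ}
    (hp : IsFormPair J M C) (hT : HasFormRep T J M) (hH : ¬ FiniteDimensional ℂ H)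
    (hsmall : ∀ ε : ℝ, 0 < ε → ∃ K : Submodule ℂ H, FiniteDimensional ℂ K ∧
      ∀ g ∈ Kᗮ, ‖J g‖ ^ 2 ≤ ε * ‖g‖ ^ 2) :
    ∃ ev : ℕ → ℝ, IsEigenvalueSequence T ev ∧ Filter.Tendsto ev Filter.atTop Filter.atTop ∧
      IsMinMaxSequence J M ev := by
  classical
  obtain ⟨R, N', hR, hRi, hRa, hN', hN1, hN2, ⟨c₁, hc₁, hlow⟩, ⟨c₂, hc₂, hup⟩, hrep⟩ :=
    hp.exists_resolvent
  replace hrep := hrep T hT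
  have hJ := hp.selfAdjoint_left
  have hM := hp.selfAdjoint_right
  have hR0 : 0 ≤ R := by
    rw [nonneg_iff_re_inner hR]
    intro w
    rw [re_inner_comm]
    exact le_trans (by positivity) (hlow w)
  have hs := smallOffFinite_of_le hc₂ hup hsmall
  have hd := hs.discreteAbove hR0
  have hess : essSpectrum T = ∅ := hrep.hasPurelyDiscreteSpectrum hR0 hs
  let mult : ℝ → ℕ := fun μ => Module.finrank ℂ (opEigenspace T (μ : ℂ))
  have hpos : ∀ s, mult s ≠ 0 → 0 < s + C := by
    intro s hs0
    by_contra h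
    apply hs0
    have h1 := congrArg (fun p : Submodule ℂ H => Module.finrank ℂ p)
      (hrep.opEigenspace_eq_bot hR0 (not_lt.1 h))
    simpa using h1
  have hmult : ∀ s, 0 < s + C → mult s = Module.finrank ℂ (eig R (s + C)⁻¹) := by
    intro s h
    exact congrArg (fun p : Submodule ℂ H => Module.finrank ℂ p) (hrep.opEigenspace_eq h.ne')
  have hfin : ∀ μ, {s | s ≤ μ ∧ mult s ≠ 0}.Finite := by
    intro μ
    have hε : 0 < (|μ + C| + 1)⁻¹ := by positivity
    refine ((hd _ hε).1.image fun r => r⁻¹ - C).subset ?_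
    rintro s ⟨hsμ, hs0⟩
    have h1 := hpos s hs0
    refine ⟨(s + C)⁻¹, ⟨?_, ?_⟩, by simp⟩
    · apply mem_spectrum_of_eig_ne_bot
      intro hbot
      apply hs0
      rw [hmult s h1, hbot, finrank_bot]
    · refine (inv_lt_inv₀ (by positivity) h1).2 ?_
      have := le_abs_self (μ + C)
      linarith
  have hfinrank : ∀ (A : Finset ℝ) (S : Set ℝ), S ⊆ Set.Ioi 0 →
      (∀ s ∈ A, 0 < s + C ∧ (s + C)⁻¹ ∈ S) →
      (∀ s, mult s ≠ 0 → (s + C)⁻¹ ∈ S → s ∈ A) →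
      FiniteDimensional ℂ (eigSum R S) ∧
        Module.finrank ℂ (eigSum R S) = ∑ s ∈ A, mult s := by
    intro A S hS hAS hSA
    have h1 : eigSum R S = eigSum R ((A.image fun s => (s + C)⁻¹ : Finset ℝ) : Set ℝ) := by
      refine eigSum_eq_of_inter ?_ ?_
      · intro r hr
        rw [Finset.mem_coe, Finset.mem_image] at hr
        obtain ⟨s, hs, rfl⟩ := hr
        exact (hAS s hs).2
      · intro r hr hr'
        by_contra hbot
        have hr0 : 0 < r := hS hr
        have h2 : (r⁻¹ - C + C)⁻¹ = r := by rw [sub_add_cancel, inv_inv]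
        have h3 : 0 < r⁻¹ - C + C := by rw [sub_add_cancel]; positivity
        refine hr' (Finset.mem_coe.2 (Finset.mem_image.2 ⟨r⁻¹ - C, hSA _ ?_ ?_, h2⟩))
        · rw [hmult _ h3, h2]
          have := eig_finiteDimensional hd hr0
          exact fun h0 => hbot (Submodule.finrank_eq_zero.1 h0)
        · rwa [h2]
    rw [h1]
    obtain ⟨h2, h3⟩ := finrank_eigSum hR (A.image fun s => (s + C)⁻¹) (by
      intro r hr
      obtain ⟨s, hs, rfl⟩ := Finset.mem_image.1 hr
      exact eig_finiteDimensional hd (inv_pos.2 (hAS s hs).1))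
    refine ⟨h2, h3.trans ?_⟩
    rw [Finset.sum_image]
    · exact Finset.sum_congr rfl fun s hs => (hmult s (hAS s hs).1).symm
    · intro s _ t _ hst
      exact add_right_cancel (inv_injective hst)
  -- With finitely many eigenvalues the eigenspaces would span a finite-dimensional space; on its
  -- complement ⟨g, Rg⟩ ≤ 0, which forces Jg = 0 and g = 0, so H itself would be finite-dimensional.
  have hinf : {s | mult s ≠ 0}.Infinite := by
    intro hF
    obtain ⟨hfd, -⟩ := hfinrank hF.toFinset (Set.Ioi 0) le_rfl
      (fun s hs => by
        rw [Set.Finite.mem_toFinset] at hs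
        exact ⟨hpos s hs, inv_pos.2 (hpos s hs)⟩)
      (fun s hs _ => (Set.Finite.mem_toFinset _).2 hs)
    have hcomp : CompleteSpace (eigSum R (Set.Ioi 0)) := FiniteDimensional.complete ℂ _
    have hbot : (eigSum R (Set.Ioi 0))ᗮ = ⊥ := by
      rw [Submodule.eq_bot_iff]
      intro g hg
      have h1 : ∀ ε : ℝ, 0 < ε → (inner ℂ g (R g)).re ≤ ε * ‖g‖ ^ 2 := fun ε hε =>
        re_inner_le_of_orthogonal hR hε.le (hd ε hε).1 fun μ hμ x hx =>
          (Submodule.mem_orthogonal _ _).1 hg x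
            (eig_le_eigSum (S := Set.Ioi 0) (hε.trans hμ) hx)
      have h2 : (inner ℂ g (R g)).re ≤ 0 := by
        refine le_of_forall_pos_le_add fun ε hε => ?_
        have := h1 (ε / (‖g‖ ^ 2 + 1)) (by positivity)
        rw [div_mul_eq_mul_div, le_div_iff₀ (by positivity)] at this
        rw [zero_add]
        by_contra hcon
        nlinarith [sq_nonneg ‖g‖]
      have h3 : ‖J g‖ ^ 2 = 0 :=
        le_antisymm (by nlinarith [hlow g, sq_nonneg ‖J g‖]) (sq_nonneg _)
      have h4 : J g = 0 := by simpa using h3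
      exact hp.injective (by rw [h4, map_zero])
    rw [Submodule.orthogonal_eq_bot_iff] at hbot
    rw [hbot] at hfd
    exact hH (Module.Finite.equiv (Submodule.topEquiv (R := ℂ) (M := H)))
  obtain ⟨ev, hmono, htend, hcard, hev⟩ := exists_sequence_of_multiplicity mult hfin hinf
  refine ⟨ev, ⟨hmono, ?_, fun μ _ => hcard μ⟩, htend, fun n => ?_⟩
  · intro n z hz
    rw [hess] at hz
    exact absurd hz (Set.notMem_empty z)
  obtain ⟨hn0, hnle, hnlt⟩ := hev n
  set μ := ev n with hμ
  set m := μ + C with hm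
  have hm0 : 0 < m := hpos μ hn0
  have hmem : ∀ s, s ∈ (hfin μ).toFinset ↔ s ≤ μ ∧ mult s ≠ 0 :=
    fun s => Set.Finite.mem_toFinset _
  refine ⟨?_, ?_⟩
  · obtain ⟨hfd, hrank⟩ := hfinrank (hfin μ).toFinset (Set.Ici m⁻¹)
      (fun r hr => (inv_pos.2 hm0).trans_le hr)
      (fun s hs => by
        have h1 := (hmem s).1 hs
        have h2 := hpos s h1.2
        exact ⟨h2, (inv_le_inv₀ hm0 h2).2 (by rw [hm]; linarith)⟩)
      (fun s hs0 hs => by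
        have h2 := hpos s hs0
        have h3 := (inv_le_inv₀ hm0 h2).1 hs
        exact (hmem s).2 ⟨by rw [hm] at h3; linarith, hs0⟩)
    -- J ∘ B = R, so B lifts the eigenvectors of R to the coordinates u with Ju in the form domain.
    let B : H →ₗ[ℂ] H := (N' : H →ₗ[ℂ] H).comp (J : H →ₗ[ℂ] H)
    have hBi : Function.Injective B := by
      intro x y hxy
      apply hRi
      rw [hRa, hRa]
      exact congrArg J hxy
    have he := Submodule.equivMapOfInjective B hBi (eigSum R (Set.Ici m⁻¹))
    refine ⟨(eigSum R (Set.Ici m⁻¹)).map B, Module.Finite.equiv he, ?_, ?_⟩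
    · rw [← he.finrank_eq, hrank]
      exact hnlt
    · rintro _ ⟨f, hf, rfl⟩
      have h1 : J (B f) = R f := (hRa f).symm
      have h2 : M (B f) = J f - (C : ℂ) • J (R f) := by
        rw [eq_sub_iff_add_eq, ← h1]
        exact hN1 _
      have h3 := (eigSum_bounds hR (inv_pos.2 hm0).le (fun r hr => hr) hf).2
      rw [h2, inner_sub_right, inner_smul_right, ← inner_map_eq hJ, ← inner_map_eq hJ, h1,
        Complex.sub_re, Complex.re_ofReal_mul, inner_self_re, inner_map_eq hR]
      rw [inv_mul_le_iff₀ hm0, hm] at h3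
      linarith
  -- The open ray drops μ itself, so the codimension is the count N' μ ≤ n; on the complement ⟨g,
  -- Rg⟩ ≤ ‖g‖²/m.
  · obtain ⟨hfd, hrank⟩ := hfinrank ((hfin μ).toFinset.erase μ) (Set.Ioi m⁻¹)
      (fun r hr => (inv_pos.2 hm0).trans hr)
      (fun s hs => by
        rw [Finset.mem_erase] at hs
        have h1 := (hmem s).1 hs.2
        have h2 := hpos s h1.2
        have h3 := lt_of_le_of_ne h1.1 hs.1
        exact ⟨h2, (inv_lt_inv₀ hm0 h2).2 (by rw [hm]; linarith)⟩)
      (fun s hs0 hs => by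
        have h2 := hpos s hs0
        have h3 := (inv_lt_inv₀ hm0 h2).1 hs
        have h4 : s < μ := by rw [hm] at h3; linarith
        exact Finset.mem_erase.2 ⟨h4.ne, (hmem s).2 ⟨h4.le, hs0⟩⟩)
    refine ⟨eigSum R (Set.Ioi m⁻¹), hfd, by rw [hrank]; exact hnle, fun u hu => ?_⟩
    set g := J u with hg
    have h1 : (inner ℂ g (R g)).re ≤ m⁻¹ * ‖g‖ ^ 2 :=
      re_inner_le_of_orthogonal hR (inv_pos.2 hm0).le (hd _ (inv_pos.2 hm0)).1
        fun r hr x hx => hu x (eig_le_eigSum (S := Set.Ioi m⁻¹) hr hx)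
    obtain ⟨c, hc, hcoer⟩ := hp.coercive
    set q := N' (J g) with hq
    have hMq : M q = J g - (C : ℂ) • J (J q) := eq_sub_iff_add_eq.2 (hN1 _)
    have hJq : J q = R g := (hRa g).symm
    -- Let h be the form of T + C. Since q corresponds to Rg, h(u, q) = ‖g‖² and h(q) = ⟨g, Rg⟩.
    -- Expanding h(u - mq) ≥ 0 and using ⟨g, Rg⟩ ≤ ‖g‖²/m gives h(u) ≥ m‖g‖².
    have h2 := hcoer (u - (m : ℂ) • q)
    have e1 : (inner ℂ u (M q)).re = ‖g‖ ^ 2 - C * (inner ℂ g (R g)).re := by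
      rw [hMq, inner_sub_right, inner_smul_right, ← inner_map_eq hJ u g, hJq,
        ← inner_map_eq hJ u (R g), ← hg,
        Complex.sub_re, Complex.re_ofReal_mul, inner_self_re]
    have e2 : (inner ℂ q (M u)).re = ‖g‖ ^ 2 - C * (inner ℂ g (R g)).re := by
      rw [← inner_map_eq hM, re_inner_comm, e1]
    have e3 : (inner ℂ q (M q)).re = (inner ℂ g (R g)).re - C * ‖R g‖ ^ 2 := by
      rw [hMq, inner_sub_right, inner_smul_right, ← inner_map_eq hJ q g, hJq,
        ← inner_map_eq hJ q (R g), hJq, Complex.sub_re, Complex.re_ofReal_mul, inner_self_re, re_inner_comm]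
    have e4 : ‖J (u - (m : ℂ) • q)‖ ^ 2
        = ‖g‖ ^ 2 - 2 * m * (inner ℂ g (R g)).re + m ^ 2 * ‖R g‖ ^ 2 := by
      rw [map_sub, map_smul, hJq, ← hg, ← inner_self_re, inner_sub_left, inner_sub_right,
        inner_sub_right, inner_smul_left, inner_smul_right, inner_smul_left, inner_smul_right]
      simp only [Complex.conj_ofReal, Complex.sub_re, Complex.re_ofReal_mul, inner_self_re]
      rw [re_inner_comm (R g) g]
      ring
    have e5 : (inner ℂ (u - (m : ℂ) • q) (M (u - (m : ℂ) • q))).re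
        = (inner ℂ u (M u)).re - 2 * m * (‖g‖ ^ 2 - C * (inner ℂ g (R g)).re)
          + m ^ 2 * ((inner ℂ g (R g)).re - C * ‖R g‖ ^ 2) := by
      rw [map_sub, map_smul, inner_sub_left, inner_sub_right,
        inner_sub_right, inner_smul_left, inner_smul_right, inner_smul_left, inner_smul_right]
      simp only [Complex.conj_ofReal, Complex.sub_re, Complex.re_ofReal_mul]
      rw [e1, e2, e3]
      ring
    rw [e4, e5] at h2
    have h3 : 0 ≤ c * ‖u - (m : ℂ) • q‖ ^ 2 := by positivity
    have h4 : m ^ 2 * (inner ℂ g (R g)).re ≤ m * ‖g‖ ^ 2 := by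
      have := mul_le_mul_of_nonneg_left h1 (sq_nonneg m)
      refine this.trans (le_of_eq ?_)
      field_simp
    have h5 : μ = m - C := by rw [hm]; ring
    rw [h5]
    nlinarith

/-- A space of dimension above n contains a nonzero u with Ju orthogonal to Z, as dim Z ≤ n; both
min-max inequalities hold at this u. -/
theorem IsMinMaxSequence.le_of_form_le {J M M' : H →L[ℂ] H} {ev ev' : ℕ → ℝ}
    (hJ : Function.Injective J) (h : IsMinMaxSequence J M ev) (h' : IsMinMaxSequence J M' ev')
    {a b k : ℝ} (ha : 0 ≤ a) (hb : 0 ≤ b)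
    (hle : ∀ u, b * (inner ℂ u (M u)).re ≤ a * (inner ℂ u (M' u)).re + k * ‖J u‖ ^ 2) (n : ℕ) :
    b * ev n ≤ a * ev' n + k := by
  obtain ⟨-, Z, hZ, hZn, hZu⟩ := h n
  obtain ⟨⟨E, hE, hEn, hEu⟩, -⟩ := h' n
  have hcomp : CompleteSpace Z := FiniteDimensional.complete ℂ Z
  let f : E →ₗ[ℂ] Z :=
    ((Z.orthogonalProjectionOnto.comp J : H →L[ℂ] Z) : H →ₗ[ℂ] Z).comp E.subtype
  have hker : LinearMap.ker f ≠ ⊥ := LinearMap.ker_ne_bot_of_finrank_lt (hZn.trans_lt hEn)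
  obtain ⟨u, hu, hu0⟩ := Submodule.exists_mem_ne_zero_of_ne_bot hker
  have h1 : J (u : H) ∈ Zᗮ := Submodule.orthogonalProjectionOnto_eq_zero_iff.1 hu
  have h2 := hZu u fun z hz => (Submodule.mem_orthogonal _ _).1 h1 z hz
  have h3 := hEu u u.2
  have h4 : J (u : H) ≠ 0 := by
    intro h0
    apply hu0
    have : (u : H) = 0 := hJ (by rw [h0, map_zero])
    exact Subtype.ext this
  have h5 : 0 < ‖J (u : H)‖ ^ 2 := by positivity
  have h6 := hle u
  have h7 := mul_le_mul_of_nonneg_left h2 hb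
  have h8 := mul_le_mul_of_nonneg_left h3 ha
  refine le_of_mul_le_mul_right ?_ h5
  linarith

theorem tendsto_div_of_bounds {u v : ℕ → ℝ} (hv : Filter.Tendsto v Filter.atTop Filter.atTop)
    (h : ∀ a : ℝ, 0 < a → a < 1 → ∃ k : ℝ, ∀ n, (1 - a) * v n ≤ u n + k ∧
      u n ≤ (1 + a) * v n + k) :
    Filter.Tendsto (fun n => u n / v n) Filter.atTop (nhds 1) := by
  rw [Metric.tendsto_atTop]
  intro ε hε
  -- Half of ε pays for the slope a; the other half pays for k once v n > 2k/ε.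
  obtain ⟨k, hk⟩ := h (min (ε / 2) (1 / 2)) (by positivity)
    ((min_le_right _ _).trans_lt (by norm_num))
  set a := min (ε / 2) (1 / 2)
  have ha : a ≤ ε / 2 := min_le_left _ _
  obtain ⟨n₀, hn₀⟩ := Filter.eventually_atTop.1
    (hv.eventually_gt_atTop (max 0 (2 * k / ε)))
  refine ⟨n₀, fun n hn => ?_⟩
  have h1 := hn₀ n hn
  have hv0 : 0 < v n := (le_max_left _ _).trans_lt h1
  have hvk : 2 * k / ε < v n := (le_max_right _ _).trans_lt h1
  rw [div_lt_iff₀ hε] at hvk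
  obtain ⟨h2, h3⟩ := hk n
  have h4 : a * v n ≤ ε / 2 * v n := mul_le_mul_of_nonneg_right ha hv0.le
  rw [Real.dist_eq, abs_lt]
  constructor
  · rw [lt_sub_iff_add_lt, lt_div_iff₀ hv0]
    nlinarith
  · rw [sub_lt_iff_lt_add, div_lt_iff₀ hv0]
    nlinarith

end EigenvalueSequences

/-! ### From sparseness to an estimate of the hopping form. -/

section Sparseness

variable {V : Type*} (G : SimpleGraph V) [G.LocallyFinite]

theorem ncard_pairs (W : Finset V) (P : V → V → Prop) (t : V → Finset V)
    (ht : ∀ x y, y ∈ t x ↔ P x y) :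
    {p : V × V | p.1 ∈ W ∧ P p.1 p.2}.ncard = ∑ x ∈ W, (t x).card := by
  have h1 : {p : V × V | p.1 ∈ W ∧ P p.1 p.2}
      = (fun p : (_ : V) × V => (p.1, p.2)) '' (W.sigma t : Set ((_ : V) × V)) := by
    ext ⟨x, y⟩
    simp only [Set.mem_ofPred_eq, Set.mem_image, Finset.mem_coe, Finset.mem_sigma, Prod.mk.injEq]
    constructor
    · rintro ⟨hx, hy⟩
      exact ⟨⟨x, y⟩, ⟨hx, (ht x y).2 hy⟩, rfl, rfl⟩
    · rintro ⟨⟨x', y'⟩, ⟨hx, hy⟩, rfl, rfl⟩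
      exact ⟨hx, (ht _ _).1 hy⟩
  rw [h1, Set.ncard_image_of_injective, Set.ncard_coe_finset, Finset.card_sigma]
  rintro ⟨x, y⟩ ⟨x', y'⟩ h
  simp only [Prod.mk.injEq] at h
  obtain ⟨rfl, rfl⟩ := h
  rfl

/-- The degree splits into neighbours inside and outside W; adding |∂W| + q₊(W) to both sides of
sparseness turns a into 1 + a. -/
theorem IsSparse.sum_degree_le {q : V → ℝ} {a k : ℝ} (h : IsSparse G q a k) [DecidableEq V]
    (W : Finset V) :
    ∑ x ∈ W, ((G.degree x : ℝ) + pospart q x) ≤ k * W.card + (1 + a) *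
      (∑ x ∈ W, (((G.neighborFinset x).filter (· ∉ W)).card : ℝ) + ∑ x ∈ W, pospart q x) := by
  have h1 := h W
  have e1 : {p : V × V | p.1 ∈ W ∧ p.2 ∈ W ∧ G.Adj p.1 p.2}.ncard
      = ∑ x ∈ W, ((G.neighborFinset x).filter (· ∈ W)).card :=
    ncard_pairs W (fun x y => y ∈ W ∧ G.Adj x y) _ fun x y => by
      rw [Finset.mem_filter, SimpleGraph.mem_neighborFinset, and_comm]
  have e2 : {p : V × V | p.1 ∈ W ∧ p.2 ∉ W ∧ G.Adj p.1 p.2}.ncard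
      = ∑ x ∈ W, ((G.neighborFinset x).filter (· ∉ W)).card :=
    ncard_pairs W (fun x y => y ∉ W ∧ G.Adj x y) _ fun x y => by
      rw [Finset.mem_filter, SimpleGraph.mem_neighborFinset, and_comm]
  rw [e1, e2] at h1
  push_cast at h1
  have h2 : ∑ x ∈ W, (G.degree x : ℝ)
      = ∑ x ∈ W, (((G.neighborFinset x).filter (· ∈ W)).card : ℝ)
        + ∑ x ∈ W, (((G.neighborFinset x).filter (· ∉ W)).card : ℝ) := by
    rw [← Finset.sum_add_distrib]
    refine Finset.sum_congr rfl fun x _ => ?_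
    rw [← SimpleGraph.card_neighborFinset_eq_degree,
      ← Finset.card_filter_add_card_filter_not (s := G.neighborFinset x) (· ∈ W)]
    push_cast
    rfl
  rw [Finset.sum_add_distrib, h2]
  linarith

/-- The isoperimetric inequality of a sparse graph, integrated over the level sets of `f`. -/
theorem IsSparse.sum_le {q : V → ℝ} {a k : ℝ} (h : IsSparse G q a k) (W : Finset V) (f : V → ℝ)
    (hf : ∀ x, 0 ≤ f x) (hfW : ∀ x, x ∉ W → f x = 0) :
    ∑ x ∈ W, ((G.degree x : ℝ) + pospart q x) * f x ≤ k * ∑ x ∈ W, f x + (1 + a) *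
      (∑ x ∈ W, ∑ y ∈ G.neighborFinset x, max (f x - f y) 0 + ∑ x ∈ W, pospart q x * f x) := by
  classical
  induction hn : (W.filter fun x => f x ≠ 0).card using Nat.strong_induction_on generalizing f with
  | _ n ih =>
    set U := W.filter fun x => f x ≠ 0 with hU
    have hUmem : ∀ x, x ∈ U ↔ f x ≠ 0 := by
      intro x
      rw [hU, Finset.mem_filter, and_iff_right_iff_imp]
      intro hx
      by_contra hxW
      exact hx (hfW x hxW)
    rcases U.eq_empty_or_nonempty with hemp | hne
    · have h0 : ∀ x, f x = 0 := by
        intro x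
        by_contra hx
        have := (hUmem x).2 hx
        rw [hemp] at this
        exact absurd this (Finset.notMem_empty x)
      simp [h0]
    · obtain ⟨x₀, hx₀, hmin⟩ := U.exists_min_image f hne
      -- Peel off the lowest layer: f = m·1_U + g, where m is the least positive value and U the
      -- support. g has smaller support, and the inequality is the layer's isoperimetric inequality
      -- plus the one for g.
      set m := f x₀ with hm
      have hm0 : 0 < m := lt_of_le_of_ne (hf x₀) ((hUmem x₀).1 hx₀).symm
      let i : V → ℝ := fun x => if x ∈ U then 1 else 0
      let g : V → ℝ := fun x => f x - m * i x
      have hfg : ∀ x, f x = m * i x + g x := fun x => by simp [g]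
      have hgU : ∀ x, x ∉ U → g x = 0 := by
        intro x hx
        have : f x = 0 := by_contra fun h' => hx ((hUmem x).2 h')
        simp [g, i, hx, this]
      have hg0 : ∀ x, 0 ≤ g x := by
        intro x
        by_cases hx : x ∈ U
        · have := hmin x hx
          simp only [g, i, hx, if_true]
          linarith
        · rw [hgU x hx]
      have hUW : U ⊆ W := Finset.filter_subset _ _
      have hlt : (W.filter fun x => g x ≠ 0).card < n := by
        rw [← hn]
        apply Finset.card_lt_card
        refine ⟨fun x hx => ?_, fun hsub => ?_⟩
        · by_contra hxU
          exact (Finset.mem_filter.1 hx).2 (hgU x hxU)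
        · have h2 := (Finset.mem_filter.1 (hsub hx₀)).2
          apply h2
          simp [g, i, hx₀, hm]
      have hIH := ih _ hlt g hg0 (fun x hx => hgU x fun h' => hx (hUW h')) rfl
      have hsp := h.sum_degree_le G U
      have hi : ∀ F : V → ℝ, ∑ x ∈ W, F x * i x = ∑ x ∈ U, F x := by
        intro F
        simp only [i, mul_ite, mul_one, mul_zero]
        rw [Finset.sum_ite_mem, Finset.inter_eq_right.2 hUW]
      have e1 : ∀ F : V → ℝ, ∑ x ∈ W, F x * f x = m * ∑ x ∈ U, F x + ∑ x ∈ W, F x * g x := by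
        intro F
        rw [← hi, Finset.mul_sum, ← Finset.sum_add_distrib]
        refine Finset.sum_congr rfl fun x _ => ?_
        rw [hfg x]; ring
      have e2 : ∑ x ∈ W, f x = m * U.card + ∑ x ∈ W, g x := by
        have := e1 fun _ => 1
        simpa using this
      -- The positive parts split without loss: an edge inside U has the same difference for f and
      -- g, and an edge leaving U ends where f = g = 0.
      have e3 : ∑ x ∈ W, ∑ y ∈ G.neighborFinset x, max (f x - f y) 0
          = m * ∑ x ∈ U, (((G.neighborFinset x).filter (· ∉ U)).card : ℝ)
            + ∑ x ∈ W, ∑ y ∈ G.neighborFinset x, max (g x - g y) 0 := by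
        rw [← hi, Finset.mul_sum, ← Finset.sum_add_distrib]
        refine Finset.sum_congr rfl fun x _ => ?_
        rw [Finset.card_filter]
        push_cast
        rw [Finset.sum_mul, Finset.mul_sum, ← Finset.sum_add_distrib]
        refine Finset.sum_congr rfl fun y _ => ?_
        by_cases hx : x ∈ U
        · by_cases hy : y ∈ U
          · simp [g, i, hx, hy]
          · have hfy : f y = 0 := by_contra fun h' => hy ((hUmem y).2 h')
            have h3 := hmin x hx
            have h4 : 0 ≤ f x - m := by linarith
            simp [g, i, hx, hy, hfy, hf x, h4]
        · have hfx : f x = 0 := by_contra fun h' => hx ((hUmem x).2 h')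
          rw [hgU x hx, hfx, max_eq_right (by linarith [hf y]), max_eq_right (by linarith [hg0 y])]
          simp [i, hx]
      rw [e1, e1, e2, e3]
      have := mul_le_mul_of_nonneg_left hsp hm0.le
      nlinarith

/-- Over a finite set containing W and its neighbours, the edge sum becomes a double sum with
symmetric index set, so x and y can be exchanged. -/
theorem sum_neighbor_eq {W : Finset V} [DecidableEq V] [DecidableRel G.Adj] (F : V → V → ℝ)
    (hF : ∀ x y, x ∉ W → F x y = 0) :
    ∑ x ∈ W, ∑ y ∈ G.neighborFinset x, F x y =
      ∑ x ∈ W ∪ W.biUnion fun x => G.neighborFinset x,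
        ∑ y ∈ W ∪ W.biUnion fun x => G.neighborFinset x,
        if G.Adj x y then F x y else 0 := by
  rw [← Finset.sum_subset Finset.subset_union_left]
  · refine Finset.sum_congr rfl fun x hx => ?_
    rw [← Finset.sum_filter]
    refine Finset.sum_congr ?_ fun _ _ => rfl
    ext y
    rw [SimpleGraph.mem_neighborFinset, Finset.mem_filter]
    refine ⟨fun h => ⟨?_, h⟩, fun h => h.2⟩
    exact Finset.mem_union_right _
      (Finset.mem_biUnion.2 ⟨x, hx, (SimpleGraph.mem_neighborFinset _ _ _).2 h⟩)
  · intro x _ hx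
    exact Finset.sum_eq_zero fun y _ => by rw [hF x y hx, ite_self]

/-- Since r² ≤ (st)², (s² - t²)² ≤ (s² + t² - 2r)(s² + t² + 2r); weighted AM-GM with weights L and
L⁻¹ follows. For s = |φ(x)|, t = |φ(y)| and r the hopping term, the factors are |φ(x) ∓ eφ(y)|². -/
theorem abs_sq_sub_sq_le {s t r L : ℝ} (hr : |r| ≤ s * t) (hL : 0 < L) :
    |s ^ 2 - t ^ 2| ≤ ((L + L⁻¹) * (s ^ 2 + t ^ 2) - 2 * (L - L⁻¹) * r) / 2 := by
  have hr' := abs_le.1 hr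
  have hA : 0 ≤ s ^ 2 + t ^ 2 - 2 * r := by nlinarith [sq_nonneg (s - t)]
  have hB : 0 ≤ s ^ 2 + t ^ 2 + 2 * r := by nlinarith [sq_nonneg (s - t)]
  have hr2 : r ^ 2 ≤ (s * t) ^ 2 := sq_le_sq' hr'.1 hr'.2
  have hLi : 0 < L⁻¹ := inv_pos.2 hL
  have hLL : L * L⁻¹ = 1 := mul_inv_cancel₀ hL.ne'
  have e : ((L + L⁻¹) * (s ^ 2 + t ^ 2) - 2 * (L - L⁻¹) * r) / 2
      = (L * (s ^ 2 + t ^ 2 - 2 * r) + L⁻¹ * (s ^ 2 + t ^ 2 + 2 * r)) / 2 := by ring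
  rw [e]
  refine abs_le_of_sq_le_sq ?_ (by positivity)
  have h1 : (s ^ 2 - t ^ 2) ^ 2 ≤ (s ^ 2 + t ^ 2 - 2 * r) * (s ^ 2 + t ^ 2 + 2 * r) := by
    nlinarith
  have h2 : (L * L⁻¹) * ((s ^ 2 + t ^ 2 - 2 * r) * (s ^ 2 + t ^ 2 + 2 * r))
      = (L * (s ^ 2 + t ^ 2 - 2 * r)) * (L⁻¹ * (s ^ 2 + t ^ 2 + 2 * r)) := by ring
  rw [hLL, one_mul] at h2
  rw [h2] at h1
  nlinarith [sq_nonneg (L * (s ^ 2 + t ^ 2 - 2 * r) - L⁻¹ * (s ^ 2 + t ^ 2 + 2 * r))]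

/-- The form of the magnetic adjacency operator. -/
def hopForm (e : V → V → ℂ) (W : Finset V) (φ : V → ℂ) : ℝ :=
  ∑ x ∈ W, ∑ y ∈ G.neighborFinset x, (starRingEnd ℂ (φ x) * (e x y * φ y)).re

theorem sum_neighbor_const (W : Finset V) (F : V → ℝ) :
    ∑ x ∈ W, ∑ _y ∈ G.neighborFinset x, F x = ∑ x ∈ W, (G.degree x : ℝ) * F x :=
  Finset.sum_congr rfl fun x _ => by
    rw [Finset.sum_const, SimpleGraph.card_neighborFinset_eq_degree, nsmul_eq_mul]

variable {e : V → V → ℂ} (he : ∀ x y, ‖e x y‖ = 1) (he' : ∀ x y, e y x = starRingEnd ℂ (e x y))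

include he in
theorem abs_re_hop_le (φ : V → ℂ) (x y : V) :
    |(starRingEnd ℂ (φ x) * (e x y * φ y)).re| ≤ ‖φ x‖ * ‖φ y‖ := by
  refine (Complex.abs_re_le_norm _).trans (le_of_eq ?_)
  rw [norm_mul, norm_mul, he, one_mul, RCLike.norm_conj]

include he in
-- The positive parts in the two directions of an edge add up to the absolute difference, to which
-- `abs_sq_sub_sq_le` applies; symmetrising accounts for the division by 2.
theorem sum_max_le (W : Finset V) (φ : V → ℂ) (hφ : ∀ x, x ∉ W → φ x = 0) {L : ℝ} (hL : 0 < L) :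
    ∑ x ∈ W, ∑ y ∈ G.neighborFinset x, max (‖φ x‖ ^ 2 - ‖φ y‖ ^ 2) 0 ≤
      ((L + L⁻¹) * ∑ x ∈ W, (G.degree x : ℝ) * ‖φ x‖ ^ 2 - (L - L⁻¹) * hopForm G e W φ) / 2 := by
  classical
  set U := W ∪ W.biUnion fun x => G.neighborFinset x
  set r : V → V → ℝ := fun x y => (starRingEnd ℂ (φ x) * (e x y * φ y)).re with hr
  have e1 := sum_neighbor_eq G (W := W) (fun x y => max (‖φ x‖ ^ 2 - ‖φ y‖ ^ 2) 0) (by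
    intro x y hx
    rw [hφ x hx, norm_zero]
    exact max_eq_right (by nlinarith [sq_nonneg ‖φ y‖]))
  have e2 := sum_neighbor_eq G (W := W) (fun x _ => ‖φ x‖ ^ 2) (by
    intro x y hx
    rw [hφ x hx, norm_zero]; norm_num)
  have e3 := sum_neighbor_eq G (W := W) r (by
    intro x y hx
    simp [hr, hφ x hx])
  have swap : ∀ F : V → V → ℝ, ∑ x ∈ U, ∑ y ∈ U, (if G.Adj x y then F x y else 0)
      = ∑ x ∈ U, ∑ y ∈ U, (if G.Adj x y then F y x else 0) := by
    intro F
    rw [Finset.sum_comm]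
    simp only [G.adj_comm]
  rw [← sum_neighbor_const, hopForm, e1, e2]
  change _ ≤ (_ - _ * ∑ x ∈ W, ∑ y ∈ G.neighborFinset x, r x y) / 2
  rw [e3]
  have s1 := swap fun x y => max (‖φ x‖ ^ 2 - ‖φ y‖ ^ 2) 0
  have s2 := swap fun x _ => ‖φ x‖ ^ 2
  have key : ∑ x ∈ U, ∑ y ∈ U, (if G.Adj x y then max (‖φ x‖ ^ 2 - ‖φ y‖ ^ 2) 0 else 0)
      + ∑ x ∈ U, ∑ y ∈ U, (if G.Adj x y then max (‖φ y‖ ^ 2 - ‖φ x‖ ^ 2) 0 else 0)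
      ≤ (L + L⁻¹) / 2 * (∑ x ∈ U, ∑ y ∈ U, (if G.Adj x y then ‖φ x‖ ^ 2 else 0)
        + ∑ x ∈ U, ∑ y ∈ U, (if G.Adj x y then ‖φ y‖ ^ 2 else 0))
        - (L - L⁻¹) * ∑ x ∈ U, ∑ y ∈ U, (if G.Adj x y then r x y else 0) := by
    simp only [Finset.mul_sum, ← Finset.sum_add_distrib, ← Finset.sum_sub_distrib]
    refine Finset.sum_le_sum fun x _ => Finset.sum_le_sum fun y _ => ?_
    by_cases hxy : G.Adj x y
    · simp only [hxy, if_true]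
      have h1 := abs_sq_sub_sq_le (abs_re_hop_le he φ x y) hL
      have h2 : max (‖φ x‖ ^ 2 - ‖φ y‖ ^ 2) 0 + max (‖φ y‖ ^ 2 - ‖φ x‖ ^ 2) 0
          = |‖φ x‖ ^ 2 - ‖φ y‖ ^ 2| := by
        rcases le_total (‖φ x‖ ^ 2) (‖φ y‖ ^ 2) with h | h
        · rw [max_eq_right (by linarith), max_eq_left (by linarith), abs_of_nonpos (by linarith)]
          ring
        · rw [max_eq_left (by linarith), max_eq_right (by linarith), abs_of_nonneg (by linarith)]
          ring
      rw [h2]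
      refine h1.trans (le_of_eq ?_)
      simp only [hr]
      ring
    · simp [hxy]
  rw [← s1, ← s2] at key
  linarith

include he in
theorem abs_hopForm_le (W : Finset V) (φ : V → ℂ) (hφ : ∀ x, x ∉ W → φ x = 0) :
    |hopForm G e W φ| ≤ ∑ x ∈ W, (G.degree x : ℝ) * ‖φ x‖ ^ 2 := by
  classical
  set U := W ∪ W.biUnion fun x => G.neighborFinset x
  set r : V → V → ℝ := fun x y => (starRingEnd ℂ (φ x) * (e x y * φ y)).re with hr
  have e2 := sum_neighbor_eq G (W := W) (fun x _ => ‖φ x‖ ^ 2) (by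
    intro x y hx
    rw [hφ x hx, norm_zero]; norm_num)
  have e3 := sum_neighbor_eq G (W := W) (fun x y => |r x y|) (by
    intro x y hx
    simp [hr, hφ x hx])
  have s2 : ∑ x ∈ U, ∑ y ∈ U, (if G.Adj x y then ‖φ x‖ ^ 2 else 0)
      = ∑ x ∈ U, ∑ y ∈ U, (if G.Adj x y then ‖φ y‖ ^ 2 else 0) := by
    rw [Finset.sum_comm]
    simp only [G.adj_comm]
  have key : ∑ x ∈ U, ∑ y ∈ U, (if G.Adj x y then |r x y| else 0)
      ≤ (∑ x ∈ U, ∑ y ∈ U, (if G.Adj x y then ‖φ x‖ ^ 2 else 0)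
        + ∑ x ∈ U, ∑ y ∈ U, (if G.Adj x y then ‖φ y‖ ^ 2 else 0)) / 2 := by
    simp only [Finset.sum_div, ← Finset.sum_add_distrib]
    refine Finset.sum_le_sum fun x _ => Finset.sum_le_sum fun y _ => ?_
    by_cases hxy : G.Adj x y
    · simp only [hxy, if_true]
      have h1 := abs_re_hop_le he φ x y
      refine h1.trans ?_
      nlinarith [sq_nonneg (‖φ x‖ - ‖φ y‖)]
    · simp [hxy]
  rw [← s2] at key
  rw [← sum_neighbor_const, e2]
  refine (Finset.abs_sum_le_sum_abs _ _).trans ?_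
  refine (Finset.sum_le_sum fun x _ => Finset.abs_sum_le_sum_abs _ _).trans ?_
  change ∑ x ∈ W, ∑ y ∈ G.neighborFinset x, |r x y| ≤ _
  rw [e3]
  linarith

include he he' in
/-- Sparseness controls the magnetic adjacency form by the form of `deg + q₊`. -/
theorem IsSparse.hopForm_estimate {q : V → ℝ} {a k : ℝ} (h : IsSparse G q a k) (ha : 0 ≤ a)
    (W : Finset V) (φ : V → ℂ) (hφ : ∀ x, x ∉ W → φ x = 0) {L : ℝ} (hL : 0 < L) :
    (L - L⁻¹) * hopForm G e W φ ≤
      (L + L⁻¹ - 2 / (1 + a)) * ∑ x ∈ W, ((G.degree x : ℝ) + pospart q x) * ‖φ x‖ ^ 2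
        + 2 / (1 + a) * k * ∑ x ∈ W, ‖φ x‖ ^ 2 := by
  have h1 := h.sum_le G W (fun x => ‖φ x‖ ^ 2) (fun x => sq_nonneg _)
    (fun x hx => by simp [hφ x hx])
  have h2 := sum_max_le G he W φ hφ hL
  have h3 : ∑ x ∈ W, ((G.degree x : ℝ) + pospart q x) * ‖φ x‖ ^ 2
      = ∑ x ∈ W, (G.degree x : ℝ) * ‖φ x‖ ^ 2 + ∑ x ∈ W, pospart q x * ‖φ x‖ ^ 2 := by
    rw [← Finset.sum_add_distrib]
    exact Finset.sum_congr rfl fun x _ => by ring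
  have h4 : 0 ≤ ∑ x ∈ W, pospart q x * ‖φ x‖ ^ 2 :=
    Finset.sum_nonneg fun x _ => mul_nonneg (le_max_right _ _) (sq_nonneg _)
  set X₁ := ∑ x ∈ W, (G.degree x : ℝ) * ‖φ x‖ ^ 2
  set X₂ := ∑ x ∈ W, pospart q x * ‖φ x‖ ^ 2
  set n := ∑ x ∈ W, ‖φ x‖ ^ 2
  set Y := hopForm G e W φ
  set B := ∑ x ∈ W, ∑ y ∈ G.neighborFinset x, max (‖φ x‖ ^ 2 - ‖φ y‖ ^ 2) 0
  rw [h3] at h1 ⊢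
  -- Because (L + L⁻¹)/2 ≥ 1, the q₊ part can be given the same coefficient as the degree part.
  have h5 : 2 ≤ L + L⁻¹ := by
    have : L * L⁻¹ = 1 := mul_inv_cancel₀ hL.ne'
    nlinarith [sq_nonneg (L - L⁻¹), inv_pos.2 hL]
  have hpos : 0 < 1 + a := by linarith
  have h6 : B + X₂ ≤ ((L + L⁻¹) * (X₁ + X₂) - (L - L⁻¹) * Y) / 2 := by nlinarith
  have h7 : X₁ + X₂ ≤ k * n + (1 + a) * (((L + L⁻¹) * (X₁ + X₂) - (L - L⁻¹) * Y) / 2) :=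
    h1.trans (by nlinarith)
  have h8 : 2 / (1 + a) * (X₁ + X₂) ≤ 2 / (1 + a) * (k * n)
      + ((L + L⁻¹) * (X₁ + X₂) - (L - L⁻¹) * Y) := by
    have := mul_le_mul_of_nonneg_left h7 (show 0 ≤ 2 / (1 + a) by positivity)
    refine this.trans (le_of_eq ?_)
    field_simp
  nlinarith

end Sparseness

/-! ### Operators on ℓ²: diagonal operators, finitely supported functions, maximal operators. -/

section SequenceSpace

variable {V : Type*}

theorem sum_norm_sq_le (u : L2 V) (s : Finset V) : ∑ x ∈ s, ‖u x‖ ^ 2 ≤ ‖u‖ ^ 2 := by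
  have := lp.sum_rpow_le_norm_rpow (p := 2) (by norm_num) u s
  simpa using this

/-- A linear map on functions which is bounded for the `ℓ²` seminorms acts boundedly on `ℓ²`. -/
theorem exists_clm_of_sum_le (A : (V → ℂ) →ₗ[ℂ] (V → ℂ)) {c : ℝ} (hc : 0 ≤ c)
    (h : ∀ u s, ∃ t : Finset V, ∑ x ∈ s, ‖A u x‖ ^ 2 ≤ c ^ 2 * ∑ x ∈ t, ‖u x‖ ^ 2) :
    ∃ D : L2 V →L[ℂ] L2 V, ∀ u x, D u x = A u x := by
  have hb : ∀ (u : L2 V) (s : Finset V), ∑ x ∈ s, ‖A u x‖ ^ 2 ≤ (c * ‖u‖) ^ 2 := by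
    intro u s
    obtain ⟨t, ht⟩ := h u s
    rw [mul_pow]
    exact ht.trans (mul_le_mul_of_nonneg_left (sum_norm_sq_le u t) (sq_nonneg c))
  have hmem : ∀ u : L2 V, Memℓp (E := fun _ : V => ℂ) (A u) 2 := fun u =>
    memℓp_gen' (C := (c * ‖u‖) ^ 2) fun s => by simpa using hb u s
  let D₀ : L2 V →ₗ[ℂ] L2 V :=
    { toFun := fun u => ⟨A u, hmem u⟩
      map_add' := fun u v => lp.ext (by
        change A ((u + v : L2 V) : V → ℂ) = A u + A v
        rw [lp.coeFn_add, map_add])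
      map_smul' := fun r u => lp.ext (by
        change A ((r • u : L2 V) : V → ℂ) = r • A u
        rw [lp.coeFn_smul, map_smul]) }
  refine ⟨D₀.mkContinuous c fun u => ?_, fun u x => rfl⟩
  refine lp.norm_le_of_forall_sum_le (by norm_num) (mul_nonneg hc (norm_nonneg _)) fun s => ?_
  simp only [ENNReal.toReal_ofNat, Real.rpow_ofNat]
  exact hb u s

theorem exists_diagonal {g : V → ℝ} {c : ℝ} (hc : 0 ≤ c) (hg : ∀ x, |g x| ≤ c) :
    ∃ D : L2 V →L[ℂ] L2 V, ∀ u x, D u x = g x * u x := by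
  refine exists_clm_of_sum_le (LinearMap.mulLeft ℂ fun x => (g x : ℂ)) hc fun u s => ⟨s, ?_⟩
  rw [Finset.mul_sum]
  refine Finset.sum_le_sum fun x _ => ?_
  simp only [LinearMap.mulLeft_apply, Pi.mul_apply, norm_mul, Complex.norm_real, Real.norm_eq_abs]
  rw [mul_pow]
  exact mul_le_mul_of_nonneg_right (pow_le_pow_left₀ (abs_nonneg _) (hg x) 2) (sq_nonneg _)

theorem isSelfAdjoint_of_diagonal {g : V → ℝ} {D : L2 V →L[ℂ] L2 V}
    (hD : ∀ u x, D u x = g x * u x) : IsSelfAdjoint D := by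
  refine isSelfAdjoint_of_inner fun u v => ?_
  rw [lp.inner_eq_tsum, lp.inner_eq_tsum]
  refine tsum_congr fun x => ?_
  rw [hD, hD]
  simp only [RCLike.inner_apply, map_mul, Complex.conj_ofReal]
  ring

theorem isSelfAdjoint_of_single [DecidableEq V] {D : L2 V →L[ℂ] L2 V}
    (hD : ∀ x y, D (lp.single 2 y 1) x = starRingEnd ℂ (D (lp.single 2 x 1) y)) :
    IsSelfAdjoint D := by
  have : ContinuousLinearMap.adjoint D = D := by
    apply lp.ext_continuousLinearMap (p := 2) (by norm_num)
    intro y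
    ext1
    apply lp.ext
    funext x
    have h1 := lp.inner_single_left (𝕜 := ℂ) (G := fun _ : V => ℂ) x 1
      (ContinuousLinearMap.adjoint D (lp.single 2 y 1))
    rw [ContinuousLinearMap.adjoint_inner_right, lp.inner_single_right] at h1
    simp only [RCLike.inner_apply, map_one, mul_one, one_mul] at h1
    change (ContinuousLinearMap.adjoint D (lp.single 2 y 1)) x = D (lp.single 2 y 1) x
    rw [← h1, hD, Complex.conj_conj]
  exact this

theorem inner_eq_sum {u : L2 V} {W : Finset V} (hu : ∀ x ∉ W, u x = 0) (v : L2 V) :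
    inner ℂ u v = ∑ x ∈ W, starRingEnd ℂ (u x) * v x := by
  rw [lp.inner_eq_tsum, tsum_eq_sum (s := W)]
  · refine Finset.sum_congr rfl fun x _ => ?_
    rw [RCLike.inner_apply, mul_comm]
  · intro x hx
    rw [hu x hx, inner_zero_left]

theorem norm_sq_eq_sum {u : L2 V} {W : Finset V} (hu : ∀ x ∉ W, u x = 0) :
    ‖u‖ ^ 2 = ∑ x ∈ W, ‖u x‖ ^ 2 := by
  rw [← inner_self_re, inner_eq_sum hu, Complex.re_sum]
  refine Finset.sum_congr rfl fun x _ => ?_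
  rw [← Complex.normSq_eq_conj_mul_self, Complex.ofReal_re, Complex.normSq_eq_norm_sq]

theorem re_inner_diagonal {g : V → ℝ} {D : L2 V →L[ℂ] L2 V} (hD : ∀ u x, D u x = g x * u x)
    {u : L2 V} {W : Finset V} (hu : ∀ x ∉ W, u x = 0) :
    (inner ℂ u (D u)).re = ∑ x ∈ W, g x * ‖u x‖ ^ 2 := by
  rw [inner_eq_sum hu, Complex.re_sum]
  refine Finset.sum_congr rfl fun x _ => ?_
  rw [hD, mul_left_comm, ← Complex.normSq_eq_conj_mul_self, ← Complex.ofReal_mul,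
    Complex.ofReal_re, Complex.normSq_eq_norm_sq]

theorem exists_finset_of_mem_Cc {u : L2 V} (hu : u ∈ Cc V) : ∃ W : Finset V, ∀ x ∉ W, u x = 0 :=
  ⟨Set.Finite.toFinset hu, fun _ hx => by
    by_contra h
    exact hx ((Set.Finite.mem_toFinset (s := Function.support (u : V → ℂ)) hu).2 h)⟩

theorem mem_Cc_of_finset {u : L2 V} {W : Finset V} (hu : ∀ x ∉ W, u x = 0) : u ∈ Cc V := by
  refine W.finite_toSet.subset fun x hx => ?_
  by_contra h
  exact hx (hu x h)

theorem dense_Cc : Dense (Cc V : Set (L2 V)) := by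
  classical
  intro u
  have h := lp.hasSum_single (p := 2) (by norm_num) u
  refine mem_closure_of_tendsto h (Filter.Eventually.of_forall fun s => ?_)
  refine Submodule.sum_mem _ fun x _ => mem_Cc_of_finset (W := {x}) fun y hy => ?_
  exact lp.single_apply_ne _ _ _ (by simpa using hy)

/-- For bounded operators the inequality is a closed condition in u. This is the benefit of
rescaling: form estimates need only be proved on C_c(V). -/
theorem re_inner_le_of_Cc {P : L2 V →L[ℂ] L2 V} {C : ℝ}
    {J : L2 V →L[ℂ] L2 V} (h : ∀ u ∈ Cc V, (inner ℂ u (P u)).re ≤ C * ‖J u‖ ^ 2) (u : L2 V) :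
    (inner ℂ u (P u)).re ≤ C * ‖J u‖ ^ 2 := by
  have hc : IsClosed {u : L2 V | (inner ℂ u (P u)).re ≤ C * ‖J u‖ ^ 2} := by
    refine isClosed_le ?_ (by fun_prop)
    exact Complex.continuous_re.comp (by fun_prop)
  exact hc.closure_subset_iff.2 h (dense_Cc u)

theorem re_inner_diagonal_nonneg {g : V → ℝ} {D : L2 V →L[ℂ] L2 V}
    (hD : ∀ u x, D u x = g x * u x) (hg : ∀ x, 0 ≤ g x) (u : L2 V) :
    0 ≤ (inner ℂ u (D u)).re := by
  have := re_inner_le_of_Cc (P := -D) (J := D) (C := 0) (fun u hu => by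
    obtain ⟨W, hW⟩ := exists_finset_of_mem_Cc hu
    rw [zero_mul, neg_apply, inner_neg_right, Complex.neg_re, re_inner_diagonal hD hW, neg_nonpos]
    exact Finset.sum_nonneg fun x _ => mul_nonneg (hg x) (sq_nonneg _)) u
  rw [zero_mul, neg_apply, inner_neg_right, Complex.neg_re] at this
  linarith

theorem exists_lp_of_finset (f : V → ℂ) (W : Finset V) (hf : ∀ x ∉ W, f x = 0) :
    ∃ u : L2 V, ∀ x, u x = f x := by
  classical
  refine ⟨∑ x ∈ W, lp.single 2 x (f x), fun y => ?_⟩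
  rw [lp.coeFn_sum, Finset.sum_apply]
  simp only [lp.single_apply]
  rw [Finset.sum_pi_single]
  split_ifs with h
  · rfl
  · exact (hf y h).symm

theorem mem_maxOp_graph {L : (V → ℂ) →ₗ[ℂ] (V → ℂ)} {φ ψ : L2 V} :
    (φ, ψ) ∈ (maxOp L).graph ↔ ∀ x, L φ x = ψ x := by
  rw [LinearPMap.mem_graph_iff]
  constructor
  · rintro ⟨u, hu, hu'⟩ x
    simp only at hu hu'
    rw [← hu, ← hu']
    rfl
  · intro h
    have hm : φ ∈ (maxOp L).domain := by
      change Memℓp (E := fun _ : V => ℂ) (L φ) 2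
      rw [show L φ = ψ from funext h]
      exact lp.memℓp ψ
    refine ⟨⟨φ, hm⟩, rfl, lp.ext ?_⟩
    exact funext h

/-- A maximal operator which is injective after a shift is the operator of the form it extends. -/
theorem hasFormRep_maxOp {L : (V → ℂ) →ₗ[ℂ] (V → ℂ)} {J M : L2 V →L[ℂ] L2 V} {C : ℝ} {b : V → ℝ}
    (hp : IsFormPair J M C) (hb : ∀ x, 0 < b x) (hJ : ∀ u x, J u x = b x * u x)
    (hM : ∀ u x, M u x = b x * L (J u) x)
    (hinj : ∀ ψ : L2 V, (∀ x, L ψ x + C * ψ x = 0) → ψ = 0) : HasFormRep (maxOp L) J M := by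
  have hb' : ∀ x, (b x : ℂ) ≠ 0 := fun x => Complex.ofReal_ne_zero.2 (hb x).ne'
  have key : ∀ u y, M u = J y → ∀ x, L (J u) x = y x := by
    intro u y h x
    apply mul_left_cancel₀ (hb' x)
    rw [← hM, h, hJ]
  intro φ y
  rw [mem_maxOp_graph]
  constructor
  · intro h
    obtain ⟨-, N', -, -, -, -, h1, -⟩ := hp.exists_resolvent
    -- Ju is the solution of (L + C)ψ = y + Cφ in the form domain; φ solves the same equation, so
    -- their difference is annihilated by L + C.
    set u := N' (J (y + (C : ℂ) • φ)) with hu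
    have h2 : M u + (C : ℂ) • J (J u) = J (y + (C : ℂ) • φ) := h1 _
    have h3 : M u = J (y + (C : ℂ) • φ - (C : ℂ) • J u) := by
      rw [map_sub, map_smul J (C : ℂ) (J u), ← h2, add_sub_cancel_right]
    have h4 := key u _ h3
    have h5 : φ - J u = 0 := by
      apply hinj
      intro x
      have h6 := h4 x
      have h7 := h x
      simp only [lp.coeFn_sub, lp.coeFn_add, lp.coeFn_smul, Pi.sub_apply, Pi.add_apply,
        Pi.smul_apply, smul_eq_mul, map_sub] at h6 ⊢
      rw [h6, h7]
      ring
    rw [sub_eq_zero] at h5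
    refine ⟨u, h5.symm, ?_⟩
    rw [h3, ← h5, add_sub_cancel_right]
  · rintro ⟨u, rfl, hu⟩
    exact key u y hu

theorem hasFormRep_mulOp {g : V → ℝ} {J M : L2 V →L[ℂ] L2 V} {C : ℝ} {b : V → ℝ}
    (hp : IsFormPair J M C) (hb : ∀ x, 0 < b x) (hJ : ∀ u x, J u x = b x * u x)
    (hM : ∀ u x, M u x = ((g x * b x ^ 2 : ℝ) : ℂ) * u x) (hC : ∀ x, 0 < g x + C) :
    HasFormRep (mulOp g) J M := by
  refine hasFormRep_maxOp hp hb hJ (fun u x => ?_) fun ψ h => lp.ext (funext fun x => ?_)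
  · rw [hM, LinearMap.mulLeft_apply, Pi.mul_apply, hJ]
    push_cast
    ring
  · have := h x
    rw [LinearMap.mulLeft_apply, Pi.mul_apply, ← add_mul, ← Complex.ofReal_add] at this
    exact (mul_eq_zero.1 this).resolve_left (Complex.ofReal_ne_zero.2 (hC x).ne')

end SequenceSpace

/-! ### The rescaled bounded operators J, X, A and Z. -/

section ScaledForms

variable {V : Type*} (G : SimpleGraph V) [G.LocallyFinite]

/-- The bounded operators which represent the forms of `1`, `deg + q₊`, the magnetic adjacency
operator and `q₋` after rescaling by `b = (1 + deg + q₊)^{-1/2}`. -/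
structure ScaledForms (e : V → V → ℂ) (q : V → ℝ) (b : V → ℝ) (J X A Z : L2 V →L[ℂ] L2 V) :
    Prop where
  pos : ∀ x, 0 < b x
  mul_sq : ∀ x, (1 + ((G.degree x : ℝ) + pospart q x)) * b x ^ 2 = 1
  scale_apply : ∀ u x, J u x = b x * u x
  weight_apply : ∀ u x, X u x = ((((G.degree x : ℝ) + pospart q x) * b x ^ 2 : ℝ) : ℂ) * u x
  hop_apply : ∀ u x, A u x = b x * ∑ y ∈ G.neighborFinset x, e x y * J u y
  neg_apply : ∀ u x, Z u x = ((negpart q x * b x ^ 2 : ℝ) : ℂ) * u x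

variable {G}
variable {e : V → V → ℂ} {q : V → ℝ} {b : V → ℝ} {J X A Z : L2 V →L[ℂ] L2 V}

theorem pospart_nonneg (q : V → ℝ) (x : V) : 0 ≤ pospart q x := le_max_right _ _

theorem negpart_nonneg (q : V → ℝ) (x : V) : 0 ≤ negpart q x := le_max_right _ _

theorem pospart_sub_negpart (q : V → ℝ) (x : V) : pospart q x - negpart q x = q x := by
  unfold pospart negpart
  rcases le_total (q x) 0 with h | h
  · rw [max_eq_right h, max_eq_left (by linarith)]; ring
  · rw [max_eq_left h, max_eq_right (by linarith)]; ring

/-- A Schur test: Cauchy-Schwarz at x costs a factor deg x, absorbed by b(x)², and each y is then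
counted at most deg y times, absorbed by b(y)². -/
theorem sum_hop_norm_sq_le {b : V → ℝ} (he : ∀ x y, ‖e x y‖ = 1)
    (hb : ∀ x, (G.degree x : ℝ) * b x ^ 2 ≤ 1) (u : V → ℂ) (s : Finset V) :
    ∃ t : Finset V, ∑ x ∈ s, ‖b x * ∑ y ∈ G.neighborFinset x, e x y * (b y * u y)‖ ^ 2 ≤
      ∑ x ∈ t, ‖u x‖ ^ 2 := by
  classical
  refine ⟨s.biUnion fun x => G.neighborFinset x, ?_⟩
  set t := s.biUnion fun x => G.neighborFinset x
  have h1 : ∀ x, ‖b x * ∑ y ∈ G.neighborFinset x, e x y * (b y * u y)‖ ^ 2 ≤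
      ∑ y ∈ G.neighborFinset x, b y ^ 2 * ‖u y‖ ^ 2 := by
    intro x
    have h2 : ‖∑ y ∈ G.neighborFinset x, e x y * (b y * u y)‖ ≤
        ∑ y ∈ G.neighborFinset x, |b y| * ‖u y‖ :=
      (norm_sum_le _ _).trans (le_of_eq (Finset.sum_congr rfl fun y _ => by
        rw [norm_mul, he, one_mul, norm_mul, Complex.norm_real, Real.norm_eq_abs]))
    have h3 : (∑ y ∈ G.neighborFinset x, |b y| * ‖u y‖) ^ 2 ≤
        (G.degree x : ℝ) * ∑ y ∈ G.neighborFinset x, b y ^ 2 * ‖u y‖ ^ 2 := by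
      have := sq_sum_le_card_mul_sum_sq (s := G.neighborFinset x) (f := fun y => |b y| * ‖u y‖)
      simpa only [SimpleGraph.card_neighborFinset_eq_degree, mul_pow, sq_abs] using this
    rw [norm_mul, mul_pow, Complex.norm_real, Real.norm_eq_abs, sq_abs]
    have h4 : 0 ≤ ∑ y ∈ G.neighborFinset x, b y ^ 2 * ‖u y‖ ^ 2 :=
      Finset.sum_nonneg fun y _ => by positivity
    calc b x ^ 2 * ‖∑ y ∈ G.neighborFinset x, e x y * (b y * u y)‖ ^ 2
        ≤ b x ^ 2 * ((G.degree x : ℝ) * ∑ y ∈ G.neighborFinset x, b y ^ 2 * ‖u y‖ ^ 2) :=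
          mul_le_mul_of_nonneg_left ((pow_le_pow_left₀ (norm_nonneg _) h2 2).trans h3)
            (sq_nonneg _)
      _ = ((G.degree x : ℝ) * b x ^ 2) * ∑ y ∈ G.neighborFinset x, b y ^ 2 * ‖u y‖ ^ 2 := by ring
      _ ≤ 1 * ∑ y ∈ G.neighborFinset x, b y ^ 2 * ‖u y‖ ^ 2 :=
          mul_le_mul_of_nonneg_right (hb x) h4
      _ = _ := one_mul _
  refine (Finset.sum_le_sum fun x _ => h1 x).trans ?_
  have h5 : ∀ x ∈ s, ∑ y ∈ G.neighborFinset x, b y ^ 2 * ‖u y‖ ^ 2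
      = ∑ y ∈ t, if G.Adj x y then b y ^ 2 * ‖u y‖ ^ 2 else 0 := by
    intro x hx
    rw [← Finset.sum_filter]
    refine Finset.sum_congr ?_ fun _ _ => rfl
    ext y
    rw [SimpleGraph.mem_neighborFinset, Finset.mem_filter]
    exact ⟨fun h => ⟨Finset.mem_biUnion.2 ⟨x, hx, (SimpleGraph.mem_neighborFinset _ _ _).2 h⟩, h⟩,
      fun h => h.2⟩
  rw [Finset.sum_congr rfl h5, Finset.sum_comm]
  refine Finset.sum_le_sum fun y _ => ?_
  rw [← Finset.sum_filter, Finset.sum_const, nsmul_eq_mul, ← mul_assoc]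
  have h6 : ((s.filter fun x => G.Adj x y).card : ℝ) ≤ G.degree y := by
    rw [← SimpleGraph.card_neighborFinset_eq_degree]
    exact_mod_cast Finset.card_le_card fun x hx =>
      (SimpleGraph.mem_neighborFinset _ _ _).2 (G.adj_symm (Finset.mem_filter.1 hx).2)
  have h7 : ((s.filter fun x => G.Adj x y).card : ℝ) * b y ^ 2 ≤ 1 :=
    (mul_le_mul_of_nonneg_right h6 (sq_nonneg _)).trans (hb y)
  exact (mul_le_mul_of_nonneg_right h7 (sq_nonneg _)).trans (le_of_eq (one_mul _))

theorem exists_scaledForms (he : ∀ x y, ‖e x y‖ = 1) {K : ℝ}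
    (hK : ∀ x, negpart q x ≤ K * (1 + ((G.degree x : ℝ) + pospart q x))) :
    ∃ b J X A Z, ScaledForms G e q b J X A Z := by
  set w : V → ℝ := fun x => 1 + ((G.degree x : ℝ) + pospart q x) with hw
  have hd : ∀ x, (0 : ℝ) ≤ G.degree x := fun x => Nat.cast_nonneg _
  have hq := pospart_nonneg q
  have hw1 : ∀ x, 1 ≤ w x := fun x => by simp only [hw]; linarith [hd x, hq x]
  have hw0 : ∀ x, 0 < w x := fun x => one_pos.trans_le (hw1 x)
  set b : V → ℝ := fun x => (√(w x))⁻¹ with hb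
  have hb0 : ∀ x, 0 < b x := fun x => inv_pos.2 (Real.sqrt_pos.2 (hw0 x))
  have hb2 : ∀ x, w x * b x ^ 2 = 1 := fun x => by
    simp only [hb]
    rw [inv_pow, Real.sq_sqrt (hw0 x).le, mul_inv_cancel₀ (hw0 x).ne']
  have hb1 : ∀ x, |b x| ≤ 1 := fun x => by
    rw [abs_of_pos (hb0 x)]
    exact inv_le_one_of_one_le₀ (Real.one_le_sqrt.2 (hw1 x))
  obtain ⟨J, hJ⟩ := exists_diagonal (g := b) zero_le_one hb1
  obtain ⟨X, hX⟩ := exists_diagonal (g := fun x => ((G.degree x : ℝ) + pospart q x) * b x ^ 2)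
    zero_le_one fun x => by
      rw [abs_of_nonneg (mul_nonneg (add_nonneg (hd x) (hq x)) (sq_nonneg _)), ← hb2 x]
      exact mul_le_mul_of_nonneg_right (by simp only [hw]; linarith) (sq_nonneg _)
  obtain ⟨Z, hZ⟩ := exists_diagonal (g := fun x => negpart q x * b x ^ 2) (abs_nonneg K)
    fun x => by
      rw [abs_of_nonneg (mul_nonneg (negpart_nonneg q x) (sq_nonneg _))]
      refine (mul_le_mul_of_nonneg_right (hK x) (sq_nonneg _)).trans ?_
      rw [mul_assoc]
      exact (le_of_eq (by rw [hb2, mul_one])).trans (le_abs_self K)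
  let A₀ : (V → ℂ) →ₗ[ℂ] (V → ℂ) :=
    { toFun := fun u x => b x * ∑ y ∈ G.neighborFinset x, e x y * (b y * u y)
      map_add' := fun u v => by
        funext x
        simp only [Pi.add_apply, mul_add, Finset.sum_add_distrib]
      map_smul' := fun c u => by
        funext x
        simp only [Pi.smul_apply, smul_eq_mul, RingHom.id_apply, Finset.mul_sum]
        exact Finset.sum_congr rfl fun y _ => by ring }
  obtain ⟨A, hA⟩ := exists_clm_of_sum_le A₀ zero_le_one fun u s => by
    obtain ⟨t, ht⟩ := sum_hop_norm_sq_le (G := G) he (b := b) (fun x => by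
      rw [← hb2 x]
      exact mul_le_mul_of_nonneg_right (by simp only [hw]; linarith [hq x]) (sq_nonneg _)) u s
    exact ⟨t, by rw [one_pow, one_mul]; exact ht⟩
  refine ⟨b, J, X, A, Z, hb0, hb2, hJ, hX, fun u x => ?_, hZ⟩
  rw [hA]
  change (b x : ℂ) * ∑ y ∈ G.neighborFinset x, e x y * (b y * u y) = _
  congr 1
  exact Finset.sum_congr rfl fun y _ => by rw [hJ]

namespace ScaledForms

variable (hF : ScaledForms G e q b J X A Z)
include hF

theorem isSelfAdjoint_scale : IsSelfAdjoint J := isSelfAdjoint_of_diagonal hF.scale_apply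

theorem isSelfAdjoint_weight : IsSelfAdjoint X := isSelfAdjoint_of_diagonal hF.weight_apply

theorem isSelfAdjoint_neg : IsSelfAdjoint Z := isSelfAdjoint_of_diagonal hF.neg_apply

theorem isSelfAdjoint_hop (he' : ∀ x y, e y x = starRingEnd ℂ (e x y)) : IsSelfAdjoint A := by
  classical
  refine isSelfAdjoint_of_single fun x y => ?_
  have h : ∀ x y, A (lp.single 2 y 1) x = if G.Adj x y then b x * e x y * b y else 0 := by
    intro x y
    rw [hF.hop_apply]
    have : ∀ z, e x z * J (lp.single 2 y 1) z = if z = y then e x z * b z else 0 := by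
      intro z
      rw [hF.scale_apply]
      split_ifs with hz
      · rw [hz, lp.single_apply_self, mul_one]
      · rw [lp.single_apply_ne _ _ _ hz, mul_zero, mul_zero]
    rw [Finset.sum_congr rfl fun z _ => this z, Finset.sum_ite_eq']
    simp only [SimpleGraph.mem_neighborFinset, mul_ite, mul_zero, mul_assoc]
  rw [h, h, G.adj_comm y x]
  split_ifs
  · rw [he' y x]
    simp only [map_mul, Complex.conj_ofReal]
    ring
  · rw [map_zero]

theorem injective : Function.Injective J := by
  intro u v h
  apply lp.ext
  funext x
  have := congrArg (fun f : L2 V => f x) h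
  simp only [hF.scale_apply] at this
  exact mul_left_cancel₀ (Complex.ofReal_ne_zero.2 (hF.pos x).ne') this

theorem scale_eq_zero {u : L2 V} {x : V} (h : u x = 0) : J u x = 0 := by
  rw [hF.scale_apply, h, mul_zero]

theorem norm_scale_sq (u : L2 V) (x : V) : ‖J u x‖ ^ 2 = b x ^ 2 * ‖u x‖ ^ 2 := by
  rw [hF.scale_apply, norm_mul, mul_pow, Complex.norm_real, Real.norm_eq_abs, sq_abs]

/-- Finitely supported functions lie in ran J, with preimages of the same support, so statements on
C_c(V) can be pulled back along J. -/
theorem exists_scale_eq {φ : L2 V} {W : Finset V} (hφ : ∀ x ∉ W, φ x = 0) :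
    ∃ u : L2 V, J u = φ ∧ ∀ x ∉ W, u x = 0 := by
  obtain ⟨u, hu⟩ := exists_lp_of_finset (fun x => (b x : ℂ)⁻¹ * φ x) W fun x hx => by
    rw [hφ x hx, mul_zero]
  refine ⟨u, lp.ext (funext fun x => ?_), fun x hx => by rw [hu, hφ x hx, mul_zero]⟩
  rw [hF.scale_apply, hu, mul_inv_cancel_left₀ (Complex.ofReal_ne_zero.2 (hF.pos x).ne')]

variable {u : L2 V} {W : Finset V} (hu : ∀ x ∉ W, u x = 0)
include hu

theorem norm_scale_eq : ‖J u‖ ^ 2 = ∑ x ∈ W, ‖J u x‖ ^ 2 :=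
  norm_sq_eq_sum fun x hx => hF.scale_eq_zero (hu x hx)

theorem re_inner_weight : (inner ℂ u (X u)).re =
    ∑ x ∈ W, ((G.degree x : ℝ) + pospart q x) * ‖J u x‖ ^ 2 := by
  rw [re_inner_diagonal hF.weight_apply hu]
  exact Finset.sum_congr rfl fun x _ => by rw [hF.norm_scale_sq]; ring

theorem re_inner_neg : (inner ℂ u (Z u)).re = ∑ x ∈ W, negpart q x * ‖J u x‖ ^ 2 := by
  rw [re_inner_diagonal hF.neg_apply hu]
  exact Finset.sum_congr rfl fun x _ => by rw [hF.norm_scale_sq]; ring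

theorem re_inner_hop : (inner ℂ u (A u)).re = hopForm G e W (J u) := by
  rw [inner_eq_sum hu, Complex.re_sum, hopForm]
  refine Finset.sum_congr rfl fun x _ => ?_
  rw [hF.hop_apply, ← Complex.re_sum, ← Finset.mul_sum, hF.scale_apply, map_mul,
    Complex.conj_ofReal]
  congr 1
  ring

end ScaledForms

end ScaledForms

/-! ### Relative bounds for the hopping form and for q₋. -/

section FormEstimates

variable {V : Type*} {G : SimpleGraph V} [G.LocallyFinite]
variable {e : V → V → ℂ} {q : V → ℝ} {b : V → ℝ} {J X A Z : L2 V →L[ℂ] L2 V}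

theorem IsFormPair.mono {H : Type*} [NormedAddCommGroup H] [InnerProductSpace ℂ H]
    [CompleteSpace H] {J M M' : H →L[ℂ] H} {C C' : ℝ} (h : IsFormPair J M C)
    (hM : IsSelfAdjoint M') (hle : ∀ u, (inner ℂ u (M u)).re ≤ (inner ℂ u (M' u)).re)
    (hC : C ≤ C') : IsFormPair J M' C' := by
  obtain ⟨h1, h2, -, c, hc, h4⟩ := h
  exact ⟨h1, h2, hM, c, hc, fun u => (h4 u).trans
    (add_le_add (hle u) (mul_le_mul_of_nonneg_right hC (sq_nonneg _)))⟩

namespace ScaledForms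

variable (hF : ScaledForms G e q b J X A Z)
include hF

/-- X + J² = 1: the form norm of `deg + q₊` is the ℓ² norm of u. -/
theorem re_inner_weight_add (u : L2 V) : (inner ℂ u (X u)).re + ‖J u‖ ^ 2 = ‖u‖ ^ 2 := by
  have h : X u + J (J u) = u := by
    apply lp.ext
    funext x
    rw [lp.coeFn_add, Pi.add_apply, hF.weight_apply, hF.scale_apply, hF.scale_apply]
    have := congrArg (fun r : ℝ => (r : ℂ) * u x) (hF.mul_sq x)
    simp only [Complex.ofReal_one, one_mul] at this
    rw [← mul_assoc, ← add_mul]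
    conv_rhs => rw [← this]
    congr 1
    push_cast
    ring
  rw [← inner_self_re (J u), inner_map_eq hF.isSelfAdjoint_scale, ← Complex.add_re,
    ← inner_add_right, h, inner_self_re]

theorem re_inner_neg_nonneg (u : L2 V) : 0 ≤ (inner ℂ u (Z u)).re :=
  re_inner_diagonal_nonneg hF.neg_apply
    (fun x => mul_nonneg (negpart_nonneg q x) (sq_nonneg _)) u

theorem abs_re_inner_hop_le {p s : ℝ}
    (h : ∀ (u : L2 V) (W : Finset V), (∀ x ∉ W, u x = 0) →
      |hopForm G e W (J u)| ≤ p * ∑ x ∈ W, ((G.degree x : ℝ) + pospart q x) * ‖J u x‖ ^ 2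
        + s * ∑ x ∈ W, ‖J u x‖ ^ 2) (u : L2 V) :
    |(inner ℂ u (A u)).re| ≤ p * (inner ℂ u (X u)).re + s * ‖J u‖ ^ 2 := by
  have h1 := re_inner_le_of_Cc (P := A - (p : ℂ) • X) (J := J) (C := s) (fun u hu => by
    obtain ⟨W, hW⟩ := exists_finset_of_mem_Cc hu
    have := (abs_le.1 (h u W hW)).2
    rw [sub_apply, smul_apply, inner_sub_right,
      inner_smul_right, Complex.sub_re, Complex.re_ofReal_mul, hF.re_inner_weight hW,
      hF.re_inner_hop hW, hF.norm_scale_eq hW]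
    linarith) u
  have h2 := re_inner_le_of_Cc (P := -A - (p : ℂ) • X) (J := J) (C := s) (fun u hu => by
    obtain ⟨W, hW⟩ := exists_finset_of_mem_Cc hu
    have := (abs_le.1 (h u W hW)).1
    rw [sub_apply, smul_apply, inner_sub_right,
      _root_.neg_apply, inner_neg_right,
      inner_smul_right, Complex.sub_re, Complex.re_ofReal_mul, Complex.neg_re,
      hF.re_inner_weight hW, hF.re_inner_hop hW, hF.norm_scale_eq hW]
    linarith) u
  rw [sub_apply, smul_apply, inner_sub_right,
    inner_smul_right, Complex.sub_re, Complex.re_ofReal_mul] at h1 h2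
  rw [_root_.neg_apply, inner_neg_right, Complex.neg_re] at h2
  rw [abs_le]
  constructor <;> linarith

theorem abs_re_inner_hop_le_weight (he : ∀ x y, ‖e x y‖ = 1) (u : L2 V) :
    |(inner ℂ u (A u)).re| ≤ (inner ℂ u (X u)).re := by
  have := hF.abs_re_inner_hop_le (p := 1) (s := 0) (fun u W hW => by
    rw [zero_mul, add_zero, one_mul]
    refine (abs_hopForm_le G he W (J u) fun x hx => hF.scale_eq_zero (hW x hx)).trans ?_
    refine Finset.sum_le_sum fun x _ => mul_le_mul_of_nonneg_right ?_ (sq_nonneg _)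
    linarith [pospart_nonneg q x]) u
  linarith

theorem exists_abs_hop_le_weight (he : ∀ x y, ‖e x y‖ = 1)
    (he' : ∀ x y, e y x = starRingEnd ℂ (e x y)) {a k : ℝ} (hsp : IsSparse G q a k) (ha : 0 ≤ a)
    (hk : 0 ≤ k) {L p : ℝ} (hL : 1 < L) (hp : L + L⁻¹ - 2 / (1 + a) ≤ p * (L - L⁻¹)) :
    ∃ s, 0 ≤ s ∧
      ∀ u, |(inner ℂ u (A u)).re| ≤ p * (inner ℂ u (X u)).re + s * ‖J u‖ ^ 2 := by
  have hL0 : 0 < L := by linarith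
  have hd : 0 < L - L⁻¹ := by linarith [inv_lt_one_of_one_lt₀ hL]
  refine ⟨2 / (1 + a) * k / (L - L⁻¹), by positivity, hF.abs_re_inner_hop_le fun u W hW => ?_⟩
  have hJ : ∀ x ∉ W, J u x = 0 := fun x hx => hF.scale_eq_zero (hW x hx)
  -- The parameter L bounds the hopping form from above; L⁻¹ reverses the sign of L - L⁻¹ and bounds
  -- it from below.
  have h1 := hsp.hopForm_estimate G he he' ha W (J u) hJ hL0
  have h2 := hsp.hopForm_estimate G he he' ha W (J u) hJ (inv_pos.2 hL0)
  rw [inv_inv] at h2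
  have hX : 0 ≤ ∑ x ∈ W, ((G.degree x : ℝ) + pospart q x) * ‖J u x‖ ^ 2 :=
    Finset.sum_nonneg fun x _ =>
      mul_nonneg (add_nonneg (Nat.cast_nonneg _) (pospart_nonneg q x)) (sq_nonneg _)
  set x := ∑ x ∈ W, ((G.degree x : ℝ) + pospart q x) * ‖J u x‖ ^ 2
  set n := ∑ x ∈ W, ‖J u x‖ ^ 2
  set y := hopForm G e W (J u)
  set r := 2 / (1 + a) * k
  have h3 := mul_le_mul_of_nonneg_right hp hX
  have h4 : (L - L⁻¹) * (r / (L - L⁻¹) * n) = r * n := by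
    rw [← mul_assoc, mul_div_assoc', mul_div_cancel_left₀ _ hd.ne']
  rw [abs_le]
  constructor
  · refine le_of_mul_le_mul_left ?_ hd
    linarith
  · refine le_of_mul_le_mul_left ?_ hd
    linarith

end ScaledForms

variable {θ : V → V → Real.Angle}

theorem MemK.sum_le {α : ℝ} (h : MemK G θ α q) : ∃ C, 0 ≤ C ∧ ∀ (φ : L2 V) (W : Finset V),
    (∀ x ∉ W, φ x = 0) → ∑ x ∈ W, negpart q x * ‖φ x‖ ^ 2 ≤
      α * (∑ x ∈ W, ((G.degree x : ℝ) + pospart q x) * ‖φ x‖ ^ 2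
        - hopForm G (fun x y => ((θ x y).toCircle : ℂ)) W φ) + C * ∑ x ∈ W, ‖φ x‖ ^ 2 := by
  obtain ⟨C, hC, h⟩ := h
  refine ⟨C, hC, fun φ W hW => ?_⟩
  obtain ⟨h₁, h₂, h⟩ := h φ (mem_Cc_of_finset hW)
  have hmul : ∀ (r : ℝ) (z : ℂ), (starRingEnd ℂ z * (r * z)).re = r * ‖z‖ ^ 2 := fun r z => by
    rw [mul_left_comm, ← Complex.normSq_eq_conj_mul_self, ← Complex.ofReal_mul,
      Complex.ofReal_re, Complex.normSq_eq_norm_sq]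
  have e1 : (inner ℂ φ (mulOp (negpart q) ⟨φ, h₁⟩)).re
      = ∑ x ∈ W, negpart q x * ‖φ x‖ ^ 2 := by
    rw [inner_eq_sum hW, Complex.re_sum]
    exact Finset.sum_congr rfl fun x _ => hmul _ _
  have e2 : (inner ℂ φ (magneticMaxOp G θ (pospart q) ⟨φ, h₂.1⟩)).re
      = ∑ x ∈ W, ((G.degree x : ℝ) + pospart q x) * ‖φ x‖ ^ 2
        - hopForm G (fun x y => ((θ x y).toCircle : ℂ)) W φ := by
    rw [inner_eq_sum hW, Complex.re_sum, hopForm, ← Finset.sum_sub_distrib]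
    refine Finset.sum_congr rfl fun x _ => ?_
    have : magneticMaxOp G θ (pospart q) ⟨φ, h₂.1⟩ x
        = (((G.degree x : ℝ) + pospart q x : ℝ) : ℂ) * φ x
          - ∑ y ∈ G.neighborFinset x, ((θ x y).toCircle : ℂ) * φ y := by
      change ∑ y ∈ G.neighborFinset x, (φ x - ((θ x y).toCircle : ℂ) * φ y)
        + (pospart q x : ℂ) * φ x = _
      rw [Finset.sum_sub_distrib, Finset.sum_const, SimpleGraph.card_neighborFinset_eq_degree,
        nsmul_eq_mul]
      push_cast
      ring
    rw [this, mul_sub, Complex.sub_re, hmul, Finset.mul_sum, Complex.re_sum]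
  have e3 : (inner ℂ φ (mulOp (fun _ => C) ⟨φ, h₂.2⟩)).re = C * ∑ x ∈ W, ‖φ x‖ ^ 2 := by
    rw [inner_eq_sum hW, Complex.re_sum, Finset.mul_sum]
    exact Finset.sum_congr rfl fun x _ => hmul _ _
  rw [LinearPMap.add_apply, LinearPMap.smul_apply, inner_add_right, inner_smul_right,
    Complex.add_re, Complex.re_ofReal_mul, e1, e2, e3] at h
  exact h

/-- Test with the delta function at x: without loops its hopping form vanishes. -/
theorem MemK.negpart_le {α : ℝ} (h : MemK G θ α q) :
    ∃ C, 0 ≤ C ∧ ∀ x, negpart q x ≤ α * ((G.degree x : ℝ) + pospart q x) + C := by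
  classical
  obtain ⟨C, hC, h⟩ := h.sum_le
  refine ⟨C, hC, fun x => ?_⟩
  have := h (lp.single 2 x 1) {x} fun y hy => lp.single_apply_ne _ _ _ (by simpa using hy)
  have h0 : hopForm G (fun x y => ((θ x y).toCircle : ℂ)) {x} (lp.single 2 x 1 : L2 V) = 0 := by
    rw [hopForm, Finset.sum_singleton]
    refine Finset.sum_eq_zero fun y hy => ?_
    have hxy : y ≠ x := ((SimpleGraph.mem_neighborFinset _ _ _).1 hy).ne'
    rw [lp.single_apply_ne _ _ _ hxy, mul_zero, mul_zero, Complex.zero_re]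
  rw [h0, Finset.sum_singleton, Finset.sum_singleton, Finset.sum_singleton,
    lp.single_apply_self, norm_one, one_pow, mul_one, mul_one, mul_one, sub_zero] at this
  exact this

theorem toCircle_conj (hθ : ∀ x y, θ x y = -θ y x) (x y : V) :
    ((θ y x).toCircle : ℂ) = starRingEnd ℂ ((θ x y).toCircle : ℂ) := by
  rw [hθ y x, Real.Angle.toCircle_neg, Circle.coe_inv_eq_conj]

namespace ScaledForms

variable (hF : ScaledForms G (fun x y => ((θ x y).toCircle : ℂ)) q b J X A Z)
include hF

/-- The hypothesis reads Z ≤ α(X - A) + CJ², and -A ≤ X costs the factor 2. -/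
theorem exists_neg_le {α : ℝ} (hα : 0 ≤ α) (h : MemK G θ α q) :
    ∃ C, 0 ≤ C ∧ (∀ x, negpart q x ≤ 2 * α * ((G.degree x : ℝ) + pospart q x) + C) ∧
      ∀ u, (inner ℂ u (Z u)).re ≤ 2 * α * (inner ℂ u (X u)).re + C * ‖J u‖ ^ 2 := by
  obtain ⟨C, hC, h1⟩ := h.sum_le
  obtain ⟨C', hC', h1'⟩ := h.negpart_le
  have hw : ∀ x, 0 ≤ (G.degree x : ℝ) + pospart q x := fun x =>
    add_nonneg (Nat.cast_nonneg _) (pospart_nonneg q x)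
  refine ⟨C + C', by positivity, fun x => (h1' x).trans ?_, fun u => ?_⟩
  · nlinarith [mul_nonneg hα (hw x)]
  have h2 := re_inner_le_of_Cc (P := Z - (α : ℂ) • (X - A)) (J := J) (C := C) (fun u hu => by
    obtain ⟨W, hW⟩ := exists_finset_of_mem_Cc hu
    have := h1 (J u) W fun x hx => hF.scale_eq_zero (hW x hx)
    rw [sub_apply, smul_apply,
      sub_apply, inner_sub_right, inner_smul_right, inner_sub_right,
      Complex.sub_re, Complex.re_ofReal_mul, Complex.sub_re, hF.re_inner_weight hW,
      hF.re_inner_hop hW, hF.re_inner_neg hW, hF.norm_scale_eq hW]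
    linarith) u
  rw [sub_apply, smul_apply,
    sub_apply, inner_sub_right, inner_smul_right, inner_sub_right,
    Complex.sub_re, Complex.re_ofReal_mul, Complex.sub_re] at h2
  have h3 := (abs_le.1 (hF.abs_re_inner_hop_le_weight (fun x y => Circle.norm_coe _) u)).1
  nlinarith [mul_nonneg hC' (sq_nonneg ‖J u‖)]

variable (hθ : ∀ x y, θ x y = -θ y x)
include hθ

/-- The magnetic adjacency operator is a small form perturbation of `deg + q`. -/
theorem exists_abs_hop_le (hq : MemKZeroPlus G θ q) {a k : ℝ} (hsp : IsSparse G q a k)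
    (ha : 0 ≤ a) (hk : 0 ≤ k) {L p a' : ℝ} (hL : 1 < L)
    (hp : L + L⁻¹ - 2 / (1 + a) ≤ p * (L - L⁻¹)) (hp0 : 0 < p) (hpa : p < a') :
    ∃ k', 0 ≤ k' ∧ ∀ u, |(inner ℂ u (A u)).re| ≤
      a' * (inner ℂ u ((X - Z) u)).re + k' * ‖J u‖ ^ 2 := by
  have ha' : 0 < a' := hp0.trans hpa
  obtain ⟨s, hs, h1⟩ := hF.exists_abs_hop_le_weight (fun x y => Circle.norm_coe _)
    (toCircle_conj hθ) hsp ha hk hL hp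
  -- With this α, a'Z ≤ (a' - p)X + a'CJ², so pX ≤ a'(X - Z) + a'CJ².
  set α := (a' - p) / (2 * a') with hα
  have hα0 : 0 < α := div_pos (sub_pos.2 hpa) (by linarith)
  have hα1 : α < 1 := by rw [hα, div_lt_one (by linarith)]; linarith
  obtain ⟨C, hC, -, h2⟩ := hF.exists_neg_le hα0.le (hq α ⟨hα0, hα1⟩)
  refine ⟨a' * C + s, by positivity, fun u => (h1 u).trans ?_⟩
  rw [sub_apply, inner_sub_right, Complex.sub_re]
  have h3 := mul_le_mul_of_nonneg_left (h2 u) ha'.le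
  have h4 : a' * (2 * α) = a' - p := by rw [hα]; field_simp
  have h5 : a' * (2 * α * (inner ℂ u (X u)).re + C * ‖J u‖ ^ 2)
      = (a' - p) * (inner ℂ u (X u)).re + a' * C * ‖J u‖ ^ 2 := by rw [← h4]; ring
  linarith

theorem exists_abs_hop_le_of_isSparse (hq : MemKZeroPlus G θ q) {a k : ℝ}
    (hsp : IsSparse G q a k) (ha : 0 ≤ a) (hk : 0 ≤ k) :
    ∃ a' k', 0 < a' ∧ a' < 1 ∧ 0 ≤ k' ∧ ∀ u, |(inner ℂ u (A u)).re| ≤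
      a' * (inner ℂ u ((X - Z) u)).re + k' * ‖J u‖ ^ 2 := by
  -- This makes 2/(1 + a) = 4L⁻¹, so the coefficient is (L - 3L⁻¹)/(L - L⁻¹) < 1.
  set L := 2 * (1 + a) with hL
  have hL1 : 1 < L := by linarith
  have hinv : L⁻¹ < 1 := inv_lt_one_of_one_lt₀ hL1
  have hd : 0 < L - L⁻¹ := by linarith
  have h2 : 2 / (1 + a) = 4 * L⁻¹ := by rw [hL]; field_simp; norm_num
  set p₀ := (L - 3 * L⁻¹) / (L - L⁻¹) with hp₀
  have hp1 : p₀ < 1 := by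
    rw [hp₀, div_lt_one hd]
    linarith [inv_pos.2 (show 0 < L by linarith)]
  set p := max p₀ (1 / 2) with hp
  have hplt : p < 1 := max_lt hp1 (by norm_num)
  have hppos : 0 < p := lt_of_lt_of_le (by norm_num) (le_max_right _ _)
  obtain ⟨k', hk', h⟩ := hF.exists_abs_hop_le hθ hq hsp ha hk (p := p) (a' := (p + 1) / 2) hL1
    (by
      rw [h2, ← div_le_iff₀ hd]
      refine le_trans (le_of_eq ?_) (le_max_left _ _)
      rw [hp₀]; congr 1; ring) hppos (by linarith)
  exact ⟨(p + 1) / 2, k', by linarith, by linarith, hk', h⟩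

theorem exists_abs_hop_le_of_isAlmostSparse (hq : MemKZeroPlus G θ q)
    (hsp : IsAlmostSparse G q) {a' : ℝ} (ha' : 0 < a') :
    ∃ k', 0 ≤ k' ∧ ∀ u, |(inner ℂ u (A u)).re| ≤
      a' * (inner ℂ u ((X - Z) u)).re + k' * ‖J u‖ ^ 2 := by
  set δ := a' / 2 with hδ
  have hδ0 : 0 < δ := by positivity
  set L := 1 + δ with hL
  have hL1 : 1 < L := by linarith
  have hL0 : 0 < L := by linarith
  have hinv : L⁻¹ < 1 := inv_lt_one_of_one_lt₀ hL1
  -- For L = 1 + δ and this ε, L + L⁻¹ - 2/(1 + ε) ≤ 2δ²L⁻¹ ≤ δ(L - L⁻¹), so p = δ is admissible.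
  obtain ⟨k, hk, hs⟩ := hsp (δ ^ 2 / (2 * L)) (by positivity)
  refine hF.exists_abs_hop_le hθ hq hs (by positivity) hk (p := δ) (a' := a') hL1 ?_ hδ0
    (by linarith)
  set ε := δ ^ 2 / (2 * L) with hε
  have hε0 : 0 < ε := by positivity
  have h1 : 2 - 2 * ε ≤ 2 / (1 + ε) := by
    rw [le_div_iff₀ (by positivity)]
    nlinarith [sq_nonneg ε]
  refine (sub_le_sub_left h1 _).trans ?_
  have h2 : L + L⁻¹ - (2 - 2 * ε) = 2 * δ ^ 2 * L⁻¹ := by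
    rw [hε, hL]; field_simp; ring
  have h3 : δ * (L - L⁻¹) = δ ^ 2 * (2 + δ) * L⁻¹ := by
    rw [hL]; field_simp; ring
  rw [h2, h3]
  have : 0 < L⁻¹ := inv_pos.2 hL0
  refine mul_le_mul_of_nonneg_right ?_ this.le
  nlinarith [sq_nonneg δ]

end ScaledForms

end FormEstimates

/-! ### Form sums. -/

section FormSums

variable {H : Type*} [NormedAddCommGroup H] [InnerProductSpace ℂ H] [CompleteSpace H]

theorem HasFormRep.graph_nonneg {T : H →ₗ.[ℂ] H} {J M : H →L[ℂ] H} (hJ : IsSelfAdjoint J)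
    (h : HasFormRep T J M) (hM : ∀ u, 0 ≤ (inner ℂ u (M u)).re) (x y : H)
    (hxy : (x, y) ∈ T.graph) : 0 ≤ (inner ℂ x y).re := by
  obtain ⟨u, rfl, hu⟩ := (h x y).1 hxy
  rw [inner_map_eq hJ, ← hu]
  exact hM u

/-- Density of D determines w from u in `formGraph`, so the relation is the graph of an operator. -/
theorem formOp_graph {D : Submodule ℂ H} (hD : Dense (D : Set H))
    (Q : D →ₗ⋆[ℂ] D →ₗ[ℂ] ℂ) : (formOp D Q).graph = formGraph D Q := by
  apply Submodule.toLinearPMap_graph_eq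
  rintro ⟨x, y⟩ ⟨hx, h⟩ (rfl : x = 0)
  have h0 : (⟨((0 : H), y).1, hx⟩ : D) = 0 := rfl
  refine hD.eq_zero_of_inner_right ℂ fun v hv => ?_
  rw [← h ⟨v, hv⟩, h0, map_zero]

/-- The form sum of two nonnegative operators when the form domain `ran J` of the first is
contained in that of the second. -/
theorem hasFormRep_formSumSub {A B : H →ₗ.[ℂ] H} {J M J' M' D Z : H →L[ℂ] H} {C C' : ℝ}
    (hp : IsFormPair J M C) (hA : HasFormRep A J M) (hM : ∀ u, 0 ≤ (inner ℂ u (M u)).re)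
    (hp' : IsFormPair J' M' C') (hB : HasFormRep B J' M')
    (hM' : ∀ u, 0 ≤ (inner ℂ u (M' u)).re) (hD : ∀ u, J' (D u) = J u)
    (hZ : ∀ u v, inner ℂ (D u) (M' (D v)) = inner ℂ u (Z v)) :
    HasFormRep (formSumSub A B) J (M - Z) := by
  have hJ := hp.selfAdjoint_left
  have hS := posSqrt_spec (hp.isSelfAdjoint hA) (hA.graph_nonneg hJ hM)
  have hR := posSqrt_spec (hp'.isSelfAdjoint hB) (hB.graph_nonneg hp'.selfAdjoint_left hM')
  obtain ⟨hSd, hSi⟩ := domain_and_inner_of_sqOp_eq hp hA hS.1 hS.2.2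
  obtain ⟨hRd, hRi⟩ := domain_and_inner_of_sqOp_eq hp' hB hR.1 hR.2.2
  set S := posSqrt A
  set R := posSqrt B
  -- By Ju = J'(Du) the form domain of A lies in that of B, and the intersection is ran J.
  have hdom : ∀ x, x ∈ S.domain ⊓ R.domain ↔ ∃ u, J u = x := by
    intro x
    rw [Submodule.mem_inf, hSd, hRd]
    exact ⟨fun h => h.1, fun ⟨u, hu⟩ => ⟨⟨u, hu⟩, ⟨D u, (hD u).trans hu⟩⟩⟩
  have hdense : Dense ((S.domain ⊓ R.domain : Submodule ℂ H) : Set H) := by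
    refine (denseRange_of_injective hJ hp.injective).mono ?_
    rintro _ ⟨u, rfl⟩
    exact (hdom _).2 ⟨u, rfl⟩
  have hQ : ∀ (u v : H) (hu : J u ∈ S.domain ⊓ R.domain) (hv : J v ∈ S.domain ⊓ R.domain),
      diffForm S R ⟨J v, hv⟩ ⟨J u, hu⟩ = inner ℂ v ((M - Z) u) := by
    intro u v hu hv
    have hgr : ∀ (T : H →ₗ.[ℂ] H) (w : H) (hw : w ∈ T.domain), (w, T ⟨w, hw⟩) ∈ T.graph :=
      fun T w hw => (LinearPMap.mem_graph_iff _).2 ⟨⟨w, hw⟩, rfl, rfl⟩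
    have h1 : inner ℂ (S ⟨J v, hv.1⟩) (S ⟨J u, hu.1⟩) = inner ℂ v (M u) :=
      hSi v u _ _ (hgr S _ hv.1) (hgr S _ hu.1)
    have h2 : inner ℂ (R ⟨J v, hv.2⟩) (R ⟨J u, hu.2⟩) = inner ℂ v (Z u) := by
      rw [← hZ]
      refine hRi (D v) (D u) _ _ ?_ ?_
      · rw [hD]; exact hgr R _ hv.2
      · rw [hD]; exact hgr R _ hu.2
    rw [sub_apply, inner_sub_right, ← h1, ← h2]
    rfl
  intro x y
  rw [formSumSub, formOp_graph hdense]
  constructor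
  · rintro ⟨hx, h⟩
    obtain ⟨u, rfl⟩ := (hdom x).1 hx
    refine ⟨u, rfl, ext_inner_left ℂ fun v => ?_⟩
    have hv := (hdom (J v)).2 ⟨v, rfl⟩
    rw [← hQ u v hx hv, ← inner_map_eq hJ]
    exact h ⟨J v, hv⟩
  · rintro ⟨u, rfl, hu⟩
    refine ⟨(hdom _).2 ⟨u, rfl⟩, ?_⟩
    rintro ⟨w, hw⟩
    obtain ⟨v, rfl⟩ := (hdom w).1 hw
    rw [hQ u v _ hw, hu, ← inner_map_eq hJ]

end FormSums

/-! ### Identification of the concrete operators with their forms. -/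

section MagneticForms

variable {V : Type*} {G : SimpleGraph V} [G.LocallyFinite]
variable {q : V → ℝ} {b : V → ℝ} {J X A Z : L2 V →L[ℂ] L2 V} {θ : V → V → Real.Angle}

/-- Square summability makes {‖ψ x‖ ≥ ‖ψ x₀‖} finite, so the maximum is attained. -/
theorem exists_max_norm (ψ : L2 V) {x₀ : V} (h₀ : ψ x₀ ≠ 0) :
    ∃ x, ψ x ≠ 0 ∧ ∀ y, ‖ψ y‖ ≤ ‖ψ x‖ := by
  have hs : Summable fun x => ‖ψ x‖ ^ 2 := by
    have := (lp.memℓp ψ).summable (by norm_num)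
    simpa using this
  have hr : 0 < ‖ψ x₀‖ := norm_pos_iff.2 h₀
  have hfin : {x | ‖ψ x₀‖ ≤ ‖ψ x‖}.Finite := by
    have h1 := hs.tendsto_cofinite_zero.eventually (gt_mem_nhds (pow_pos hr 2))
    refine (Filter.eventually_cofinite.1 h1).subset fun x hx => ?_
    exact not_lt.2 (pow_le_pow_left₀ hr.le hx 2)
  obtain ⟨x, hx, hmax⟩ := Set.exists_max_image _ (fun x => ‖ψ x‖) hfin ⟨x₀, le_refl ‖ψ x₀‖⟩
  refine ⟨x, norm_pos_iff.1 (hr.trans_le hx), fun y => ?_⟩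
  rcases le_total ‖ψ x₀‖ ‖ψ y‖ with h | h
  · exact hmax y h
  · exact h.trans hx

theorem magneticAction_apply (g : V → ℝ) (φ : V → ℂ) (x : V) :
    magneticAction G θ g φ x = (((G.degree x : ℝ) + g x : ℝ) : ℂ) * φ x
      - ∑ y ∈ G.neighborFinset x, ((θ x y).toCircle : ℂ) * φ y := by
  change ∑ y ∈ G.neighborFinset x, (φ x - ((θ x y).toCircle : ℂ) * φ y) + (g x : ℂ) * φ x = _
  rw [Finset.sum_sub_distrib, Finset.sum_const, SimpleGraph.card_neighborFinset_eq_degree,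
    nsmul_eq_mul]
  push_cast
  ring

/-- The maximum principle for the magnetic operator with positive potential. -/
theorem eq_zero_of_magneticAction_add {g : V → ℝ} (hg : ∀ x, 0 ≤ g x) {C : ℝ} (hC : 0 < C)
    (ψ : L2 V) (h : ∀ x, magneticAction G θ g ψ x + C * ψ x = 0) : ψ = 0 := by
  by_contra hne
  have hex : ∃ x, ψ x ≠ 0 := by
    by_contra! h0
    exact hne (lp.ext (funext h0))
  obtain ⟨x₀, h₀⟩ := hex
  obtain ⟨x, hx, hmax⟩ := exists_max_norm ψ h₀
  -- At a maximum of |ψ| the equation yields (deg + g + C)|ψ(x)| ≤ deg |ψ(x)|, impossible for C > 0.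
  have h1 := h x
  rw [magneticAction_apply, sub_add_eq_add_sub, sub_eq_zero, ← add_mul,
    ← Complex.ofReal_add] at h1
  have h2 := congrArg norm h1
  rw [norm_mul, Complex.norm_real, Real.norm_eq_abs] at h2
  have h3 : ‖∑ y ∈ G.neighborFinset x, ((θ x y).toCircle : ℂ) * ψ y‖ ≤ G.degree x * ‖ψ x‖ := by
    refine (norm_sum_le _ _).trans ?_
    rw [← SimpleGraph.card_neighborFinset_eq_degree, ← nsmul_eq_mul]
    refine Finset.sum_le_card_nsmul _ _ _ fun y _ => ?_
    rw [norm_mul, Circle.norm_coe, one_mul]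
    exact hmax y
  have h4 := le_abs_self ((G.degree x : ℝ) + g x + C)
  have h5 := norm_pos_iff.2 hx
  nlinarith [hg x, mul_le_mul_of_nonneg_right h4 h5.le, mul_nonneg (hg x) h5.le, mul_pos hC h5]

/-- The representation of `q₋` by bounded operators. -/
theorem exists_formRep_negpart {K : ℝ}
    (hK : ∀ x, (1 + negpart q x) * b x ^ 2 ≤ K) (hJ : ∀ u x, J u x = b x * u x)
    (hZ : ∀ u x, Z u x = ((negpart q x * b x ^ 2 : ℝ) : ℂ) * u x) :
    ∃ J' M' D : L2 V →L[ℂ] L2 V, IsFormPair J' M' 1 ∧ HasFormRep (mulOp (negpart q)) J' M' ∧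
      (∀ u, 0 ≤ (inner ℂ u (M' u)).re) ∧ (∀ u, J' (D u) = J u) ∧
      ∀ u v, inner ℂ (D u) (M' (D v)) = inner ℂ u (Z v) := by
  have hn := negpart_nonneg q
  set w : V → ℝ := fun x => 1 + negpart q x with hw
  have hw1 : ∀ x, 1 ≤ w x := fun x => by simp only [hw]; linarith [hn x]
  have hw0 : ∀ x, 0 < w x := fun x => one_pos.trans_le (hw1 x)
  set d : V → ℝ := fun x => (√(w x))⁻¹ with hd
  have hd0 : ∀ x, 0 < d x := fun x => inv_pos.2 (Real.sqrt_pos.2 (hw0 x))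
  have hd2 : ∀ x, w x * d x ^ 2 = 1 := fun x => by
    simp only [hd]
    rw [inv_pow, Real.sq_sqrt (hw0 x).le, mul_inv_cancel₀ (hw0 x).ne']
  obtain ⟨J', hJ'⟩ := exists_diagonal (g := d) zero_le_one fun x => by
    rw [abs_of_pos (hd0 x)]
    exact inv_le_one_of_one_le₀ (Real.one_le_sqrt.2 (hw1 x))
  obtain ⟨M', hM'⟩ := exists_diagonal (g := fun x => negpart q x * d x ^ 2) zero_le_one
    fun x => by
      rw [abs_of_nonneg (mul_nonneg (hn x) (sq_nonneg _)), ← hd2 x]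
      exact mul_le_mul_of_nonneg_right (by simp only [hw]; linarith) (sq_nonneg _)
  -- q₋ is rescaled by its own weight d = (1 + q₋)^(-1/2); D = b/d changes between the two scalings
  -- and is bounded by `hK`.
  obtain ⟨D, hD⟩ := exists_diagonal (g := fun x => √(w x) * b x) (Real.sqrt_nonneg K) fun x => by
    refine Real.abs_le_sqrt ?_
    rw [mul_pow, Real.sq_sqrt (hw0 x).le]
    exact hK x
  have hnonneg := re_inner_diagonal_nonneg hM' fun x => mul_nonneg (hn x) (sq_nonneg _)
  have hDs := isSelfAdjoint_of_diagonal hD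
  have hp : IsFormPair J' M' 1 := by
    have hJs := isSelfAdjoint_of_diagonal hJ'
    refine ⟨hJs, fun u v h => lp.ext (funext fun x => ?_), isSelfAdjoint_of_diagonal hM',
      1, one_pos, fun u => ?_⟩
    · have := congrArg (fun f : L2 V => f x) h
      simp only [hJ'] at this
      exact mul_left_cancel₀ (Complex.ofReal_ne_zero.2 (hd0 x).ne') this
    · have h : M' u + J' (J' u) = u := by
        apply lp.ext
        funext x
        rw [lp.coeFn_add, Pi.add_apply, hM', hJ', hJ', ← mul_assoc, ← add_mul,
          ← Complex.ofReal_mul, ← Complex.ofReal_add]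
        rw [show negpart q x * d x ^ 2 + d x * d x = w x * d x ^ 2 by simp only [hw]; ring, hd2,
          Complex.ofReal_one, one_mul]
      rw [one_mul, one_mul, ← inner_self_re (J' u), inner_map_eq hJs, ← Complex.add_re,
        ← inner_add_right, h, inner_self_re]
  refine ⟨J', M', D, hp, hasFormRep_mulOp hp hd0 hJ' hM' fun x => by linarith [hn x], hnonneg,
    fun u => lp.ext (funext fun x => ?_), fun u v => ?_⟩
  · rw [hJ', hD, hJ, ← mul_assoc, ← Complex.ofReal_mul]
    rw [show d x * (√(w x) * b x) = b x by
      simp only [hd]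
      rw [← mul_assoc, inv_mul_cancel₀ (Real.sqrt_pos.2 (hw0 x)).ne', one_mul]]
  · rw [inner_map_eq hDs]
    congr 1
    apply lp.ext
    funext x
    rw [hD, hM', hD, hZ, ← mul_assoc, ← mul_assoc, ← Complex.ofReal_mul, ← Complex.ofReal_mul]
    rw [show √(w x) * b x * (negpart q x * d x ^ 2) * (√(w x) * b x)
        = (√(w x)) ^ 2 * d x ^ 2 * (negpart q x * b x ^ 2) by ring,
      Real.sq_sqrt (hw0 x).le, hd2, one_mul]

namespace ScaledForms

variable (hF : ScaledForms G (fun x y => ((θ x y).toCircle : ℂ)) q b J X A Z)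
include hF

/-- With α = 1/4, Z ≤ X/2 + CJ², and X + J² = 1 gives X - Z + (C + 1/2)J² ≥ 1/2. Subtracting A keeps
the fraction 1 - a' of this, at the cost of k'J². -/
theorem exists_isFormPair (hθ : ∀ x y, θ x y = -θ y x) (hq : MemKZeroPlus G θ q) {a' k' : ℝ}
    (ha' : 0 < a') (ha1 : a' < 1) (hk' : 0 ≤ k') (h : ∀ u, |(inner ℂ u (A u)).re| ≤
      a' * (inner ℂ u ((X - Z) u)).re + k' * ‖J u‖ ^ 2) :
    ∃ C, 0 < C ∧ (∀ x, 0 < degAdd G q x + C) ∧ IsFormPair J (X - Z) C ∧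
      IsFormPair J (X - A - Z) C ∧ IsFormPair J (X - A) C ∧
      ∀ x, 1 + ((G.degree x : ℝ) + pospart q x) ≤ 2 * (degAdd G q x + C) := by
  obtain ⟨C, hC, h1, h2⟩ := hF.exists_neg_le (α := 1 / 4) (by norm_num)
    (hq _ ⟨by norm_num, by norm_num⟩)
  have hX := hF.isSelfAdjoint_weight
  have hZ := hF.isSelfAdjoint_neg
  have hA := hF.isSelfAdjoint_hop (toCircle_conj hθ)
  have hcoer : ∀ u, (1 / 2 : ℝ) * ‖u‖ ^ 2 ≤ (inner ℂ u ((X - Z) u)).re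
      + (C + 1 / 2) * ‖J u‖ ^ 2 := by
    intro u
    have h3 := h2 u
    have h4 := hF.re_inner_weight_add u
    rw [sub_apply, inner_sub_right, Complex.sub_re]
    linarith
  have hdeg : ∀ x, 1 + ((G.degree x : ℝ) + pospart q x) ≤ 2 * (degAdd G q x + (C + 1 / 2)) := by
    intro x
    have h3 := h1 x
    have h4 := pospart_sub_negpart q x
    rw [degAdd]
    linarith
  have hp : IsFormPair J (X - Z) (C + 1 / 2) :=
    ⟨hF.isSelfAdjoint_scale, hF.injective, hX.sub hZ, 1 / 2, by norm_num, hcoer⟩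
  have hC' : C + 1 / 2 ≤ C + 1 / 2 + k' := by linarith
  have hp' : IsFormPair J (X - A - Z) (C + 1 / 2 + k') := by
    refine ⟨hF.isSelfAdjoint_scale, hF.injective, (hX.sub hA).sub hZ, (1 - a') / 2,
      by linarith, fun u => ?_⟩
    have h3 := (abs_le.1 (h u)).2
    have h4 := mul_le_mul_of_nonneg_left (hcoer u) (sub_pos.2 ha1).le
    have h5 : (inner ℂ u ((X - A - Z) u)).re
        = (inner ℂ u ((X - Z) u)).re - (inner ℂ u (A u)).re := by
      simp only [sub_apply, inner_sub_right, Complex.sub_re]; ring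
    rw [h5]
    nlinarith [mul_nonneg ha'.le (mul_nonneg (show 0 ≤ C + 1 / 2 by linarith)
      (sq_nonneg ‖J u‖))]
  have hd0 : ∀ x, (0 : ℝ) ≤ G.degree x := fun x => Nat.cast_nonneg _
  refine ⟨C + 1 / 2 + k', by linarith, fun x => ?_,
    hp.mono (hX.sub hZ) (fun u => le_rfl) hC', hp', hp'.mono (hX.sub hA) (fun u => ?_) le_rfl,
    fun x => (hdeg x).trans (by linarith)⟩
  · linarith [hdeg x, hd0 x, pospart_nonneg q x]
  · rw [sub_apply _ Z, inner_sub_right, Complex.sub_re]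
    linarith [hF.re_inner_neg_nonneg u]

theorem hasFormRep_degAdd {C : ℝ} (hp : IsFormPair J (X - Z) C)
    (hC : ∀ x, 0 < degAdd G q x + C) : HasFormRep (mulOp (degAdd G q)) J (X - Z) := by
  refine hasFormRep_mulOp hp hF.pos hF.scale_apply (fun u x => ?_) hC
  rw [sub_apply, lp.coeFn_sub, Pi.sub_apply, hF.weight_apply, hF.neg_apply, ← sub_mul,
    ← Complex.ofReal_sub, degAdd, ← pospart_sub_negpart q x]
  congr 2
  ring

theorem hasFormRep_magneticMaxOp {C : ℝ} (hp : IsFormPair J (X - A) C) (hC : 0 < C) :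
    HasFormRep (magneticMaxOp G θ (pospart q)) J (X - A) := by
  refine hasFormRep_maxOp hp hF.pos hF.scale_apply (fun u x => ?_)
    (eq_zero_of_magneticAction_add (pospart_nonneg q) hC)
  rw [magneticAction_apply, sub_apply, lp.coeFn_sub, Pi.sub_apply, hF.weight_apply, hF.hop_apply,
    hF.scale_apply]
  push_cast
  ring

theorem hasFormRep_magneticOp {C : ℝ} (hp : IsFormPair J (X - A) C) (hC : 0 < C) {K : ℝ}
    (hK : ∀ x, (1 + negpart q x) * b x ^ 2 ≤ K) :
    HasFormRep (magneticOp G θ q) J (X - A - Z) := by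
  obtain ⟨J', M', D, hp', hB, hM', hD, hZ⟩ :=
    exists_formRep_negpart hK hF.scale_apply hF.neg_apply
  refine hasFormRep_formSumSub hp (hF.hasFormRep_magneticMaxOp hp hC) (fun u => ?_) hp' hB hM' hD hZ
  rw [sub_apply, inner_sub_right, Complex.sub_re]
  linarith [(abs_le.1 (hF.abs_re_inner_hop_le_weight (fun x y => Circle.norm_coe _) u)).2]

end ScaledForms

end MagneticForms

/-! ### Behaviour at infinity, and transfer of the estimates to the operators. -/

section Asymptotics

variable {V : Type*} {G : SimpleGraph V} [G.LocallyFinite]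
variable {q : V → ℝ} {b : V → ℝ} {J X A Z : L2 V →L[ℂ] L2 V} {θ : V → V → Real.Angle}

theorem exists_finset_lt_of_liminf_eq_top {g : V → ℝ} (h : liminfAtInfinity g = ⊤) (r : ℝ) :
    ∃ W : Finset V, ∀ x ∉ W, r < g x := by
  obtain ⟨W, hW⟩ := iSup_eq_top.1 h (r : EReal) (EReal.coe_lt_top r)
  exact ⟨W, fun x hx => EReal.coe_lt_coe_iff.1 (hW.trans_le (iInf₂_le x hx))⟩

theorem infinite_setOf_lt_of_liminf_ne_top {g : V → ℝ} (h : liminfAtInfinity g ≠ ⊤) :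
    ∃ r : ℝ, {x | g x < r}.Infinite := by
  obtain ⟨r, hr, -⟩ := EReal.lt_iff_exists_real_btwn.1 (lt_top_iff_ne_top.2 h)
  refine ⟨r, fun hfin => ?_⟩
  have h1 := (le_iSup (fun W : Finset V => ⨅ x : V, ⨅ _ : x ∉ W, (g x : EReal))
    hfin.toFinset).trans_lt hr
  obtain ⟨x, hx⟩ := iInf_lt_iff.1 h1
  obtain ⟨hxW, hx⟩ := iInf_lt_iff.1 hx
  exact hxW (hfin.mem_toFinset.2 (EReal.coe_lt_coe_iff.1 hx))

theorem norm_sq_le_of_forall_sum_le {u : L2 V} {c : ℝ}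
    (h : ∀ s : Finset V, ∑ x ∈ s, ‖u x‖ ^ 2 ≤ c) : ‖u‖ ^ 2 ≤ c := by
  have hc : 0 ≤ c := by simpa using h ∅
  rw [← Real.sq_sqrt hc]
  refine pow_le_pow_left₀ (norm_nonneg _) ?_ 2
  refine lp.norm_le_of_forall_sum_le (by norm_num) (Real.sqrt_nonneg c) fun s => ?_
  simp only [ENNReal.toReal_ofNat, Real.rpow_ofNat]
  rw [Real.sq_sqrt hc]
  exact h s

theorem finite_of_single_mem [DecidableEq V] {E : Submodule ℂ (L2 V)} (hE : FiniteDimensional ℂ E)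
    {S : Set V} (h : ∀ x ∈ S, lp.single 2 x 1 ∈ E) : S.Finite := by
  have hli : LinearIndependent ℂ fun x : S => (⟨lp.single 2 x.1 1, h x x.2⟩ : E) := by
    rw [linearIndependent_iff']
    intro s c hc x hx
    have h1 := congrArg (fun f : E => (f : L2 V) x.1) hc
    simp only [Submodule.coe_sum, Submodule.coe_smul, lp.coeFn_sum, Finset.sum_apply,
      lp.coeFn_smul, Pi.smul_apply, smul_eq_mul, ZeroMemClass.coe_zero] at h1
    rw [Finset.sum_eq_single x] at h1
    · rwa [lp.single_apply_self, mul_one] at h1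
    · intro y _ hy
      rw [lp.single_apply_ne _ _ _ fun h' => hy (Subtype.ext h'.symm), mul_zero]
    · exact fun h' => absurd hx h'
  have : Finite S := hli.finite
  exact Set.toFinite S

theorem not_finiteDimensional [Infinite V] : ¬ FiniteDimensional ℂ (L2 V) := by
  classical
  intro h
  have : FiniteDimensional ℂ (⊤ : Submodule ℂ (L2 V)) := inferInstance
  exact Set.infinite_univ (finite_of_single_mem this fun x _ => trivial)

namespace ScaledForms

variable (hF : ScaledForms G (fun x y => ((θ x y).toCircle : ℂ)) q b J X A Z)
include hF

/-- K is spanned by the delta functions on a finite W outside which deg + q > ε⁻¹; there b² ≤ ε. -/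
theorem exists_norm_scale_le (h : liminfAtInfinity (degAdd G q) = ⊤) {ε : ℝ} (hε : 0 < ε) :
    ∃ K : Submodule ℂ (L2 V), FiniteDimensional ℂ K ∧ ∀ g ∈ Kᗮ, ‖J g‖ ^ 2 ≤ ε * ‖g‖ ^ 2 := by
  classical
  obtain ⟨W, hW⟩ := exists_finset_lt_of_liminf_eq_top h ε⁻¹
  refine ⟨Submodule.span ℂ ((fun x => lp.single 2 x 1) '' (W : Set V)),
    FiniteDimensional.span_of_finite ℂ (W.finite_toSet.image _), fun g hg => ?_⟩
  have h0 : ∀ x ∈ W, g x = 0 := by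
    intro x hx
    have h1 := (Submodule.mem_orthogonal _ _).1 hg (lp.single 2 x 1)
      (Submodule.subset_span ⟨x, hx, rfl⟩)
    rw [lp.inner_single_left] at h1
    simpa using h1
  have hb : ∀ x ∉ W, b x ^ 2 ≤ ε := by
    intro x hx
    have h1 := hW x hx
    have h2 := hF.mul_sq x
    have h3 : ε⁻¹ ≤ 1 + ((G.degree x : ℝ) + pospart q x) := by
      rw [degAdd] at h1
      linarith [le_max_left (q x) 0, show pospart q x = max (q x) 0 from rfl]
    have h4 := mul_le_mul_of_nonneg_right h3 (sq_nonneg (b x))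
    rw [h2] at h4
    rwa [inv_mul_le_iff₀ hε, mul_one] at h4
  refine norm_sq_le_of_forall_sum_le fun s => ?_
  refine le_trans ?_ (mul_le_mul_of_nonneg_left (sum_norm_sq_le g s) hε.le)
  rw [Finset.mul_sum]
  refine Finset.sum_le_sum fun x _ => ?_
  rw [hF.norm_scale_sq]
  by_cases hx : x ∈ W
  · rw [h0 x hx, norm_zero]; simp
  · exact mul_le_mul_of_nonneg_right (hb x hx) (sq_nonneg _)

/-- Otherwise deg + q < r on an infinite set S, where b² is bounded below. Then the form of R is
bounded below on functions supported in S, so these form a finite-dimensional space by discreteness,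
although it contains infinitely many delta functions. -/
theorem liminf_eq_top {C : ℝ} {R : L2 V →L[ℂ] L2 V} {T : L2 V →ₗ.[ℂ] L2 V} {c : ℝ} (hc : 0 < c)
    (hR : 0 ≤ R) (hlow : ∀ w, c * ‖J w‖ ^ 2 ≤ (inner ℂ w (R w)).re)
    (hrep : HasResolventRep T R C) (hT : HasPurelyDiscreteSpectrum T) {K : ℝ}
    (hdeg : ∀ x, 1 + ((G.degree x : ℝ) + pospart q x) ≤ 2 * (degAdd G q x + K)) :
    liminfAtInfinity (degAdd G q) = ⊤ := by
  classical
  by_contra hne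
  obtain ⟨r, hr⟩ := infinite_setOf_lt_of_liminf_ne_top hne
  set S : Set V := {x | degAdd G q x < r} with hS
  obtain ⟨x₀, hx₀ : degAdd G q x₀ < r⟩ := hr.nonempty
  have hw : ∀ x, (0 : ℝ) ≤ (G.degree x : ℝ) + pospart q x := fun x =>
    add_nonneg (Nat.cast_nonneg _) (pospart_nonneg q x)
  set m := 2 * (r + K) with hm
  have hm0 : 0 < m := by linarith [hdeg x₀, hw x₀]
  have hb : ∀ x ∈ S, 1 ≤ m * b x ^ 2 := by
    intro x (hx : degAdd G q x < r)
    rw [← hF.mul_sq x]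
    exact mul_le_mul_of_nonneg_right ((hdeg x).trans (by linarith)) (sq_nonneg _)
  let E : Submodule ℂ (L2 V) :=
    { carrier := {f | ∀ x ∉ S, f x = 0}
      zero_mem' := fun x _ => rfl
      add_mem' := fun {f g} hf hg x hx => by
        rw [lp.coeFn_add, Pi.add_apply, hf x hx, hg x hx, add_zero]
      smul_mem' := fun a f hf x hx => by
        rw [lp.coeFn_smul, Pi.smul_apply, hf x hx, smul_zero] }
  have hE : ∀ f ∈ E, c / m * ‖f‖ ^ 2 ≤ (inner ℂ f (R f)).re := by
    intro f hf
    refine le_trans ?_ (hlow f)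
    have : ‖f‖ ^ 2 ≤ m * ‖J f‖ ^ 2 := by
      refine norm_sq_le_of_forall_sum_le fun s => ?_
      refine le_trans ?_ (mul_le_mul_of_nonneg_left (sum_norm_sq_le (J f) s) hm0.le)
      rw [Finset.mul_sum]
      refine Finset.sum_le_sum fun x _ => ?_
      rw [hF.norm_scale_sq]
      by_cases hx : x ∈ S
      · have := mul_le_mul_of_nonneg_right (hb x hx) (sq_nonneg ‖f x‖)
        linarith
      · rw [hf x hx, norm_zero]; simp
    calc c / m * ‖f‖ ^ 2 ≤ c / m * (m * ‖J f‖ ^ 2) :=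
          mul_le_mul_of_nonneg_left this (div_pos hc hm0).le
      _ = c * ‖J f‖ ^ 2 := by field_simp
  have hfd := DiscreteAbove.finiteDimensional_of_lower_bound (IsSelfAdjoint.of_nonneg hR)
    (hrep.discreteAbove hR hT) (div_pos hc hm0) hE
  refine hr (finite_of_single_mem hfd fun x hx y hy => ?_)
  exact lp.single_apply_ne _ _ _ fun h => hy (h ▸ hx)

theorem hasPurelyDiscreteSpectrum_iff {C : ℝ} {M : L2 V →L[ℂ] L2 V} {T : L2 V →ₗ.[ℂ] L2 V}
    (hp : IsFormPair J M C) (hT : HasFormRep T J M) {K : ℝ}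
    (hdeg : ∀ x, 1 + ((G.degree x : ℝ) + pospart q x) ≤ 2 * (degAdd G q x + K)) :
    HasPurelyDiscreteSpectrum T ↔ liminfAtInfinity (degAdd G q) = ⊤ := by
  obtain ⟨R, -, hRs, -, -, -, -, -, ⟨c, hc, hlow⟩, ⟨c', hc', hup⟩, hrep⟩ := hp.exists_resolvent
  have hR : 0 ≤ R := (nonneg_iff_re_inner hRs).2 fun w => by
    rw [re_inner_comm]
    exact (mul_nonneg hc.le (sq_nonneg _)).trans (hlow w)
  exact ⟨fun h => hF.liminf_eq_top hc hR hlow (hrep T hT) h hdeg,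
    fun h => (hrep T hT).hasPurelyDiscreteSpectrum hR
      (smallOffFinite_of_le hc' hup fun ε hε => hF.exists_norm_scale_le h hε)⟩

theorem re_inner_degAdd {u : L2 V} {W : Finset V} (hu : ∀ x ∉ W, u x = 0) :
    (inner ℂ u ((X - Z) u)).re = ∑ x ∈ W, degAdd G q x * ‖J u x‖ ^ 2 := by
  rw [sub_apply, inner_sub_right, Complex.sub_re, hF.re_inner_weight hu, hF.re_inner_neg hu,
    ← Finset.sum_sub_distrib]
  refine Finset.sum_congr rfl fun x _ => ?_
  rw [degAdd, ← pospart_sub_negpart q x]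
  ring

/-- C_c(V) lies in the domain: for u supported in W, (X - A - Z)u is supported in W and its
neighbours, a finite set, and is therefore in ran J. -/
theorem exists_re_inner_magneticOp (hT : HasFormRep (magneticOp G θ q) J (X - A - Z))
    {φ : L2 V} (hφ : φ ∈ Cc V) : ∃ (u : L2 V) (W : Finset V) (h : φ ∈ (magneticOp G θ q).domain),
      J u = φ ∧ (∀ x ∉ W, u x = 0) ∧ (inner ℂ φ (magneticOp G θ q ⟨φ, h⟩)).re
        = (inner ℂ u ((X - Z) u)).re - (inner ℂ u (A u)).re := by
  classical
  obtain ⟨W, hW⟩ := exists_finset_of_mem_Cc hφ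
  obtain ⟨u, rfl, hu⟩ := hF.exists_scale_eq hW
  obtain ⟨y, hy, -⟩ := hF.exists_scale_eq (φ := (X - A - Z) u)
    (W := W ∪ W.biUnion fun x => G.neighborFinset x) fun x hx => by
      rw [Finset.mem_union, not_or] at hx
      rw [sub_apply, sub_apply, lp.coeFn_sub, lp.coeFn_sub, Pi.sub_apply, Pi.sub_apply,
        hF.weight_apply, hF.neg_apply, hF.hop_apply, hu x hx.1, Finset.sum_eq_zero]
      · simp
      · intro z hz
        have hzW : z ∉ W := fun h => hx.2 (Finset.mem_biUnion.2 ⟨z, h,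
          (SimpleGraph.mem_neighborFinset _ _ _).2
            (G.adj_symm ((SimpleGraph.mem_neighborFinset _ _ _).1 hz))⟩)
        rw [hF.scale_eq_zero (hu z hzW), mul_zero]
  have hgr : (J u, y) ∈ (magneticOp G θ q).graph := (hT _ _).2 ⟨u, rfl, hy.symm⟩
  obtain ⟨⟨v, hv⟩, hvu, hvy⟩ := (LinearPMap.mem_graph_iff _).1 hgr
  simp only at hvu hvy
  subst hvu
  refine ⟨u, W, hv, rfl, hu, ?_⟩
  rw [hvy, inner_map_eq hF.isSelfAdjoint_scale, hy]
  simp only [sub_apply, inner_sub_right, Complex.sub_re]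
  ring

end ScaledForms

theorem exists_re_inner_mulOp (g : V → ℝ) {φ : L2 V} {W : Finset V} (hW : ∀ x ∉ W, φ x = 0) :
    ∃ h : φ ∈ (mulOp g).domain,
      (inner ℂ φ (mulOp g ⟨φ, h⟩)).re = ∑ x ∈ W, g x * ‖φ x‖ ^ 2 := by
  obtain ⟨ψ, hψ⟩ := exists_lp_of_finset (fun x => (g x : ℂ) * φ x) W fun x hx => by
    rw [hW x hx, mul_zero]
  have hgr : (φ, ψ) ∈ (mulOp g).graph := mem_maxOp_graph.2 fun x => (hψ x).symm
  obtain ⟨⟨v, hv⟩, hvu, hvy⟩ := (LinearPMap.mem_graph_iff _).1 hgr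
  simp only at hvu hvy
  subst hvu
  refine ⟨hv, ?_⟩
  rw [hvy, inner_eq_sum hW, Complex.re_sum]
  refine Finset.sum_congr rfl fun x _ => ?_
  rw [hψ, mul_left_comm, ← Complex.normSq_eq_conj_mul_self, ← Complex.ofReal_mul,
    Complex.ofReal_re, Complex.normSq_eq_norm_sq]

theorem ScaledForms.opLEOn (hF : ScaledForms G (fun x y => ((θ x y).toCircle : ℂ)) q b J X A Z)
    (hT : HasFormRep (magneticOp G θ q) J (X - A - Z)) {a' k' : ℝ}
    (h : ∀ u, |(inner ℂ u (A u)).re| ≤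
      a' * (inner ℂ u ((X - Z) u)).re + k' * ‖J u‖ ^ 2) :
    OpLEOn (Cc V) (mulOp fun x => (1 - a') * degAdd G q x - k') (magneticOp G θ q) ∧
      OpLEOn (Cc V) (magneticOp G θ q) (mulOp fun x => (1 + a') * degAdd G q x + k') := by
  have key : ∀ (r s : ℝ) (φ : L2 V) (W : Finset V),
      ∑ x ∈ W, (r * degAdd G q x + s) * ‖φ x‖ ^ 2
        = r * ∑ x ∈ W, degAdd G q x * ‖φ x‖ ^ 2 + s * ∑ x ∈ W, ‖φ x‖ ^ 2 := by
    intro r s φ W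
    rw [Finset.mul_sum, Finset.mul_sum, ← Finset.sum_add_distrib]
    exact Finset.sum_congr rfl fun x _ => by ring
  constructor
  · intro φ hφ
    obtain ⟨u, W, h₂, rfl, hu, h2⟩ := hF.exists_re_inner_magneticOp hT hφ
    obtain ⟨h₁, h1⟩ := exists_re_inner_mulOp (fun x => (1 - a') * degAdd G q x - k')
      fun x hx => hF.scale_eq_zero (hu x hx)
    refine ⟨h₁, h₂, ?_⟩
    rw [h1, h2]
    simp only [sub_eq_add_neg _ k']
    rw [key, ← hF.re_inner_degAdd hu, ← hF.norm_scale_eq hu]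
    linarith [(abs_le.1 (h u)).2]
  · intro φ hφ
    obtain ⟨u, W, h₁, rfl, hu, h1⟩ := hF.exists_re_inner_magneticOp hT hφ
    obtain ⟨h₂, h2⟩ := exists_re_inner_mulOp (fun x => (1 + a') * degAdd G q x + k')
      fun x hx => hF.scale_eq_zero (hu x hx)
    refine ⟨h₁, h₂, ?_⟩
    rw [h1, h2, key, ← hF.re_inner_degAdd hu, ← hF.norm_scale_eq hu]
    linarith [(abs_le.1 (h u)).1]

end Asymptotics

end SparseMagnetic

/-! ### The theorem. -/

theorem theoremt {V : Type*} [Countable V] (G : SimpleGraph V) [G.LocallyFinite]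
    (θ : V → V → Real.Angle) (hθ : ∀ x y, θ x y = -θ y x)
    (q : V → ℝ) (hq : MemKZeroPlus G θ q)
    (a k : ℝ) (ha : 0 ≤ a) (hk : 0 ≤ k) (hsparse : IsSparse G q a k) :
    IsSelfAdjoint (magneticOp G θ q) ∧
    (∃ a' k' : ℝ, 0 < a' ∧ a' < 1 ∧ 0 ≤ k' ∧
      OpLEOn (Cc V) (mulOp fun x => (1 - a') * degAdd G q x - k') (magneticOp G θ q) ∧
      OpLEOn (Cc V) (magneticOp G θ q) (mulOp fun x => (1 + a') * degAdd G q x + k')) ∧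
    absSqrtDomain (magneticOp G θ q) = absSqrtDomain (mulOp (degAdd G q)) ∧
    (HasPurelyDiscreteSpectrum (magneticOp G θ q) ↔ liminfAtInfinity (degAdd G q) = ⊤) ∧
    (Infinite V → liminfAtInfinity (degAdd G q) = ⊤ → IsAlmostSparse G q →
      ∃ ev evDeg : ℕ → ℝ,
        IsEigenvalueSequence (magneticOp G θ q) ev ∧
        IsEigenvalueSequence (mulOp (degAdd G q)) evDeg ∧
        Filter.Tendsto (fun n => ev n / evDeg n) Filter.atTop (nhds 1)) := by
  -- Any α in (0,1) would do here: only a pointwise bound of q₋ by a multiple of 1 + deg + q₊ is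
  -- needed, so that Z is bounded.
  obtain ⟨K, hK, hKq⟩ := (hq (1 / 2) ⟨by norm_num, by norm_num⟩).negpart_le
  have hw : ∀ x, (0 : ℝ) ≤ (G.degree x : ℝ) + pospart q x := fun x =>
    add_nonneg (Nat.cast_nonneg _) (pospart_nonneg q x)
  have hKw : ∀ x, negpart q x ≤ (K + 1) * (1 + ((G.degree x : ℝ) + pospart q x)) := fun x => by
    nlinarith [hKq x, hw x, mul_nonneg hK (hw x)]
  obtain ⟨b, J, X, A, Z, hF⟩ := exists_scaledForms (G := G) (q := q)
    (e := fun x y => ((θ x y).toCircle : ℂ)) (fun x y => Circle.norm_coe _) hKw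
  have hKb : ∀ x, (1 + negpart q x) * b x ^ 2 ≤ K + 2 := fun x => by
    have h1 : 1 + negpart q x ≤ (K + 2) * (1 + ((G.degree x : ℝ) + pospart q x)) := by
      linarith [hKw x, hw x]
    refine (mul_le_mul_of_nonneg_right h1 (sq_nonneg (b x))).trans (le_of_eq ?_)
    rw [mul_assoc, hF.mul_sq, mul_one]
  obtain ⟨a', k', ha', ha1, hk', hA⟩ := hF.exists_abs_hop_le_of_isSparse hθ hq hsparse ha hk
  obtain ⟨C, hC, hCd, hpD, hpT, hpA, hdeg⟩ := hF.exists_isFormPair hθ hq ha' ha1 hk' hA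
  have hT := hF.hasFormRep_magneticOp hpA hC hKb
  have hD := hF.hasFormRep_degAdd hpD hCd
  refine ⟨hpT.isSelfAdjoint hT, ⟨a', k', ha', ha1, hk', hF.opLEOn hT hA⟩, ?_,
    hF.hasPurelyDiscreteSpectrum_iff hpT hT hdeg, fun hV hlim has => ?_⟩
  -- Both form domains are ran J with the same J.
  · ext φ
    rw [mem_absSqrtDomain_iff hpT hT, mem_absSqrtDomain_iff hpD hD]
  · obtain ⟨ev, h1, -, h2⟩ := exists_eigenvalueSequence hpT hT not_finiteDimensional
      fun ε hε => hF.exists_norm_scale_le hlim hε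
    obtain ⟨evDeg, h3, h4, h5⟩ := exists_eigenvalueSequence hpD hD not_finiteDimensional
      fun ε hε => hF.exists_norm_scale_le hlim hε
    refine ⟨ev, evDeg, h1, h3, tendsto_div_of_bounds h4 fun r hr hr1 => ?_⟩
    obtain ⟨s, hs, hb⟩ := hF.exists_abs_hop_le_of_isAlmostSparse hθ hq has hr
    have hsplit : ∀ u, (inner ℂ u ((X - A - Z) u)).re
        = (inner ℂ u ((X - Z) u)).re - (inner ℂ u (A u)).re := fun u => by
      simp only [sub_apply, inner_sub_right, Complex.sub_re]; ring
    refine ⟨s, fun n => ⟨?_, ?_⟩⟩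
    -- Both forms use the same J, so the inequalities (1 - r)(X - Z) - sJ² ≤ X - A - Z ≤ (1 + r)(X -
    -- Z) + sJ² pass to the n-th eigenvalues.
    · have := h5.le_of_form_le hF.injective h2 (a := 1) (b := 1 - r) (k := s) zero_le_one
        (by linarith) (fun u => by
          rw [hsplit]; linarith [(abs_le.1 (hb u)).2]) n
      linarith
    · have := h2.le_of_form_le hF.injective h5 (a := 1 + r) (b := 1) (k := s) (by linarith)
        zero_le_one (fun u => by
          rw [hsplit]; linarith [(abs_le.1 (hb u)).1]) n
      linarith
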